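/- **Machine covering with migration.** Jobs with processing times \(p_0,p_1,p_2,\dots>0\) arrive one at a time and are assigned to \(m\ge 1\) identical machines. The load of a machine is the sum of the processing times of its jobs, and the goal is to maximize the minimum machine load; \(\mathrm{OPT}_n\) denotes the optimal value for the first \(n\) jobs. When a job \(j^*\) arrives, already assigned jobs may be reassigned. An online algorithm is \(\rho\)-competitive if after every arrival \(\mathrm{OPT}_n\le\rho\cdot\ell_{\min}\), where \(\ell_{\min}\) is the minimum load of its current schedule. It has migration factor \(\beta\) if at every arrival the total processing time of the reassigned old jobs is at most \(\beta p_{j^*}\). **Algorithm Online LPT**, for \(0<\varepsilon<1\) with \(1/\varepsilon\in\mathbb Z\). Given the current schedule \(\mathcal S\) of the old jobs \(\mathcal J\), at the arrival of \(j^*\) a schedule \(\mathcal S'\) of \(\mathcal J'=\mathcal J\cup\{j^*\}\) is constructed as follows. Processing times are rounded down to \(\tilde p_j=2^{e}+\lfloor (p_j-2^{e})/(\varepsilon 2^{e})\rfloor\,\varepsilon 2^{e}\), where \(e\in\mathbb Z\) and \(2^{e}\le p_j<2^{e+1}\); sizes and loads in the algorithm are the rounded ones. List scheduling assigns given jobs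 one by one to a least loaded machine; LPT is list scheduling in non-increasing order of size. 1. Run LPT on \(\mathcal J'\), let \(\tau\) be the minimum load obtained, and put \(\mathrm{UB}=2\tau\) and \(\{\ell,\dots,u\}=\{i\in\mathbb Z:\varepsilon\,\mathrm{UB}\le 2^i<\mathrm{UB}\}\). A job is small if \(\tilde p_j<2^\ell\), huge if \(\tilde p_j\ge 2^{u+1}\), and big otherwise. Let \(q_1>\dots>q_r\) be the numbers \(2^i+k\varepsilon2^i\) with \(\ell\le i\le u\), \(0\le k<1/\varepsilon\). (If \(\mathrm{UB}=0\), all jobs are huge and \(r=0\).) 2. For \(h=0,1,\dots,r\), assign the huge jobs (if \(h=0\)) or the jobs of size \(q_h\) (if \(h\ge1\)): first, every such job of \(\mathcal J\) that \(\mathcal S\) assigns to a machine in \(\mathcal M^=_{h-1}\) is assigned to this same machine; then the remaining such jobs are assigned by list scheduling, ties between least loaded machines being broken in favor of machines not in \(\mathcal M^=_{h-1}\). Here \(\mathcal M^=_{-1}\) is the set of all machines, and \(\mathcal M^=_h\) is the set of the machines to which \(\mathcal S\) and \(\mathcal S'\) assign the same set of jobs among the jobs of the classes \(0,\dots,h\).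 3. Assign every small job of \(\mathcal J\) that \(\mathcal S\) assigns to a machine in \(\mathcal M^=_r\) to this same machine, and the remaining jobs by list scheduling. 4. While some machine that contains a small job has load greater than \(\ell_{\min}(\mathcal S')+2^\ell\): take a machine of maximum load among those that contain a small job, and reassign a smallest job on it to a least loaded machine. All orders and ties that are not specified are arbitrary. **Theorem.** The following holds however these free choices are made, with absolute constants in the \(O\)-terms. - Online LPT runs in polynomial time: for rational processing times, each call takes time polynomial in \(m\), \(1/\varepsilon\) and the total bit length of the processing times of the jobs present. - On \(m\) machines, Online LPT is \(\left(\frac{4m-2}{3m-1}+O(\varepsilon)\right)\)-competitive, as \(\varepsilon\to0\). - Online LPT has migration factor \(O\!\left(\frac1{\varepsilon^3}\log\frac1\varepsilon\right)\). - Consequently, for every \(0<\delta\le\frac12\) there is \(\varepsilon\) with \(1/\varepsilon\in\mathbb Z\) and \(1/\varepsilon=O(1/\delta)\) such that, for every \(m\ge1\), Online LPT with parameter \(\varepsilon\) is \(\left(\frac43+\delta\right)\)-competitive with migration factor \(O\!\left(\frac1{\delta^3}\log\frac1\delta\right)\). -/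

import Mathlib

/-! A small language for algorithms with a running-time clock and with unresolved choices.

A program reads and changes a state that holds a clock and a stream of natural numbers. Whenever
the algorithm may choose freely (ties, arbitrary orders), the next number of the stream selects one
of the admissible candidates, so quantifying over all streams is the same as quantifying over all
ways to resolve the free choices. The result `none` means that the program does not terminate
or has nothing to choose from. -/

/-- The clock and the pending numbers that resolve free choices. -/
structure RunState where
  clock : ℕ
  coins : ℕ → ℕ

/-- Programs with result in `α`. -/
abbrev Prog (α : Type) : Type := StateT RunState Option α

namespace Prog

/-- Let the clock advance by `c`. -/
def tick (c : ℕ) : Prog Unit := fun s => some ((), { s with clock := s.clock + c })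

/-- Choose an arbitrary element of a list (no result if the list is empty). -/
def pick {α : Type} (l : List α) : Prog α := fun s =>
  (l[s.coins 0 % l.length]?).map fun a =>
    (a, { clock := s.clock + l.length + 1, coins := fun k => s.coins (k + 1) })

/-- The sublist of the elements that pass a test. -/
def filter {α : Type} (t : α → Prog Bool) : List α → Prog (List α)
  | [] => pure []
  | a :: l => do
    tick 1
    let b ← t a
    let r ← filter t l
    pure (if b then a :: r else r)

/-- Do all elements of a list pass a test? -/
def all {α : Type} (t : α → Prog Bool) : List α → Prog Bool
  | [] => pure true
  | a :: l => do
    tick 1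
    let b ← t a
    let r ← all t l
    pure (b && r)

/-- Apply a program to every element of a list. -/
def map {α β : Type} (f : α → Prog β) : List α → Prog (List β)
  | [] => pure []
  | a :: l => do
    tick 1
    let b ← f a
    let r ← map f l
    pure (b :: r)

/-- Run through a list from left to right, updating a value. -/
def fold {α β : Type} (f : β → α → Prog β) : β → List α → Prog β
  | b, [] => pure b
  | b, a :: l => do
    tick 1
    let b' ← f b a
    fold f b' l

/-- Membership in a list, by scanning it. -/
def mem {α : Type} [DecidableEq α] (a : α) (l : List α) : Prog Bool := do
  tick (l.length + 1)
  pure (decide (a ∈ l))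

/-- Repeat `body` until it returns `true`, but at most `k` times; `none` if that is not enough. -/
def loopAtMost {α : Type} (body : α → Prog (α × Bool)) : ℕ → α → Prog α
  | 0, _ => fun _ => none
  | k + 1, a => do
    let r ← body a
    if r.2 then pure r.1 else loopAtMost body k r.1

open Classical in
/-- Repeat `body` until it returns `true`; `none` if that never happens. -/
noncomputable def loop {α : Type} (body : α → Prog (α × Bool)) (a : α) : Prog α := fun s =>
  if h : ∃ k, (loopAtMost body k a s).isSome then loopAtMost body (Nat.find h) a s else none

section Arithmetic

/-! Arithmetic on numbers. `size x` is the length of the representation of `x`; an arithmetic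
operation on `x, y` is charged `(1 + size x + size y) ^ 2`, as in schoolbook arithmetic. -/

variable {F : Type} [Field F] [LinearOrder F] [IsStrictOrderedRing F] [FloorRing F]

/-- The charge for an arithmetic operation on the given operands. -/
def charge (size : F → ℕ) (operands : List F) : Prog Unit :=
  tick ((1 + (operands.map size).sum) ^ 2)

def add (size : F → ℕ) (x y : F) : Prog F := do
  charge size [x, y]
  pure (x + y)

def sub (size : F → ℕ) (x y : F) : Prog F := do
  charge size [x, y]
  pure (x - y)

def mul (size : F → ℕ) (x y : F) : Prog F := do
  charge size [x, y]
  pure (x * y)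

def div (size : F → ℕ) (x y : F) : Prog F := do
  charge size [x, y]
  pure (x / y)

def lt (size : F → ℕ) (x y : F) : Prog Bool := do
  charge size [x, y]
  pure (decide (x < y))

def le (size : F → ℕ) (x y : F) : Prog Bool := do
  charge size [x, y]
  pure (decide (x ≤ y))

def eq (size : F → ℕ) (x y : F) : Prog Bool := do
  charge size [x, y]
  pure (decide (x = y))

def floor (size : F → ℕ) (x : F) : Prog F := do
  charge size [x]
  pure (⌊x⌋ : F)

/-- The largest integer `e` with `2 ^ e ≤ x`, for `x > 0`. -/
def log2 (size : F → ℕ) (x : F) : Prog ℤ := do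
  charge size [x]
  pure (Int.log 2 x)

/-- The smallest integer `e` with `x ≤ 2 ^ e`, for `x > 0`. -/
def clog2 (size : F → ℕ) (x : F) : Prog ℤ := do
  charge size [x]
  pure (Int.clog 2 x)

/-- The number `2 ^ e`; its representation has about `|e|` digits. -/
def pow2 (e : ℤ) : Prog F := do
  tick ((1 + e.natAbs) ^ 2)
  pure ((2 : F) ^ e)

end Arithmetic

end Prog

/-- A (partial) assignment of the jobs `0, 1, 2, …` to `m` machines. -/
abbrev Sched (m : ℕ) : Type := ℕ → Option (Fin m)

/-- The assignment of no job. -/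
def emptySched (m : ℕ) : Sched m := fun _ => none

/-! The algorithm. Jobs are numbered in the order of their arrival. When job `n` arrives, the old
job set is `{0, …, n - 1}` and the new one is `{0, …, n}`. The accuracy is `ε = 1 / K`. -/

namespace OnlineLPT

section Algorithm

variable {F : Type} [Field F] [LinearOrder F] [IsStrictOrderedRing F] [FloorRing F]

/-- Round `x ∈ [2 ^ e, 2 ^ (e + 1))` down to a number `2 ^ e + k ε 2 ^ e`. -/
def roundDown (size : F → ℕ) (K : ℕ) (x : F) : Prog F := do
  let e ← Prog.log2 size x
  let b ← Prog.pow2 e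
  let g ← Prog.div size b (K : F)
  let d ← Prog.sub size x b
  let r ← Prog.div size d g
  let k ← Prog.floor size r
  let t ← Prog.mul size k g
  Prog.add size b t

/-- The table of the rounded sizes of the jobs `0, …, n`. -/
def roundAll (size : F → ℕ) (K : ℕ) (p : ℕ → F) (n : ℕ) : Prog (ℕ → F) :=
  Prog.fold (fun q j => do
    let x ← roundDown size K (p j)
    pure (Function.update q j x)) (fun _ => 0) (List.range (n + 1))

/-- The load of machine `i`. -/
def load {m : ℕ} (size : F → ℕ) (q : ℕ → F) (n : ℕ) (σ : Sched m) (i : Fin m) : Prog F :=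
  Prog.fold (fun a j => if σ j = some i then Prog.add size a (q j) else pure a) 0
    (List.range (n + 1))

/-- The list of all least loaded machines. -/
def leastLoaded {m : ℕ} (size : F → ℕ) (q : ℕ → F) (n : ℕ) (σ : Sched m) : Prog (List (Fin m)) :=
  Prog.filter (fun i => Prog.all (fun i' => do
    let a ← load size q n σ i
    let b ← load size q n σ i'
    Prog.le size a b) (List.finRange m)) (List.finRange m)

/-- An arbitrary least loaded machine; ties are broken in favor of the machines in `pref`, and
arbitrarily apart from that. -/
def pickLeast {m : ℕ} (size : F → ℕ) (q : ℕ → F) (n : ℕ) (pref : List (Fin m)) (σ : Sched m) :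
    Prog (Fin m) := do
  let L ← leastLoaded size q n σ
  let L' ← Prog.filter (fun i => Prog.mem i pref) L
  Prog.pick (if L'.isEmpty then L else L')

/-- List scheduling of `k` jobs from the list `js`, in an arbitrary order. -/
def listSchedule {m : ℕ} (size : F → ℕ) (q : ℕ → F) (n : ℕ) (pref : List (Fin m)) :
    ℕ → List ℕ → Sched m → Prog (Sched m)
  | 0, _, σ => pure σ
  | k + 1, js, σ => do
    let j ← Prog.pick js
    let i ← pickLeast size q n pref σ
    Prog.tick (js.length + 1)
    listSchedule size q n pref k (js.erase j) (Function.update σ j (some i))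

/-- List scheduling of all jobs in the list `js` that are not assigned yet. -/
def scheduleRest {m : ℕ} (size : F → ℕ) (q : ℕ → F) (n : ℕ) (pref : List (Fin m))
    (js : List ℕ) (σ : Sched m) : Prog (Sched m) := do
  let rest ← Prog.filter (fun j => pure (σ j).isNone) js
  listSchedule size q n pref rest.length rest σ

/-- The elements of the list `js` of maximum size. -/
def largest (size : F → ℕ) (q : ℕ → F) (js : List ℕ) : Prog (List ℕ) :=
  Prog.filter (fun j => Prog.all (fun j' => Prog.le size (q j') (q j)) js) js

/-- The elements of the list `js` of minimum size. -/
def smallest (size : F → ℕ) (q : ℕ → F) (js : List ℕ) : Prog (List ℕ) :=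
  Prog.filter (fun j => Prog.all (fun j' => Prog.le size (q j) (q j')) js) js

/-- `k` rounds of LPT: assign a largest unassigned job to a least loaded machine. -/
def lpt {m : ℕ} (size : F → ℕ) (q : ℕ → F) (n : ℕ) : ℕ → Sched m → Prog (Sched m)
  | 0, σ => pure σ
  | k + 1, σ => do
    let js ← Prog.filter (fun j => pure (σ j).isNone) (List.range (n + 1))
    let L ← largest size q js
    let j ← Prog.pick L
    let i ← pickLeast size q n [] σ
    lpt size q n k (Function.update σ j (some i))

/-- The exponents `l, …, c - 1`, in decreasing order. -/
def exponents (l c : ℤ) : List ℤ := (List.range (c - l).toNat).map fun t => c - 1 - (t : ℤ)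

/-- From the upper bound `UB`, compute `2 ^ ℓ` and `2 ^ (u + 1)`, where
`{ℓ, …, u} = {i : ε UB ≤ 2 ^ i < UB}`, and the list, in decreasing order, of the rounded sizes
`2 ^ i + k ε 2 ^ i` with `ℓ ≤ i ≤ u` and `0 ≤ k < 1 / ε`. If `UB = 0`, there are no such sizes and
both thresholds are `0`: every job counts as huge. -/
def thresholds (size : F → ℕ) (K : ℕ) (UB : F) : Prog (F × F × List F) := do
  let pos ← Prog.lt size 0 UB
  if pos then
    let x ← Prog.div size UB (K : F)
    let l ← Prog.clog2 size x
    let c ← Prog.clog2 size UB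
    let lo ← Prog.pow2 l
    let hi ← Prog.pow2 c
    let P ← Prog.map (fun i => do
      let b ← Prog.pow2 i
      let g ← Prog.div size b (K : F)
      Prog.map (fun k : ℕ => do
        let t ← Prog.mul size (k : F) g
        Prog.add size b t) (List.range K).reverse) (exponents l c)
    pure (lo, hi, P.flatten)
  else
    pure (0, 0, [])

/-- Assign the jobs of the list `js` to the same machine as in `σ` if that machine is not in `ne`.
-/
def keep {m : ℕ} (σ : Sched m) (ne : List (Fin m)) (js : List ℕ) (σ' : Sched m) :
    Prog (Sched m) :=
  Prog.fold (fun τ j =>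
    match σ j with
    | none => pure τ
    | some i => do
      let b ← Prog.mem i ne
      pure (if b then τ else Function.update τ j (some i))) σ' js

/-- The machines to which `σ` and `σ'` assign different sets of jobs of size at least `x`. -/
def differing {m : ℕ} (size : F → ℕ) (q : ℕ → F) (n : ℕ) (x : F) (σ σ' : Sched m) :
    Prog (List (Fin m)) :=
  Prog.filter (fun i => do
    let same ← Prog.all (fun j => do
      let b ← Prog.lt size (q j) x
      pure (b || decide (σ j = some i ↔ σ' j = some i))) (List.range (n + 1))
    pure (!same)) (List.finRange m)

/-- One phase: assign the jobs that pass the test `t`. The second component of the state is the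
list of the machines whose assignments differ so far; `x` is a lower bound on the sizes of the jobs
treated up to this phase. -/
def phase {m : ℕ} (size : F → ℕ) (q : ℕ → F) (n : ℕ) (σ : Sched m) (t : ℕ → Prog Bool) (x : F)
    (st : Sched m × List (Fin m)) : Prog (Sched m × List (Fin m)) := do
  let js ← Prog.filter t (List.range (n + 1))
  let σ₁ ← keep σ st.2 js st.1
  let σ₂ ← scheduleRest size q n st.2 js σ₁
  let ne ← differing size q n x σ σ₂
  pure (σ₂, ne)

/-- The jobs on machine `i`. -/
def jobsOn {m : ℕ} (n : ℕ) (σ : Sched m) (i : Fin m) : Prog (List ℕ) :=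
  Prog.filter (fun j => pure (decide (σ j = some i))) (List.range (n + 1))

/-- The machines that contain a job of size less than `lo`. -/
def withSmall {m : ℕ} (size : F → ℕ) (q : ℕ → F) (n : ℕ) (lo : F) (σ : Sched m) :
    Prog (List (Fin m)) :=
  Prog.filter (fun i => do
    let js ← jobsOn n σ i
    let sm ← Prog.filter (fun j => Prog.lt size (q j) lo) js
    pure (!sm.isEmpty)) (List.finRange m)

/-- The machines in the list `M` of maximum load. -/
def mostLoaded {m : ℕ} (size : F → ℕ) (q : ℕ → F) (n : ℕ) (σ : Sched m) (M : List (Fin m)) :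
    Prog (List (Fin m)) :=
  Prog.filter (fun i => Prog.all (fun i' => do
    let a ← load size q n σ i
    let b ← load size q n σ i'
    Prog.le size b a) M) M

/-- One evaluation of the condition of the final loop and, if it holds, of its body: if some machine
that contains a small job has load more than `lo` above the minimum load, move a smallest job from
such a machine of maximum load to a least loaded machine; otherwise signal the end of the loop. -/
def rebalanceStep {m : ℕ} (size : F → ℕ) (q : ℕ → F) (n : ℕ) (lo : F) (σ : Sched m) :
    Prog (Sched m × Bool) := do
  let M ← withSmall size q n lo σ
  let k ← pickLeast size q n [] σ
  let bad ← Prog.filter (fun i => do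
    let a ← load size q n σ k
    let b ← Prog.add size a lo
    let c ← load size q n σ i
    Prog.lt size b c) M
  if bad.isEmpty then
    pure (σ, true)
  else
    let top ← mostLoaded size q n σ M
    let i ← Prog.pick top
    let js ← jobsOn n σ i
    let L ← smallest size q js
    let j ← Prog.pick L
    pure (Function.update σ j (some k), false)

/-- Algorithm Online LPT with accuracy `ε = 1 / K`, called when job `n` arrives. Input: the sizes
`p` of the jobs `0, …, n` and the current assignment `σ` of the jobs `0, …, n - 1`. Output: an
assignment of the jobs `0, …, n`. -/
noncomputable def onlineLPT {m : ℕ} (size : F → ℕ) (K : ℕ) (p : ℕ → F) (n : ℕ) (σ : Sched m) :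
    Prog (Sched m) := do
  let q ← roundAll size K p n
  let σL ← lpt size q n (n + 1) (emptySched m)
  let i ← pickLeast size q n [] σL
  let τ ← load size q n σL i
  let UB ← Prog.add size τ τ
  let th ← thresholds size K UB
  let lo := th.1
  let hi := th.2.1
  let P := th.2.2
  let st₀ ← phase size q n σ (fun j => Prog.le size hi (q j)) hi (emptySched m, [])
  let st ← Prog.fold (fun st x => phase size q n σ (fun j => Prog.eq size (q j) x) x st) st₀ P
  let small ← Prog.filter (fun j => Prog.lt size (q j) lo) (List.range (n + 1))
  let σ₁ ← keep σ st.2 small st.1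
  let σ₂ ← scheduleRest size q n [] (List.range (n + 1)) σ₁
  Prog.loop (rebalanceStep size q n lo) σ₂

/-- `S n` is the assignment after the arrival of the first `n` jobs, and `T n` is the running time
of the call at the arrival of job `n`, if the algorithm starts with no job and resolves its free
choices in that call according to `ω n`. -/
def Produces {m : ℕ} (size : F → ℕ) (K : ℕ) (p : ℕ → F) (ω : ℕ → ℕ → ℕ)
    (S : ℕ → Sched m) (T : ℕ → ℕ) : Prop :=
  S 0 = emptySched m ∧
    ∀ n, ∃ coins, (onlineLPT size K p n (S n)).run ⟨0, ω n⟩ = some (S (n + 1), ⟨T n, coins⟩)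

end Algorithm

end OnlineLPT

/-- The sum of the binary lengths of numerator and denominator. -/
def bitSize (x : ℚ) : ℕ := x.num.natAbs.size + x.den.size

noncomputable section

/-- The minimum machine load of an assignment of the first `n` jobs. -/
def minLoad {m : ℕ} (p : ℕ → ℝ) (n : ℕ) (σ : Sched m) : ℝ :=
  ⨅ i : Fin m, ∑ j ∈ Finset.range n, if σ j = some i then p j else 0

/-- The maximum, over all schedules of the first `n` jobs, of the minimum machine load. -/
def optLoad (m : ℕ) (p : ℕ → ℝ) (n : ℕ) : ℝ :=
  ⨆ f : Fin n → Fin m, ⨅ i : Fin m, ∑ j : Fin n, if f j = i then p j else 0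

/-- `σ` is a schedule of exactly the first `n` jobs. -/
def IsSchedule {m : ℕ} (n : ℕ) (σ : Sched m) : Prop := ∀ j, (σ j).isSome ↔ j < n

/-- The total size of the jobs among the first `n` whose machine is not the same in `σ` and `σ'`. -/
def migrated {m : ℕ} (p : ℕ → ℝ) (n : ℕ) (σ σ' : Sched m) : ℝ :=
  ∑ j ∈ Finset.range n, if σ j ≠ σ' j then p j else 0

/-- On `m` machines, Online LPT with accuracy `1 / K` always produces schedules, whatever its free
choices, and is `ρ`-competitive. -/
def IsCompetitive (m K : ℕ) (ρ : ℝ) : Prop :=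
  ∀ p : ℕ → ℝ, (∀ j, 0 < p j) → ∀ ω : ℕ → ℕ → ℕ, ∃ (S : ℕ → Sched m) (T : ℕ → ℕ),
    OnlineLPT.Produces (fun _ => 0) K p ω S T ∧
      ∀ n, IsSchedule n (S n) ∧ optLoad m p n ≤ ρ * minLoad p n (S n)

/-- On `m` machines, Online LPT with accuracy `1 / K` always produces schedules, whatever its free
choices, and has migration factor `β`. -/
def HasMigrationFactor (m K : ℕ) (β : ℝ) : Prop :=
  ∀ p : ℕ → ℝ, (∀ j, 0 < p j) → ∀ ω : ℕ → ℕ → ℕ, ∃ (S : ℕ → Sched m) (T : ℕ → ℕ),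
    OnlineLPT.Produces (fun _ => 0) K p ω S T ∧
      ∀ n, IsSchedule n (S n) ∧ migrated p n (S n) (S (n + 1)) ≤ β * p n

/-- On `m` machines with rational job sizes, every call of Online LPT with accuracy `1 / K`
terminates, whatever its free choices, and its running time (with arithmetic charged by bit length)
is bounded by `f N`, where `N` is the sum of `m`, `K` and the bit lengths of the sizes of all jobs
present. -/
def RunsInTime (m K : ℕ) (f : ℕ → ℕ) : Prop :=
  ∀ p : ℕ → ℚ, (∀ j, 0 < p j) → ∀ ω : ℕ → ℕ → ℕ, ∃ (S : ℕ → Sched m) (T : ℕ → ℕ),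
    OnlineLPT.Produces bitSize K p ω S T ∧
      ∀ n, T n ≤ f (m + K + ∑ j ∈ Finset.range (n + 1), bitSize (p j))

end

/-! The analysis rests on a description of LPT schedules that does not mention an order of the jobs.
A job `j` satisfies the LPT condition (`LPTAt`) if, among the jobs at least as large as `j`, the
machine of `j` had minimum load before `j` was added; a schedule is `Stable` if all its jobs satisfy
the condition. These are exactly the schedules that LPT can produce, and the condition passes to the
jobs above any size.

**Quality.** `cover_bound` shows that if every machine of load more than `W` satisfies the LPT
condition and some machine has load at most `W`, then every schedule of the same jobs has minimum
load at most `(4 m - 2) / (3 m - 1) * W`. A job larger than `W` is alone on its machine, and a job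
larger than `W / 2` that shares its machine with a job at least as large has only this one companion;
such machines are split off by induction on `m`, after an exchange in the other schedule. If none are
left and the bound fails, then by volume some machine has a very large load, which forces its
smallest job to be larger than `W / 3`. Weights of the jobs (`coverWeight`) then lead to a
contradiction: each machine has weight at most `3` in the given schedule, one of them less than `3`,
but each has weight at least `3` in the other one. The schedules of the algorithm are
close to this situation (`OnlineLPT.NearLPT`): their big and huge jobs satisfy the LPT condition, and a machine
with a small job is at most `2 ^ ℓ = O(ε OPT)` higher than the others. So the bound applies with
`W = ℓ_min + 2 ^ ℓ`, and rounding costs another factor `1 + ε` (`OnlineLPT.CallInv.optLoad_le`).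
The threshold for small jobs never decreases because the loads of LPT schedules only grow when jobs
are added (`dominated_of_stable`), so the old schedule is close to LPT for the new threshold too.

**Migration.** Let `D` be the set of the machines on which the old and the new schedule differ in the
jobs of the classes treated so far. On `D`, the sorted loads of the new schedule are pointwise at
least those of the old one, and the total difference is the size of the new job, if it has been
treated, and `0` otherwise. All loads of big jobs are multiples of `g = ε 2 ^ ℓ`. Since ties are
broken in favor of `D`, a class can add a machine to `D` only if the machines of `D` are already too
high to take all the jobs they had in the old schedule. Pairing the machines of `D` in sorted order,
each missing job is paid for by a load difference of at least `g / 2`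
(`PhaseCounts.sum_extra_le`). Hence each of the `O((1 / ε) log (1 / ε))` classes adds `O(1 / g)`
times the size of the new job to the cardinality of `D`, plus one for the new job itself
(`OnlineLPT.phases_spec`). Huge jobs are alone on their machines and never move, and all other
migrating jobs leave a machine of `D` or go to one: in the final loop, a machine outside of `D` gives
jobs away only while a machine of `D` is lower than the old minimum (`OnlineLPT.LoopInv`). So the
migrated size is `O(UB)` times the cardinality of `D` (`OnlineLPT.sum_migrated_le`), and
`UB ≤ g / ε ^ 2` gives the migration factor.

**Running time.** `Prog.Spec V k x Q` says that, whatever the free choices, the program `x` ends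
within `V ^ k` steps with a result satisfying `Q`, where `V` bounds the numbers of jobs and machines
and the lengths of all numbers that occur. The final loop moves each job at most once, because a
moved job lies on a machine that stays low. For rational processing times, `V` can be taken
quadratic in the input length, since the rounded sizes of inputs of length `N` have the common
denominator `K 2 ^ N` (`OnlineLPT.callBound_rat`). -/

set_option linter.unusedSectionVars false

/-! ### A covering bound by weights -/

section CoverBound

variable {F : Type} [Field F] [LinearOrder F] [IsStrictOrderedRing F]

/-- The load that the jobs of the set `J` put on machine `i`. -/
def mload {m : ℕ} (q : ℕ → F) (J : Finset ℕ) (σ : Sched m) (i : Fin m) : F :=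
  ∑ j ∈ J with σ j = some i, q j

/-- The jobs of `J` that are at least as large as `x`. -/
def atLeast (q : ℕ → F) (J : Finset ℕ) (x : F) : Finset ℕ := J.filter fun j => x ≤ q j

/-- The jobs of `J` on machine `i`. -/
def onMachine {m : ℕ} (J : Finset ℕ) (σ : Sched m) (i : Fin m) : Finset ℕ :=
  J.filter fun j => σ j = some i

theorem mem_atLeast {q : ℕ → F} {J : Finset ℕ} {x : F} {j : ℕ} :
    j ∈ atLeast q J x ↔ j ∈ J ∧ x ≤ q j := Finset.mem_filter

theorem mem_onMachine {m : ℕ} {J : Finset ℕ} {σ : Sched m} {i : Fin m} {j : ℕ} :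
    j ∈ onMachine J σ i ↔ j ∈ J ∧ σ j = some i := Finset.mem_filter

theorem mload_eq {m : ℕ} (q : ℕ → F) (J : Finset ℕ) (σ : Sched m) (i : Fin m) :
    mload q J σ i = ∑ j ∈ onMachine J σ i, q j := rfl

theorem mload_nonneg {m : ℕ} {q : ℕ → F} {J : Finset ℕ} (hq : ∀ j ∈ J, 0 ≤ q j) (σ : Sched m)
    (i : Fin m) : 0 ≤ mload q J σ i :=
  Finset.sum_nonneg fun j hj => hq j (mem_onMachine.1 hj).1

theorem mload_mono {m : ℕ} {q : ℕ → F} {J J' : Finset ℕ} (hJ : J ⊆ J')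
    (hq : ∀ j ∈ J', 0 ≤ q j) (σ : Sched m) (i : Fin m) : mload q J σ i ≤ mload q J' σ i :=
  Finset.sum_le_sum_of_subset_of_nonneg (Finset.filter_subset_filter _ hJ)
    fun j hj _ => hq j (mem_onMachine.1 hj).1

theorem mload_congr {m : ℕ} {q : ℕ → F} {J J' : Finset ℕ} {σ σ' : Sched m} {i i' : Fin m}
    (h : ∀ j, j ∈ J ∧ σ j = some i ↔ j ∈ J' ∧ σ' j = some i') :
    mload q J σ i = mload q J' σ' i' := by
  rw [mload_eq, mload_eq]
  congr 1
  ext j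
  rw [mem_onMachine, mem_onMachine, h]

/-- If every job of `J` is on a machine of `M`, the loads of these machines sum up to the total
size. -/
theorem sum_mload_eq {m : ℕ} (q : ℕ → F) {J : Finset ℕ} {σ : Sched m} {M : Finset (Fin m)}
    (h : ∀ j ∈ J, ∃ i ∈ M, σ j = some i) : ∑ i ∈ M, mload q J σ i = ∑ j ∈ J, q j := by
  simp only [mload, Finset.sum_filter]
  rw [Finset.sum_comm]
  refine Finset.sum_congr rfl fun j hj => ?_
  obtain ⟨i, hi, hji⟩ := h j hj
  rw [Finset.sum_eq_single i]
  · simp [hji]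
  · intro b _ hb
    rw [hji, if_neg]
    simpa using hb.symm
  · exact fun h => absurd hi h

theorem sum_mload_le {m : ℕ} {q : ℕ → F} {J : Finset ℕ} (σ : Sched m) (M : Finset (Fin m))
    (hq : ∀ j ∈ J, 0 ≤ q j) : ∑ i ∈ M, mload q J σ i ≤ ∑ j ∈ J, q j := by
  simp only [mload, Finset.sum_filter]
  rw [Finset.sum_comm]
  refine Finset.sum_le_sum fun j hj => ?_
  rcases h : σ j with _ | i
  · simpa using hq j hj
  · simp only [Option.some.injEq]
    rw [Finset.sum_ite_eq]
    split_ifs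
    exacts [le_rfl, hq j hj]

/-- `j` satisfies the LPT condition in `σ`: among the jobs at least as large as `j`, the machine of
`j` had minimum load before `j` was added. -/
def LPTAt {m : ℕ} (q : ℕ → F) (J : Finset ℕ) (M : Finset (Fin m)) (σ : Sched m) (j : ℕ) : Prop :=
  ∀ i, σ j = some i → ∀ i' ∈ M,
    mload q (atLeast q J (q j)) σ i ≤ q j + mload q (atLeast q J (q j)) σ i'

/-- The weight of a job of size `x`: `2` for sizes from `θ` on, `1` between `η` and `θ`, and
proportional to the size, with slope `1 / (2 η)`, up to `η`. -/
def coverWeight (θ η x : F) : F := if θ ≤ x then 2 else if η < x then 1 else x / (2 * η)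

theorem coverWeight_nonneg {θ η x : F} (hη : 0 ≤ η) (hx : 0 ≤ x) : 0 ≤ coverWeight θ η x := by
  unfold coverWeight
  split_ifs <;> positivity

theorem coverWeight_le_one {θ η x : F} (hη : 0 ≤ η) (hx : x < θ) : coverWeight θ η x ≤ 1 := by
  unfold coverWeight
  rw [if_neg (not_le.2 hx)]
  split_ifs with h
  · exact le_rfl
  · apply div_le_one_of_le₀ <;> linarith

theorem coverWeight_le_two {θ η x : F} (hη : 0 ≤ η) : coverWeight θ η x ≤ 2 := by
  rcases lt_or_ge x θ with h | h
  · exact (coverWeight_le_one hη h).trans one_le_two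
  · unfold coverWeight
    rw [if_pos h]

/-- Jobs of size at least `b` that fit below `W` have total weight at most `2`. -/
theorem sum_coverWeight_le_two {q : ℕ → F} {B : Finset ℕ} {b W θ η : F} (hη : 0 ≤ η) (hb : 0 < b)
    (hB : ∀ j ∈ B, b ≤ q j) (hW : ∑ j ∈ B, q j ≤ W) (h3 : W < 3 * b) (hθ : W < θ + b) :
    ∑ j ∈ B, coverWeight θ η (q j) ≤ 2 := by
  by_cases h : ∃ x ∈ B, θ ≤ q x
  · obtain ⟨x, hx, hxθ⟩ := h
    have : B = {x} := by
      refine Finset.eq_singleton_iff_unique_mem.2 ⟨hx, fun y hy => ?_⟩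
      by_contra hne
      have h1 : q y ≤ ∑ j ∈ B.erase x, q j :=
        Finset.single_le_sum (f := q) (fun j hj => hb.le.trans (hB j (Finset.mem_of_mem_erase hj)))
          (Finset.mem_erase.2 ⟨hne, hy⟩)
      have h2 := Finset.add_sum_erase B q hx
      have h3 := hB y hy
      linarith
    rw [this, Finset.sum_singleton]
    exact coverWeight_le_two hη
  · push Not at h
    have hc : B.card ≤ 2 := by
      by_contra hc
      have h1 : B.card • b ≤ ∑ j ∈ B, q j := Finset.card_nsmul_le_sum _ _ _ hB
      have h2 : (3 : F) ≤ B.card := by exact_mod_cast (by omega : 3 ≤ B.card)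
      rw [nsmul_eq_mul] at h1
      nlinarith
    calc ∑ j ∈ B, coverWeight θ η (q j) ≤ ∑ _j ∈ B, (1 : F) :=
          Finset.sum_le_sum fun j hj => coverWeight_le_one hη (h j hj)
      _ = B.card := by simp
      _ ≤ 2 := by exact_mod_cast hc

/-- Jobs of size at most `W < T - 2 η` and of total size at least `T` have weight at least `3`. -/
theorem three_le_sum_coverWeight {q : ℕ → F} {A : Finset ℕ} {T W η : F} (hη : 0 ≤ η)
    (hq : ∀ j ∈ A, 0 < q j) (hW : ∀ j ∈ A, q j ≤ W) (hT : T ≤ ∑ j ∈ A, q j)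
    (hTW : 2 * η < T - W) (h6 : 6 * η < T) :
    3 ≤ ∑ j ∈ A, coverWeight (T / 2 - η) η (q j) := by
  set θ := T / 2 - η with hθ
  set A2 := A.filter fun j => θ ≤ q j
  set A' := A.filter fun j => ¬ θ ≤ q j
  set A1 := A'.filter fun j => η < q j
  set A0 := A'.filter fun j => ¬ η < q j
  have e1 : ∑ j ∈ A2, q j + (∑ j ∈ A1, q j + ∑ j ∈ A0, q j) = ∑ j ∈ A, q j := by
    rw [Finset.sum_filter_add_sum_filter_not, Finset.sum_filter_add_sum_filter_not]
  have e2 : ∑ j ∈ A, coverWeight θ η (q j)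
      = 2 * A2.card + (A1.card + (∑ j ∈ A0, q j) / (2 * η)) := by
    rw [← Finset.sum_filter_add_sum_filter_not A (fun j => θ ≤ q j),
      ← Finset.sum_filter_add_sum_filter_not A' (fun j => η < q j)]
    congr 1
    · rw [Finset.sum_congr rfl (g := fun _ => (2 : F))]
      · simp [A2, mul_comm]
      · intro j hj
        simp [coverWeight, (Finset.mem_filter.1 hj).2]
    congr 1
    · rw [Finset.sum_congr rfl (g := fun _ => (1 : F))]
      · simp [A1]
      · intro j hj
        have h1 := (Finset.mem_filter.1 hj)
        have h2 := (Finset.mem_filter.1 h1.1).2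
        simp [coverWeight, h1.2, h2]
    · rw [Finset.sum_div]
      refine Finset.sum_congr rfl fun j hj => ?_
      have h1 := (Finset.mem_filter.1 hj)
      have h2 := (Finset.mem_filter.1 h1.1).2
      simp [coverWeight, h1.2, h2]
  have hA0 : ∀ j ∈ A0, 0 < q j ∧ q j ≤ η := fun j hj => by
    have h1 := (Finset.mem_filter.1 hj)
    exact ⟨hq j (Finset.mem_filter.1 h1.1).1, not_lt.1 h1.2⟩
  have hS0 : 0 ≤ ∑ j ∈ A0, q j := Finset.sum_nonneg fun j hj => (hA0 j hj).1.le
  -- Small jobs of total size more than `2 k η` have weight at least `k`.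
  have key : ∀ k : F, 0 ≤ k → k * (2 * η) < ∑ j ∈ A0, q j → k ≤ (∑ j ∈ A0, q j) / (2 * η) := by
    intro k hk h
    have : A0.Nonempty := by
      by_contra hne
      rw [Finset.not_nonempty_iff_eq_empty.1 hne, Finset.sum_empty] at h
      exact absurd h (not_lt.2 (by positivity))
    obtain ⟨j, hj⟩ := this
    have := hA0 j hj
    rw [le_div_iff₀ (by linarith)]
    exact h.le
  have hS0' : 0 ≤ (∑ j ∈ A0, q j) / (2 * η) := by positivity
  rw [e2]
  by_cases hc : 3 ≤ 2 * A2.card + A1.card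
  · have : (3 : F) ≤ 2 * A2.card + A1.card := by exact_mod_cast hc
    linarith
  rcases Nat.eq_zero_or_pos A2.card with h2 | h2
  · have hs2 : ∑ j ∈ A2, q j = 0 := by rw [Finset.card_eq_zero.1 h2]; simp
    have hs1 : ∑ j ∈ A1, q j ≤ A1.card • θ := Finset.sum_le_card_nsmul _ _ _ fun j hj =>
      (not_le.1 (Finset.mem_filter.1 (Finset.mem_filter.1 hj).1).2).le
    have hs1' : A1.card ≠ 0 → ∑ j ∈ A1, q j < A1.card • θ := fun h =>
      (Finset.sum_lt_sum_of_nonempty (g := fun _ => θ) (Finset.card_ne_zero.1 h) fun j hj =>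
        not_le.1 (Finset.mem_filter.1 (Finset.mem_filter.1 hj).1).2).trans_eq
        (Finset.sum_const θ)
    obtain h1 | h1 | h1 : A1.card = 0 ∨ A1.card = 1 ∨ A1.card = 2 := by omega
    · rw [h1] at hs1
      have := key 3 (by norm_num) (by simp at hs1; linarith)
      simp [h1, h2, this]
    · rw [h1] at hs1
      have := key 2 (by norm_num) (by simp at hs1; linarith)
      simp only [h1, h2]; push_cast; linarith
    · have hs := hs1' (by omega)
      rw [h1] at hs
      have := key 1 (by norm_num) (by simp at hs; linarith)
      simp only [h1, h2]; push_cast; linarith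
  · have h2' : A2.card = 1 := by omega
    have h1 : A1.card = 0 := by omega
    obtain ⟨x, hx⟩ := Finset.card_eq_one.1 h2'
    have hs1 : ∑ j ∈ A1, q j = 0 := by rw [Finset.card_eq_zero.1 h1]; simp
    have hs2 : ∑ j ∈ A2, q j = q x := by rw [hx]; simp
    have hxA : x ∈ A := (Finset.mem_filter.1 (show x ∈ A2 by rw [hx]; simp)).1
    have := key 1 (by norm_num) (by linarith [hW x hxA])
    simp only [h1, h2']; push_cast; linarith

theorem sum_coverWeight_small {q : ℕ → F} {E : Finset ℕ} {θ η : F}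
    (h : ∀ j ∈ E, q j < θ ∧ q j ≤ η) :
    ∑ j ∈ E, coverWeight θ η (q j) = (∑ j ∈ E, q j) / (2 * η) := by
  rw [Finset.sum_div]
  refine Finset.sum_congr rfl fun j hj => ?_
  rw [coverWeight, if_neg (not_le.2 (h j hj).1), if_neg (not_lt.2 (h j hj).2)]

/-- On a machine of load at most `W` where the jobs of size at least `b` have load at least
`W - η`, the total weight is at most `5 / 2`. -/
theorem sum_coverWeight_le_of_sum_le {q : ℕ → F} {C : Finset ℕ} {b W θ η : F} (hη : 0 ≤ η)
    (hb : 0 < b) (hq : ∀ j ∈ C, 0 < q j) (hB : W - η ≤ ∑ j ∈ C with b ≤ q j, q j)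
    (h3 : W < 3 * b) (hθ : W < θ + b) (hbθ : b < θ) (hW : ∑ j ∈ C, q j ≤ W) :
    ∑ j ∈ C, coverWeight θ η (q j) ≤ 5 / 2 := by
  rw [← Finset.sum_filter_add_sum_filter_not C (fun j => b ≤ q j)] at hW ⊢
  have hE0 : ∀ j ∈ C.filter (fun j => ¬ b ≤ q j), 0 < q j := fun j hj =>
    hq j (Finset.mem_filter.1 hj).1
  have hEn : 0 ≤ ∑ j ∈ C with ¬ b ≤ q j, q j := Finset.sum_nonneg fun j hj => (hE0 j hj).le
  have hE : ∑ j ∈ C with ¬ b ≤ q j, q j ≤ η := by linarith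
  have h1 : ∑ j ∈ C with b ≤ q j, coverWeight θ η (q j) ≤ 2 :=
    sum_coverWeight_le_two hη hb (fun j hj => (Finset.mem_filter.1 hj).2) (by linarith) h3 hθ
  rw [sum_coverWeight_small (E := C.filter (fun j => ¬ b ≤ q j))]
  · have : (∑ j ∈ C with ¬ b ≤ q j, q j) / (2 * η) ≤ 1 / 2 :=
      div_le_of_le_mul₀ (by positivity) (by norm_num) (by linarith)
    linarith
  · intro j hj
    refine ⟨(not_le.1 (Finset.mem_filter.1 hj).2).trans hbθ, le_trans ?_ hE⟩
    exact Finset.single_le_sum (f := q) (fun j hj => (hE0 j hj).le) hj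

/-- On a machine that satisfies the LPT condition, the total weight is at most `3`. -/
theorem sum_coverWeight_le_of_lpt {q : ℕ → F} {C : Finset ℕ} {b W θ η : F} {e : ℕ} (hη : 0 ≤ η)
    (hb : 0 < b) (hq : ∀ j ∈ C, 0 < q j) (hB : W - η ≤ ∑ j ∈ C with b ≤ q j, q j)
    (h3 : W < 3 * b) (hθ : W < θ + b) (hbθ : b < θ) (he : e ∈ C) (hmin : ∀ j ∈ C, q e ≤ q j)
    (hW : ∑ j ∈ C, q j ≤ q e + W) (hsec : ∀ j ∈ C, j ≠ e → q e < θ) :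
    ∑ j ∈ C, coverWeight θ η (q j) ≤ 3 := by
  have hW' : ∑ j ∈ C.erase e, q j ≤ W := by
    have := Finset.add_sum_erase C q he
    linarith
  rcases le_or_gt b (q e) with hbe | hbe
  · rw [← Finset.add_sum_erase C _ he]
    by_cases hne : C.erase e = ∅
    · rw [hne, Finset.sum_empty]
      linarith [coverWeight_le_two hη (θ := θ) (x := q e)]
    · obtain ⟨k, hk⟩ := Finset.nonempty_iff_ne_empty.2 hne
      have h1 := coverWeight_le_one hη
        (hsec k (Finset.mem_of_mem_erase hk) (Finset.ne_of_mem_erase hk))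
      have h2 : ∑ j ∈ C.erase e, coverWeight θ η (q j) ≤ 2 :=
        sum_coverWeight_le_two hη hb (fun j hj => hbe.trans (hmin j (Finset.mem_of_mem_erase hj)))
          hW' h3 hθ
      linarith
  · rw [← Finset.sum_filter_add_sum_filter_not C (fun j => b ≤ q j)]
    set B := C.filter (fun j => b ≤ q j) with hBdef
    set E := C.filter (fun j => ¬ b ≤ q j)
    have heE : e ∈ E := Finset.mem_filter.2 ⟨he, not_le.2 hbe⟩
    have hEpos : ∀ j ∈ E, 0 < q j := fun j hj => hq j (Finset.mem_filter.1 hj).1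
    have hEθ : ∀ j ∈ E, q j < θ := fun j hj =>
      (not_le.1 (Finset.mem_filter.1 hj).2).trans hbθ
    have hsum : ∑ j ∈ B, q j + (q e + ∑ j ∈ E.erase e, q j) = ∑ j ∈ C, q j := by
      rw [Finset.add_sum_erase E q heE, Finset.sum_filter_add_sum_filter_not]
    have hE'n : 0 ≤ ∑ j ∈ E.erase e, q j :=
      Finset.sum_nonneg fun j hj => (hEpos j (Finset.mem_of_mem_erase hj)).le
    have h1 : ∑ j ∈ B, coverWeight θ η (q j) ≤ 2 :=
      sum_coverWeight_le_two hη hb (fun j hj => (Finset.mem_filter.1 hj).2) (by linarith) h3 hθ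
    suffices ∑ j ∈ E, coverWeight θ η (q j) ≤ 1 by linarith
    by_cases hne : E.erase e = ∅
    · rw [← Finset.add_sum_erase E _ heE, hne, Finset.sum_empty, add_zero]
      exact coverWeight_le_one hη (hEθ e heE)
    · obtain ⟨k, hk⟩ := Finset.nonempty_iff_ne_empty.2 hne
      have hle : ∀ j ∈ E.erase e, q j ≤ η := fun j hj => by
        have := Finset.single_le_sum (f := q)
          (fun j hj => (hEpos j (Finset.mem_of_mem_erase hj)).le) hj
        linarith
      have hee : q e ≤ η :=
        (hmin k (Finset.mem_filter.1 (Finset.mem_of_mem_erase hk)).1).trans (hle k hk)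
      rw [sum_coverWeight_small fun j hj => ⟨hEθ j hj, ?_⟩]
      · refine div_le_one_of_le₀ ?_ (by positivity)
        rw [← Finset.add_sum_erase E q heE]
        linarith
      · by_cases hj' : j = e
        · exact hj' ▸ hee
        · exact hle j (Finset.mem_erase.2 ⟨hj', hj⟩)

/-- A machine on which all jobs satisfy the LPT condition has load at most its smallest job plus
the load of any other machine. -/
theorem mload_le_of_lptAt {m : ℕ} {q : ℕ → F} {J : Finset ℕ} {M : Finset (Fin m)} {σ : Sched m}
    (hq : ∀ j ∈ J, 0 < q j) {i i₀ : Fin m} (hi₀ : i₀ ∈ M) {e : ℕ} (hei : σ e = some i)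
    (hmin : ∀ j ∈ J, σ j = some i → q e ≤ q j) (hlpt : LPTAt q J M σ e) :
    mload q J σ i ≤ q e + mload q J σ i₀ := by
  have h1 : mload q (atLeast q J (q e)) σ i = mload q J σ i :=
    mload_congr fun j => ⟨fun h => ⟨(mem_atLeast.1 h.1).1, h.2⟩,
      fun h => ⟨mem_atLeast.2 ⟨h.1, hmin j h.1 h.2⟩, h.2⟩⟩
  have h2 := hlpt i hei i₀ hi₀
  have h3 : mload q (atLeast q J (q e)) σ i₀ ≤ mload q J σ i₀ :=
    mload_mono (Finset.filter_subset _ _) (fun j hj => (hq j hj).le) σ i₀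
  linarith

theorem exists_smallest_on {m : ℕ} (q : ℕ → F) {J : Finset ℕ} {σ : Sched m} {i : Fin m}
    (h : (onMachine J σ i).Nonempty) :
    ∃ e ∈ J, σ e = some i ∧ ∀ j ∈ J, σ j = some i → q e ≤ q j := by
  obtain ⟨e, he, hmin⟩ := Finset.exists_min_image _ q h
  rw [mem_onMachine] at he
  exact ⟨e, he.1, he.2, fun j hj hji => hmin j (mem_onMachine.2 ⟨hj, hji⟩)⟩

/-- The covering bound, if every job has size at most `W` and every job that shares its machine with
a job at least as large has size at most `W / 2`. -/
theorem cover_bound_of_le {m : ℕ} {q : ℕ → F} {J : Finset ℕ} {M M' : Finset (Fin m)}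
    {σ τ : Sched m} {W T : F} {i₀ : Fin m} (hM : M.card = M'.card) (hq : ∀ j ∈ J, 0 < q j)
    (hJ : ∀ j ∈ J, ∃ i ∈ M, σ j = some i) (hi₀ : i₀ ∈ M) (hW : mload q J σ i₀ ≤ W)
    (hσ : ∀ i ∈ M, mload q J σ i ≤ W ∨ ∀ j ∈ J, σ j = some i → LPTAt q J M σ j)
    (hτ : ∀ i ∈ M', T ≤ mload q J τ i) (hle : ∀ j ∈ J, q j ≤ W)
    (hsec : ∀ j ∈ J, ∀ k ∈ J, j ≠ k → σ j = σ k → q k ≤ q j → 2 * q k ≤ W) :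
    (3 * (M.card : F) - 1) * T ≤ (4 * (M.card : F) - 2) * W := by
  have hq0 : ∀ j ∈ J, 0 ≤ q j := fun j hj => (hq j hj).le
  have hW0 : 0 ≤ W := (mload_nonneg hq0 σ i₀).trans hW
  have hn : (1 : F) ≤ M.card := by exact_mod_cast Finset.card_pos.2 ⟨i₀, hi₀⟩
  by_contra! hcon
  set n : F := (M.card : F)
  have hT : 0 < T := by
    by_contra! hT
    nlinarith
  -- The unit `γ` is such that `T = (4 n - 2) γ` and `W < (3 n - 1) γ`.
  obtain ⟨γ, hγ⟩ : ∃ γ : F, T = (4 * n - 2) * γ :=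
    ⟨T / (4 * n - 2), by rw [mul_div_cancel₀]; linarith⟩
  have hγ0 : 0 < γ := by
    by_contra! h
    nlinarith
  have hWγ : W < (3 * n - 1) * γ := by
    rw [hγ, ← mul_assoc, mul_comm (3 * n - 1), mul_assoc] at hcon
    exact lt_of_mul_lt_mul_left hcon (by linarith)
  obtain ⟨α, hα⟩ : ∃ α : F, α = n * γ := ⟨_, rfl⟩
  have hαγ : γ ≤ α := by rw [hα]; nlinarith
  have hT' : T = 4 * α - 2 * γ := by rw [hγ, hα]; ring
  have hW' : W < 3 * α - γ := by rw [hα]; linarith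
  have hvol : n * T ≤ ∑ j ∈ J, q j := by
    calc n * T = ∑ _i ∈ M', T := by simp [n, hM]
      _ ≤ ∑ i ∈ M', mload q J τ i := Finset.sum_le_sum hτ
      _ ≤ _ := sum_mload_le τ M' hq0
  -- By volume, some machine has a load that exceeds `W` by more than `α`.
  obtain ⟨i₁, hi₁, hbad⟩ : ∃ i ∈ M, W + α < mload q J σ i := by
    by_contra! h
    have h1 : ∑ i ∈ M, mload q J σ i ≤ W + (n - 1) * (W + α) := by
      rw [← Finset.add_sum_erase M _ hi₀]
      have h2 : ∑ i ∈ M.erase i₀, mload q J σ i ≤ (M.erase i₀).card • (W + α) :=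
        Finset.sum_le_card_nsmul _ _ _ fun i hi => h i (Finset.mem_of_mem_erase hi)
      rw [Finset.card_erase_of_mem hi₀, nsmul_eq_mul, Nat.cast_sub (Finset.card_pos.2 ⟨_, hi₀⟩)] at h2
      push_cast at h2
      linarith
    rw [sum_mload_eq q hJ] at h1
    have h2 := mul_lt_mul_of_pos_left hW' (show 0 < n by linarith)
    rw [hT'] at hvol
    nlinarith
  have hlpt : ∀ j ∈ J, σ j = some i₁ → LPTAt q J M σ j :=
    (hσ i₁ hi₁).resolve_left (by linarith [hα, mul_pos (show 0 < n by linarith) hγ0])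
  obtain ⟨e, heJ, hei, hemin⟩ := exists_smallest_on q (J := J) (σ := σ) (i := i₁) (by
    rw [Finset.nonempty_iff_ne_empty]
    intro h
    rw [mload_eq, h, Finset.sum_empty] at hbad
    linarith)
  set b := q e with hb
  have hb0 : 0 < b := hq e heJ
  have hLi₁ := mload_le_of_lptAt hq hi₀ hei hemin (hlpt e heJ hei)
  -- A machine of load more than `W + α` has a second job.
  obtain ⟨k, hkJ, hki, hke⟩ : ∃ k ∈ J, σ k = some i₁ ∧ k ≠ e := by
    by_contra! h
    have : onMachine J σ i₁ = {e} := Finset.eq_singleton_iff_unique_mem.2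
      ⟨mem_onMachine.2 ⟨heJ, hei⟩, fun j hj => h j (mem_onMachine.1 hj).1 (mem_onMachine.1 hj).2⟩
    rw [mload_eq, this, Finset.sum_singleton] at hbad
    linarith [hle e heJ]
  have h2b : 2 * b ≤ W := hsec k hkJ e heJ hke (hki.trans hei.symm) (hemin k hkJ hki)
  obtain ⟨a, ha⟩ : ∃ a, a = mload q J σ i₁ - b := ⟨_, rfl⟩
  obtain ⟨η, hη⟩ : ∃ η, η = W - a := ⟨_, rfl⟩
  have hη0 : 0 ≤ η := by linarith
  have hall : ∀ i ∈ M, a ≤ mload q (atLeast q J b) σ i := fun i hi => by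
    have h3 : mload q (atLeast q J b) σ i₁ = mload q J σ i₁ :=
      mload_congr fun j => ⟨fun h => ⟨(mem_atLeast.1 h.1).1, h.2⟩,
        fun h => ⟨mem_atLeast.2 ⟨h.1, hemin j h.1 h.2⟩, h.2⟩⟩
    have h4 := hlpt e heJ hei i₁ hei i hi
    rw [← hb, h3] at h4
    linarith
  -- Two jobs smaller than `θ` leave more than `2 η` of `T` to be covered by further jobs.
  set θ := T / 2 - η with hθ
  have h3 : W < 3 * b := by linarith
  have hθb : W < θ + b := by linarith
  have hbθ : b < θ := by linarith
  have hsecθ : ∀ j ∈ J, ∀ k ∈ J, j ≠ k → σ j = σ k → q k ≤ q j → q k < θ := fun j hj k hk h h' h'' => by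
    linarith [hsec j hj k hk h h' h'']
  have hBi : ∀ i ∈ M, W - η ≤ ∑ j ∈ onMachine J σ i with b ≤ q j, q j := fun i hi => by
    have h1 := hall i hi
    have h2 : (onMachine J σ i).filter (fun j => b ≤ q j) = onMachine (atLeast q J b) σ i := by
      ext j
      rw [Finset.mem_filter, mem_onMachine, mem_onMachine, mem_atLeast]
      tauto
    rw [h2]
    rw [mload_eq] at h1
    linarith
  have hpos : ∀ i, ∀ j ∈ onMachine J σ i, 0 < q j := fun i j hj => hq j (mem_onMachine.1 hj).1
  set w : ℕ → F := fun j => coverWeight θ η (q j)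
  have hup : ∀ i ∈ M, mload w J σ i ≤ 3 := fun i hi => by
    rcases le_or_gt (mload q J σ i) W with hL | hL
    · have : mload w J σ i ≤ 5 / 2 :=
        sum_coverWeight_le_of_sum_le hη0 hb0 (hpos i) (hBi i hi) h3 hθb hbθ hL
      linarith
    · obtain ⟨e', heJ', hei', hemin'⟩ := exists_smallest_on q (J := J) (σ := σ) (i := i) (by
        rw [Finset.nonempty_iff_ne_empty]
        intro h
        rw [mload_eq, h, Finset.sum_empty] at hL
        linarith)
      have hl := (hσ i hi).resolve_left (not_le.2 hL) e' heJ' hei'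
      have := mload_le_of_lptAt hq hi₀ hei' hemin' hl
      rw [mload_eq]
      refine sum_coverWeight_le_of_lpt (C := onMachine J σ i) (e := e') hη0 hb0 (hpos i) (hBi i hi) h3 hθb hbθ
        (mem_onMachine.2 ⟨heJ', hei'⟩)
        (fun j hj => hemin' j (mem_onMachine.1 hj).1 (mem_onMachine.1 hj).2) ?_ ?_
      · rw [← mload_eq]
        linarith
      · intro j hj hje
        rw [mem_onMachine] at hj
        exact hsecθ j hj.1 e' heJ' hje (hj.2.trans hei'.symm) (hemin' j hj.1 hj.2)
  have hup₀ : mload w J σ i₀ < 3 := by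
    have : mload w J σ i₀ ≤ 5 / 2 :=
      sum_coverWeight_le_of_sum_le hη0 hb0 (hpos i₀) (hBi i₀ hi₀) h3 hθb hbθ hW
    linarith
  have hlow : ∀ i ∈ M', 3 ≤ mload w J τ i := fun i hi =>
    three_le_sum_coverWeight hη0 (fun j hj => hq j (mem_onMachine.1 hj).1)
      (fun j hj => hle j (mem_onMachine.1 hj).1) (hτ i hi) (by linarith) (by linarith)
  have h1 : ∑ i ∈ M', mload w J τ i ≤ ∑ i ∈ M, mload w J σ i := by
    rw [sum_mload_eq w hJ]
    exact sum_mload_le τ M' fun j hj => coverWeight_nonneg hη0 (hq0 j hj)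
  have h2 : ∑ i ∈ M, mload w J σ i < ∑ _i ∈ M, (3 : F) :=
    Finset.sum_lt_sum hup ⟨i₀, hi₀, hup₀⟩
  have h3 : ∑ _i ∈ M', (3 : F) ≤ ∑ i ∈ M', mload w J τ i := Finset.sum_le_sum hlow
  simp only [Finset.sum_const, hM] at h2 h3
  linarith

/-! ### The covering bound -/

/-- Delete the job `a` and let the job `u`, which is at least as large and on none of the machines
in `M`, take its place: no load on `M` decreases. -/
theorem mload_le_mload_erase {m : ℕ} {q : ℕ → F} {J : Finset ℕ} {τ : Sched m} {i₂ i : Fin m}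
    {a u : ℕ} (ha : a ∈ J) (hu : u ∈ J) (hui : τ u = some i₂) (hau : q a ≤ q u) (hi : i ≠ i₂) :
    mload q J τ i ≤ mload q (J.erase a) (Function.update τ u (τ a)) i := by
  have hui' : τ u ≠ some i := by
    rw [hui]
    simpa using hi.symm
  by_cases hai : τ a = some i
  · have hne : a ≠ u := by
      rintro rfl
      exact hui' hai
    have h1 : onMachine J τ i = insert a ((onMachine J τ i).erase a) :=
      (Finset.insert_erase (mem_onMachine.2 ⟨ha, hai⟩)).symm
    have h2 : onMachine (J.erase a) (Function.update τ u (τ a)) i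
        = insert u ((onMachine J τ i).erase a) := by
      ext j
      rw [Finset.mem_insert, Finset.mem_erase, mem_onMachine, mem_onMachine, Finset.mem_erase]
      by_cases hj : j = u
      · subst hj
        simp [hai, hu, Ne.symm hne]
      · rw [Function.update_of_ne hj]
        tauto
    rw [mload_eq, mload_eq, h1, h2, Finset.sum_insert (Finset.notMem_erase _ _),
      Finset.sum_insert]
    · linarith
    · intro h
      exact hui' (mem_onMachine.1 (Finset.mem_of_mem_erase h)).2
  · refine (mload_congr fun j => ?_).le
    rw [Finset.mem_erase]
    by_cases hj : j = u
    · subst hj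
      simp [hai, hui']
    · rw [Function.update_of_ne hj]
      refine ⟨fun h => ⟨⟨?_, h.1⟩, h.2⟩, fun h => ⟨h.1.2, h.2⟩⟩
      rintro rfl
      exact hai h.2

/-- A machine that holds two jobs of total size more than `W` and satisfies the LPT condition holds
no other job. -/
theorem eq_or_eq_of_lpt {m : ℕ} {q : ℕ → F} {J : Finset ℕ} {M : Finset (Fin m)} {σ : Sched m}
    (hq : ∀ j ∈ J, 0 < q j) {W : F} {i i₀ : Fin m} (hi₀ : i₀ ∈ M) (hW : mload q J σ i₀ ≤ W)
    (hlpt : ∀ j ∈ J, σ j = some i → LPTAt q J M σ j) {A : Finset ℕ}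
    (hA : A ⊆ onMachine J σ i) (hAW : W < ∑ j ∈ A, q j) : onMachine J σ i ⊆ A := by
  intro k hk
  by_contra hkA
  obtain ⟨e, heJ, hei, hemin⟩ := exists_smallest_on q ⟨k, hk⟩
  have h1 := mload_le_of_lptAt hq hi₀ hei hemin (hlpt e heJ hei)
  have h2 : ∑ j ∈ insert k A, q j ≤ mload q J σ i :=
    Finset.sum_le_sum_of_subset_of_nonneg (Finset.insert_subset hk hA)
      fun j hj _ => (hq j (mem_onMachine.1 hj).1).le
  rw [Finset.sum_insert hkA] at h2
  have h3 := hemin k (mem_onMachine.1 hk).1 (mem_onMachine.1 hk).2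
  linarith

/-- **Covering bound.** Let `σ` and `τ` be two assignments of the jobs in `J` to equally many
machines. If some machine has load at most `W` in `σ`, if every machine of larger load satisfies the
LPT condition in `σ`, and if all loads in `τ` are at least `T`, then
`T ≤ (4 m - 2) / (3 m - 1) * W`. -/
theorem cover_bound {m : ℕ} {q : ℕ → F} {σ : Sched m} {W T : F} {i₀ : Fin m} :
    ∀ (J : Finset ℕ) (M M' : Finset (Fin m)) (τ : Sched m), M.card = M'.card →
      (∀ j ∈ J, 0 < q j) → (∀ j ∈ J, ∃ i ∈ M, σ j = some i) → i₀ ∈ M → mload q J σ i₀ ≤ W →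
      (∀ i ∈ M, mload q J σ i ≤ W ∨ ∀ j ∈ J, σ j = some i → LPTAt q J M σ j) →
      (∀ i ∈ M', T ≤ mload q J τ i) →
      (3 * (M.card : F) - 1) * T ≤ (4 * (M.card : F) - 2) * W := by
  intro J M
  induction h : M.card generalizing J M with
  | zero =>
    intro _ _ _ _ _ hi₀
    rw [Finset.card_eq_zero.1 h] at hi₀
    simp at hi₀
  | succ n ih =>
  intro M' τ hM hq hJ hi₀ hW hσ hτ
  have hW0 : 0 ≤ W := (mload_nonneg (fun j hj => (hq j hj).le) σ i₀).trans hW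
  -- Removing a machine `i₁` of `σ`, its jobs, and a machine `i₂` of `τ`.
  have red : ∀ i₁ ∈ M, W < mload q J σ i₁ → ∀ i₂ ∈ M', ∀ τ' : Sched m,
      (∀ i ∈ M'.erase i₂, T ≤ mload q (J.filter fun j => σ j ≠ some i₁) τ' i) →
      (3 * ((n + 1 : ℕ) : F) - 1) * T ≤ (4 * ((n + 1 : ℕ) : F) - 2) * W := by
    intro i₁ hi₁ hLi₁ i₂ hi₂ τ' hτ'
    have hne : i₀ ≠ i₁ := by
      rintro rfl
      exact absurd hW (not_le.2 hLi₁)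
    have hload : ∀ x, ∀ i, i ≠ i₁ → mload q (atLeast q (J.filter fun j => σ j ≠ some i₁) x) σ i
        = mload q (atLeast q J x) σ i := fun x i hi => mload_congr fun j => by
      rw [mem_atLeast, mem_atLeast, Finset.mem_filter]
      refine ⟨fun h => ⟨⟨h.1.1.1, h.1.2⟩, h.2⟩, fun h => ⟨⟨⟨h.1.1, ?_⟩, h.1.2⟩, h.2⟩⟩
      rw [h.2]
      simpa using hi
    have hload' : ∀ i, i ≠ i₁ → mload q (J.filter fun j => σ j ≠ some i₁) σ i
        = mload q J σ i := fun i hi => mload_congr fun j => by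
      rw [Finset.mem_filter]
      refine ⟨fun h => ⟨h.1.1, h.2⟩, fun h => ⟨⟨h.1, ?_⟩, h.2⟩⟩
      rw [h.2]
      simpa using hi
    have hi₀' : i₀ ∈ M.erase i₁ := Finset.mem_erase.2 ⟨hne, hi₀⟩
    have hc : (M.erase i₁).card = n := by
      rw [Finset.card_erase_of_mem hi₁]
      omega
    have := ih (J.filter fun j => σ j ≠ some i₁) (M.erase i₁) hc (M'.erase i₂) τ'
      (by rw [Finset.card_erase_of_mem hi₂]; omega)
      (fun j hj => hq j (Finset.mem_filter.1 hj).1)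
      (fun j hj => by
        rw [Finset.mem_filter] at hj
        obtain ⟨i, hi, hji⟩ := hJ j hj.1
        refine ⟨i, Finset.mem_erase.2 ⟨?_, hi⟩, hji⟩
        rintro rfl
        exact hj.2 hji) hi₀' (by rwa [hload' i₀ hne])
      (fun i hi => by
        rw [Finset.mem_erase] at hi
        rw [hload' i hi.1]
        refine (hσ i hi.2).imp id fun h j hj hji i' hi' i'' hi'' => ?_
        have : i' = i := by simpa [hji] using hi'.symm
        subst this
        rw [Finset.mem_erase] at hi''
        rw [hload _ _ hi.1, hload _ _ hi''.1]
        exact h j (Finset.mem_filter.1 hj).1 hji _ hji _ hi''.2) hτ'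
    have hn : (1 : F) ≤ n := by
      have : 1 ≤ n := hc ▸ Finset.card_pos.2 ⟨i₀, hi₀'⟩
      exact_mod_cast this
    -- The ratio `(4 n - 2) / (3 n - 1)` increases with `n`.
    push_cast
    have h1 : 0 < 3 * (n : F) - 1 := by linarith
    refine le_of_mul_le_mul_left ?_ h1
    calc (3 * (n : F) - 1) * ((3 * (n + 1) - 1) * T)
        = (3 * (n + 1) - 1) * ((3 * (n : F) - 1) * T) := by ring
      _ ≤ (3 * (n + 1) - 1) * ((4 * (n : F) - 2) * W) := by gcongr; linarith
      _ ≤ (3 * (n : F) - 1) * ((4 * (n + 1) - 2) * W) := by nlinarith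
  have hM' : M'.Nonempty := Finset.card_pos.1 (by omega)
  by_cases hle : ∀ j ∈ J, q j ≤ W
  swap
  · push Not at hle
    -- A job larger than `W` is alone on its machine, and in `τ` it is on at most one machine.
    obtain ⟨x, hx, hxW⟩ := hle
    obtain ⟨i₁, hi₁, hxi₁⟩ := hJ x hx
    have hxm : {x} ⊆ onMachine J σ i₁ :=
      Finset.singleton_subset_iff.2 (mem_onMachine.2 ⟨hx, hxi₁⟩)
    have hL : W < mload q J σ i₁ := hxW.trans_le <| by
      rw [mload_eq, ← Finset.sum_singleton q x]
      exact Finset.sum_le_sum_of_subset_of_nonneg hxm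
        fun j hj _ => (hq j (mem_onMachine.1 hj).1).le
    have hsub := eq_or_eq_of_lpt hq hi₀ hW ((hσ i₁ hi₁).resolve_left (not_le.2 hL)) hxm
      (by simpa using hxW)
    obtain ⟨i₂, hi₂, h₂⟩ : ∃ i₂ ∈ M', ∀ i ∈ M'.erase i₂, τ x ≠ some i := by
      by_cases h : ∃ i ∈ M', τ x = some i
      · obtain ⟨i, hi, hxi⟩ := h
        refine ⟨i, hi, fun i' hi' h => Finset.ne_of_mem_erase hi' ?_⟩
        simpa [hxi] using h.symm
      · push Not at h
        obtain ⟨i, hi⟩ := hM'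
        exact ⟨i, hi, fun i' hi' => h i' (Finset.mem_of_mem_erase hi')⟩
    refine red i₁ hi₁ hL i₂ hi₂ τ fun i hi => (hτ i (Finset.mem_of_mem_erase hi)).trans_eq ?_
    refine mload_congr fun j => ?_
    rw [Finset.mem_filter]
    refine ⟨fun h => ⟨⟨h.1, fun hj => ?_⟩, h.2⟩, fun h => ⟨h.1.1, h.2⟩⟩
    have : j = x := by simpa using hsub (mem_onMachine.2 ⟨h.1, hj⟩)
    exact h₂ i hi (this ▸ h.2)
  by_cases hsec : ∀ j ∈ J, ∀ k ∈ J, j ≠ k → σ j = σ k → q k ≤ q j → 2 * q k ≤ W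
  · have := cover_bound_of_le (by omega) hq hJ hi₀ hW hσ hτ hle hsec
    rwa [h] at this
  -- Among the pairs `(x, y)` of jobs on the same machine with `y` at most as large as `x`, take one
  -- with the largest `y`, and among these one with the smallest `x`.
  push Not at hsec
  obtain ⟨j, hj, k, hk, hjk, hσjk, hqjk, hkW⟩ := hsec
  set P := (J ×ˢ J).filter fun p => p.1 ≠ p.2 ∧ σ p.1 = σ p.2 ∧ q p.2 ≤ q p.1
  have hP : ∀ x y, (x, y) ∈ P ↔ (x ∈ J ∧ y ∈ J) ∧ x ≠ y ∧ σ x = σ y ∧ q y ≤ q x := fun x y => by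
    rw [Finset.mem_filter, Finset.mem_product]
  obtain ⟨⟨j', k'⟩, hp', hmax⟩ := Finset.exists_max_image P (fun p => q p.2)
    ⟨(j, k), (hP j k).2 ⟨⟨hj, hk⟩, hjk, hσjk, hqjk⟩⟩
  obtain ⟨⟨x, y⟩, hp, hmin⟩ := Finset.exists_min_image (P.filter fun p => q k' ≤ q p.2)
    (fun p => q p.1) ⟨(j', k'), Finset.mem_filter.2 ⟨hp', le_rfl⟩⟩
  rw [Finset.mem_filter, hP] at hp
  obtain ⟨⟨⟨hx, hy⟩, hxy, hσxy, hqxy⟩, hky⟩ := hp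
  have hyk : q y ≤ q k' := hmax (x, y) ((hP x y).2 ⟨⟨hx, hy⟩, hxy, hσxy, hqxy⟩)
  have hyW : W < 2 * q y := by
    have := hmax (j, k) ((hP j k).2 ⟨⟨hj, hk⟩, hjk, hσjk, hqjk⟩)
    simp only at this hky
    linarith
  obtain ⟨i₁, hi₁, hyi₁⟩ := hJ y hy
  have hxi₁ : σ x = some i₁ := hσxy.trans hyi₁
  have hA : {x, y} ⊆ onMachine J σ i₁ := by
    intro z hz
    rw [Finset.mem_insert, Finset.mem_singleton] at hz
    rcases hz with rfl | rfl
    exacts [mem_onMachine.2 ⟨hx, hxi₁⟩, mem_onMachine.2 ⟨hy, hyi₁⟩]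
  have hAW : W < ∑ z ∈ ({x, y} : Finset ℕ), q z := by
    rw [Finset.sum_pair hxy]
    linarith
  have hL : W < mload q J σ i₁ := hAW.trans_le <|
    Finset.sum_le_sum_of_subset_of_nonneg hA fun j hj _ => (hq j (mem_onMachine.1 hj).1).le
  have hlpt := (hσ i₁ hi₁).resolve_left (not_le.2 hL)
  have hsub := eq_or_eq_of_lpt hq hi₀ hW hlpt hA hAW
  -- Every machine holds a job at least as large as `x`.
  have hfirst : ∀ i ∈ M, ∃ f ∈ J, σ f = some i ∧ q x ≤ q f := by
    intro i hi
    have h1 := hlpt y hy hyi₁ i₁ hyi₁ i hi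
    have h2 : q x + q y ≤ mload q (atLeast q J (q y)) σ i₁ := by
      rw [mload_eq, ← Finset.sum_pair hxy]
      refine Finset.sum_le_sum_of_subset_of_nonneg (fun z hz => ?_)
        fun j hj _ => (hq j (mem_atLeast.1 (mem_onMachine.1 hj).1).1).le
      have := mem_onMachine.1 (hA hz)
      rw [mem_onMachine, mem_atLeast]
      refine ⟨⟨this.1, ?_⟩, this.2⟩
      rw [Finset.mem_insert, Finset.mem_singleton] at hz
      rcases hz with rfl | rfl
      exacts [hqxy, le_rfl]
    have h3 : q x ≤ mload q (atLeast q J (q y)) σ i := by linarith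
    have hne : (onMachine (atLeast q J (q y)) σ i).Nonempty := by
      rw [Finset.nonempty_iff_ne_empty]
      intro h
      rw [mload_eq, h, Finset.sum_empty] at h3
      linarith [hq x hx]
    obtain ⟨f, hf, hfmax⟩ := Finset.exists_max_image _ q hne
    rw [mem_onMachine, mem_atLeast] at hf
    refine ⟨f, hf.1.1, hf.2, ?_⟩
    by_cases hex : ∃ g ∈ onMachine (atLeast q J (q y)) σ i, g ≠ f
    · obtain ⟨g, hg, hgf⟩ := hex
      have hgm := hfmax g hg
      rw [mem_onMachine, mem_atLeast] at hg
      exact hmin (f, g) (Finset.mem_filter.2 ⟨(hP f g).2 ⟨⟨hf.1.1, hg.1.1⟩, hgf.symm,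
        hf.2.trans hg.2.symm, hgm⟩, hky.trans hg.1.2⟩)
    · push Not at hex
      have : onMachine (atLeast q J (q y)) σ i = {f} := Finset.eq_singleton_iff_unique_mem.2
        ⟨mem_onMachine.2 ⟨mem_atLeast.2 hf.1, hf.2⟩, hex⟩
      rwa [mload_eq, this, Finset.sum_singleton] at h3
  -- Without loss of generality, `τ` assigns every job to a machine of `M'`.
  obtain ⟨τ₁, hτ₁, hτ₁J⟩ : ∃ τ₁ : Sched m, (∀ i ∈ M', T ≤ mload q J τ₁ i) ∧
      ∀ j, ∃ i ∈ M', τ₁ j = some i := by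
    classical
    obtain ⟨i', hi'⟩ := hM'
    refine ⟨fun j => if ∃ i ∈ M', τ j = some i then τ j else some i', fun i hi => ?_, fun j => ?_⟩
    · refine (hτ i hi).trans (Finset.sum_le_sum_of_subset_of_nonneg (fun j hj => ?_)
        fun j hj _ => (hq j (Finset.mem_filter.1 hj).1).le)
      rw [Finset.mem_filter] at hj ⊢
      exact ⟨hj.1, (if_pos ⟨i, hi, hj.2⟩).trans hj.2⟩
    · simp only
      split_ifs with h
      exacts [h, ⟨i', hi', rfl⟩]
  choose! f hfJ hfσ hfq using hfirst
  -- By the pigeonhole principle, `τ` assigns two of these jobs and `y` to the same machine.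
  obtain ⟨u, v, huv, hu, hv, hτuv, hqu, hqv⟩ : ∃ u v, u ≠ v ∧ u ∈ J ∧ v ∈ J ∧ τ₁ u = τ₁ v ∧
      q x ≤ q u ∧ q y ≤ q v := by
    classical
    set g : Fin m → ℕ := fun i => if i = i₁ then x else f i with hg
    have hgσ : ∀ i ∈ M, σ (g i) = some i := fun i hi => by
      rw [hg]
      simp only
      split_ifs with h
      exacts [h ▸ hxi₁, hfσ i hi]
    have hgJ : ∀ i ∈ M, g i ∈ J := fun i hi => by
      rw [hg]
      simp only
      split_ifs with h
      exacts [hx, hfJ i hi]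
    have hgq : ∀ i ∈ M, q x ≤ q (g i) := fun i hi => by
      rw [hg]
      simp only
      split_ifs with h
      exacts [le_rfl, hfq i hi]
    have hinj : Set.InjOn g M := fun i hi i' hi' h => by
      have := hgσ i hi
      rw [h, hgσ i' hi'] at this
      simpa using this.symm
    have hyg : y ∉ M.image g := by
      intro hmem
      obtain ⟨i, hi, hiy⟩ := Finset.mem_image.1 hmem
      have h1 := hgσ i hi
      rw [hiy, hyi₁] at h1
      have h2 : i = i₁ := by simpa using h1.symm
      rw [hg] at hiy
      simp only [h2, if_true] at hiy
      exact hxy hiy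
    have hcard : (M'.image some).card < (insert y (M.image g)).card := by
      rw [Finset.card_insert_of_notMem hyg, Finset.card_image_of_injOn hinj]
      have := Finset.card_image_le (s := M') (f := (some : Fin m → Option (Fin m)))
      omega
    obtain ⟨u, hu, v, hv, huv, h⟩ := Finset.exists_ne_map_eq_of_card_lt_of_maps_to hcard
      (f := τ₁) fun j _ => by
        obtain ⟨i, hi, hji⟩ := hτ₁J j
        exact Finset.mem_coe.2 (Finset.mem_image.2 ⟨i, hi, hji.symm⟩)
    have hcase : ∀ z ∈ insert y (M.image g), z ∈ J ∧ q y ≤ q z ∧ (z ≠ y → q x ≤ q z) := by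
      intro z hz
      rcases Finset.mem_insert.1 hz with rfl | hz
      · exact ⟨hy, le_rfl, fun h => absurd rfl h⟩
      · obtain ⟨i, hi, rfl⟩ := Finset.mem_image.1 hz
        exact ⟨hgJ i hi, hqxy.trans (hgq i hi), fun _ => hgq i hi⟩
    by_cases huy : u = y
    · exact ⟨v, u, huv.symm, (hcase v hv).1, (hcase u hu).1, h.symm,
        (hcase v hv).2.2 fun h => huv (huy.trans h.symm), (hcase u hu).2.1⟩
    · exact ⟨u, v, huv, (hcase u hu).1, (hcase v hv).1, h, (hcase u hu).2.2 huy,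
        (hcase v hv).2.1⟩
  obtain ⟨i₂, hi₂, hui₂⟩ := hτ₁J u
  have hvi₂ : τ₁ v = some i₂ := hτuv ▸ hui₂
  have hJ' : (J.filter fun j => σ j ≠ some i₁) = (J.erase x).erase y := by
    ext z
    rw [Finset.mem_filter, Finset.mem_erase, Finset.mem_erase]
    constructor
    · rintro ⟨h1, h2⟩
      refine ⟨?_, ?_, h1⟩
      · rintro rfl
        exact h2 hyi₁
      · rintro rfl
        exact h2 hxi₁
    · rintro ⟨h1, h2, h3⟩
      refine ⟨h3, fun h => ?_⟩
      have := hsub (mem_onMachine.2 ⟨h3, h⟩)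
      rw [Finset.mem_insert, Finset.mem_singleton] at this
      exact this.elim h2 h1
  -- In `τ`, let the larger jobs `u` and `v` take the places of `x` and `y`, and drop the machine that
  -- `u` and `v` shared.
  rcases eq_or_ne v x with rfl | hvx
  · refine red i₁ hi₁ hL i₂ hi₂ (Function.update τ₁ u (τ₁ y)) fun i hi => ?_
    have hi' := Finset.ne_of_mem_erase hi
    have h1 := mload_le_mload_erase hx hx hvi₂ le_rfl hi' (q := q)
    rw [Function.update_eq_self] at h1
    have h2 := mload_le_mload_erase (Finset.mem_erase.2 ⟨hxy.symm, hy⟩)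
      (Finset.mem_erase.2 ⟨huv, hu⟩) hui₂ (hqxy.trans hqu) hi'
    rw [hJ']
    exact ((hτ₁ i (Finset.mem_of_mem_erase hi)).trans h1).trans h2
  · set τ₂ := Function.update τ₁ u (τ₁ x) with hτ₂
    refine red i₁ hi₁ hL i₂ hi₂ (Function.update τ₂ v (τ₂ y)) fun i hi => ?_
    have hi' := Finset.ne_of_mem_erase hi
    have h1 := mload_le_mload_erase hx hu hui₂ hqu hi'
    have h2 := mload_le_mload_erase (τ := τ₂) (i₂ := i₂) (Finset.mem_erase.2 ⟨hxy.symm, hy⟩)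
      (Finset.mem_erase.2 ⟨hvx, hv⟩) (by rw [hτ₂, Function.update_of_ne huv.symm]; exact hvi₂)
      hqv hi'
    rw [hJ']
    exact ((hτ₁ i (Finset.mem_of_mem_erase hi)).trans h1).trans h2

end CoverBound

/-! ### Dominance of loads -/

section Dominance

variable {F : Type} [Field F] [LinearOrder F] [IsStrictOrderedRing F]

/-- The loads `L'` dominate the loads `L` on the set `D` of machines: for every `t`, at least as
many machines of `D` have load at least `t` in `L'` as in `L`. Equivalently, after sorting, `L` is
pointwise at most `L'`. -/
def Dominated {m : ℕ} (D : Finset (Fin m)) (L L' : Fin m → F) : Prop :=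
  ∀ t, (D.filter fun i => t ≤ L i).card ≤ (D.filter fun i => t ≤ L' i).card

/-- Dominance can be witnessed by a permutation of `D`, by Hall's theorem. -/
theorem Dominated.exists_matching {m : ℕ} {D : Finset (Fin m)} {L L' : Fin m → F}
    (h : Dominated D L L') : ∃ π : Fin m → Fin m, (∀ i ∈ D, π i ∈ D ∧ L i ≤ L' (π i)) ∧
      (∀ k ∈ D, ∃ i ∈ D, π i = k) ∧
      ∀ {β : Type} [AddCommMonoid β] (f : Fin m → β), ∑ i ∈ D, f (π i) = ∑ i ∈ D, f i := by
  classical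
  obtain ⟨f, hinj, hf⟩ := (Finset.all_card_le_biUnion_card_iff_exists_injective
    (fun i : D => D.filter fun k => L i ≤ L' k)).1 (by
      intro s
      rcases s.eq_empty_or_nonempty with rfl | hs
      · simp
      obtain ⟨i, hi, hmin⟩ := Finset.exists_min_image s (fun i => L i) hs
      calc s.card = (s.image Subtype.val).card :=
            (Finset.card_image_of_injective _ Subtype.val_injective).symm
        _ ≤ (D.filter fun k => L i ≤ L k).card := Finset.card_le_card fun k hk => by
            obtain ⟨l, hl, rfl⟩ := Finset.mem_image.1 hk
            exact Finset.mem_filter.2 ⟨l.2, hmin l hl⟩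
        _ ≤ _ := h _
        _ ≤ _ := Finset.card_le_card (Finset.subset_biUnion_of_mem
            (fun i : D => D.filter fun k => L i ≤ L' k) hi))
  set π : Fin m → Fin m := fun i => if hi : i ∈ D then f ⟨i, hi⟩ else i
  have hπ : ∀ i (hi : i ∈ D), π i = f ⟨i, hi⟩ := fun i hi => dif_pos hi
  have h1 : ∀ i ∈ D, π i ∈ D ∧ L i ≤ L' (π i) := fun i hi => by
    rw [hπ i hi]
    exact Finset.mem_filter.1 (hf ⟨i, hi⟩)
  have h2 : Set.InjOn π D := fun i hi k hk hik => by
    rw [hπ i hi, hπ k hk] at hik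
    exact congrArg Subtype.val (hinj hik)
  have h3 : D.image π = D := Finset.eq_of_subset_of_card_le
    (Finset.image_subset_iff.2 fun i hi => (h1 i hi).1) (Finset.card_image_of_injOn h2).ge
  refine ⟨π, h1, fun k hk => ?_, fun f => ?_⟩
  · rw [← h3] at hk
    exact Finset.mem_image.1 hk
  · rw [← Finset.sum_image (f := f) h2, h3]

/-- If the counts `c` lift all loads `L` to at least `t`, then at least as many jobs lift the
dominating loads `L'` to at least `t`, provided that none of them is added at a load `≥ t`. -/
theorem Dominated.le_of_greedy {m : ℕ} {D : Finset (Fin m)} {L L' : Fin m → F}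
    (h : Dominated D L L') {c c' : Fin m → ℕ} {x t : F} (hx : 0 < x)
    (hc : ∀ i ∈ D, t ≤ L i + c i * x) (hc' : ∀ i ∈ D, c' i ≠ 0 → L' i + c' i * x < x + t)
    (hsum : ∑ i ∈ D, c i ≤ ∑ i ∈ D, c' i) : ∀ i ∈ D, t ≤ L' i + c' i * x := by
  intro k hk
  by_contra! hlt
  obtain ⟨π, hπ, hsurj, hπs⟩ := h.exists_matching
  rw [← hπs c'] at hsum
  refine absurd hsum (not_le.2 (Finset.sum_lt_sum (fun i hi => ?_) ?_))
  · by_contra! hlt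
    have h1 := hc' (π i) (hπ i hi).1 (by omega)
    have h2 := hc i hi
    have h3 : (c i : F) + 1 ≤ c' (π i) := by exact_mod_cast hlt
    nlinarith [(hπ i hi).2]
  · obtain ⟨i, hi, rfl⟩ := hsurj k hk
    refine ⟨i, hi, ?_⟩
    by_contra! hle
    have h2 := hc i hi
    have h3 : (c i : F) ≤ c' (π i) := by exact_mod_cast hle
    nlinarith [(hπ i hi).2]

/-- List scheduling of jobs of equal size preserves dominance. -/
theorem Dominated.add_class {m : ℕ} {D : Finset (Fin m)} {L L' : Fin m → F}
    (h : Dominated D L L') {c c' : Fin m → ℕ} {x : F} (hx : 0 < x)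
    (hsum : ∑ i ∈ D, c i ≤ ∑ i ∈ D, c' i)
    (hc : ∀ i ∈ D, c i ≠ 0 → ∀ k ∈ D, L i + c i * x ≤ x + (L k + c k * x))
    (hc' : ∀ i ∈ D, c' i ≠ 0 → ∀ k ∈ D, L' i + c' i * x ≤ x + (L' k + c' k * x)) :
    Dominated D (fun i => L i + c i * x) (fun i => L' i + c' i * x) := by
  intro t
  change (D.filter fun i => t ≤ L i + c i * x).card ≤ (D.filter fun i => t ≤ L' i + c' i * x).card
  obtain ⟨π, hπ, -, hπs⟩ := h.exists_matching
  by_cases h1 : ∀ k ∈ D, t ≤ L' k + c' k * x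
  · rw [Finset.filter_true_of_mem h1]
    exact Finset.card_filter_le _ _
  push Not at h1
  obtain ⟨k, hk, hkt⟩ := h1
  have hgr : ∀ i ∈ D, c' i ≠ 0 → L' i + c' i * x < x + t := fun i hi h => by
    linarith [hc' i hi h k hk]
  rw [Finset.card_filter, Finset.card_filter,
    ← hπs fun i => if t ≤ L' i + c' i * x then (1 : ℕ) else 0]
  by_cases h2 : ∀ i ∈ D, t ≤ x + (L i + c i * x)
  · rw [← hπs c'] at hsum
    have : ∑ i ∈ D, ((if t ≤ L i + c i * x then (1 : ℕ) else 0) + c' (π i))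
        ≤ ∑ i ∈ D, ((if t ≤ L' (π i) + c' (π i) * x then (1 : ℕ) else 0) + c i) := by
      refine Finset.sum_le_sum fun i hi => ?_
      have hL := (hπ i hi).2
      have hg := hgr (π i) (hπ i hi).1
      have hi2 := h2 i hi
      -- Inequalities between the counts can be read off from the loads.
      have key : ∀ a b : ℕ, (a : F) * x < b * x → a < b := fun a b h => by
        exact_mod_cast lt_of_mul_lt_mul_right h hx.le
      split_ifs with h3 h4 h4
      · have : c' (π i) ≤ c i := by
          by_contra! hlt
          have h5 : ((c i : ℕ) : F) + 1 ≤ c' (π i) := by exact_mod_cast hlt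
          have := hg (by omega)
          nlinarith
        omega
      · have := key (c' (π i)) (c i) (by linarith)
        omega
      · have : c' (π i) ≤ c i + 1 := by
          by_contra! hlt
          have h5 : ((c i : ℕ) : F) + 1 + 1 ≤ c' (π i) := by exact_mod_cast hlt
          have := hg (by omega)
          nlinarith
        omega
      · have := key (c' (π i)) (c i + 1) (by push_cast; linarith)
        omega
    rw [Finset.sum_add_distrib, Finset.sum_add_distrib] at this
    omega
  · push Not at h2
    obtain ⟨l, hl, hlt⟩ := h2
    refine Finset.sum_le_sum fun i hi => ?_
    split_ifs with h3 h4
    · exact le_rfl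
    · exfalso
      have h0 : c i = 0 := by
        by_contra h0
        linarith [hc i hi h0 l hl]
      rw [h0] at h3
      have : (0 : F) ≤ c' (π i) * x := by positivity
      have := (hπ i hi).2
      push_cast at h3
      linarith
    · exact zero_le_one
    · exact le_rfl

/-- Dominance restricts to a set of machines outside of which the loads agree. -/
theorem Dominated.restrict {m : ℕ} {D : Finset (Fin m)} {L L' : Fin m → F}
    (h : Dominated Finset.univ L L') (hD : ∀ i, i ∉ D → L i = L' i) : Dominated D L L' := by
  intro t
  have h1 : ∀ f : Fin m → F, (Finset.univ.filter fun i => t ≤ f i).card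
      = (D.filter fun i => t ≤ f i).card + (Dᶜ.filter fun i => t ≤ f i).card := fun f => by
    rw [← Finset.card_union_of_disjoint, ← Finset.filter_union, Finset.union_compl]
    exact Finset.disjoint_filter_filter disjoint_compl_right
  have h2 : (Dᶜ.filter fun i => t ≤ L i) = (Dᶜ.filter fun i => t ≤ L' i) :=
    Finset.filter_congr fun i hi => by rw [hD i (Finset.mem_compl.1 hi)]
  have := h t
  rw [h1, h1, h2] at this
  omega

/-- All jobs of `J` satisfy the LPT condition. This holds iff `σ` arises from the jobs of `J` by
list scheduling in non-increasing order of size. -/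
def Stable {m : ℕ} (q : ℕ → F) (J : Finset ℕ) (σ : Sched m) : Prop :=
  ∀ j ∈ J, LPTAt q J Finset.univ σ j

theorem atLeast_atLeast {q : ℕ → F} {J : Finset ℕ} {x y : F} (h : x ≤ y) :
    atLeast q (atLeast q J x) y = atLeast q J y := by
  ext j
  rw [mem_atLeast, mem_atLeast, mem_atLeast]
  exact ⟨fun h' => ⟨h'.1.1, h'.2⟩, fun h' => ⟨⟨h'.1, h.trans h'.2⟩, h'.2⟩⟩

theorem Stable.atLeast {m : ℕ} {q : ℕ → F} {J : Finset ℕ} {σ : Sched m} (h : Stable q J σ)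
    (x : F) : Stable q (atLeast q J x) σ := by
  intro j hj i hi i' hi'
  rw [mem_atLeast] at hj
  rw [atLeast_atLeast hj.2]
  exact h j hj.1 i hi i' hi'

/-- The load decomposes into the load of the jobs larger than `x` and that of the jobs of size `x`,
if there are no smaller jobs. -/
theorem mload_eq_add_card {m : ℕ} {q : ℕ → F} {J : Finset ℕ} {x : F} (hmin : ∀ j ∈ J, x ≤ q j)
    (σ : Sched m) (i : Fin m) : mload q J σ i = mload q (J.filter fun j => x < q j) σ i
      + (onMachine (J.filter fun j => q j = x) σ i).card * x := by
  rw [mload_eq, mload_eq, ← Finset.sum_filter_add_sum_filter_not _ (fun j => x < q j)]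
  congr 1
  · refine Finset.sum_congr ?_ fun _ _ => rfl
    ext j
    simp only [Finset.mem_filter, onMachine]
    tauto
  · rw [← nsmul_eq_mul, ← Finset.sum_const]
    have : (onMachine J σ i).filter (fun j => ¬ x < q j)
        = onMachine (J.filter fun j => q j = x) σ i := by
      ext j
      simp only [Finset.mem_filter, onMachine]
      constructor
      · rintro ⟨⟨h1, h2⟩, h3⟩
        exact ⟨⟨h1, le_antisymm (not_lt.1 h3) (hmin j h1)⟩, h2⟩
      · rintro ⟨⟨h1, h2⟩, h3⟩
        exact ⟨⟨h1, h3⟩, h2.le.not_gt⟩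
    rw [this]
    exact Finset.sum_congr rfl fun j hj => (Finset.mem_filter.1 (mem_onMachine.1 hj).1).2

theorem sum_card_onMachine {m : ℕ} {J : Finset ℕ} {σ : Sched m} {M : Finset (Fin m)}
    (h : ∀ j ∈ J, ∃ i ∈ M, σ j = some i) : ∑ i ∈ M, (onMachine J σ i).card = J.card := by
  have := sum_mload_eq (fun _ => (1 : ℚ)) h
  simp only [mload_eq, Finset.sum_const, nsmul_eq_mul, mul_one] at this
  exact_mod_cast this

/-- The loads of an LPT schedule are dominated by those of an LPT schedule of more jobs. -/
theorem dominated_of_stable {m : ℕ} {q : ℕ → F} {σ σ' : Sched m} :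
    ∀ (J J' : Finset ℕ), J ⊆ J' → (∀ j ∈ J', 0 < q j) → Stable q J σ → Stable q J' σ' →
      (∀ j ∈ J, (σ j).isSome) → (∀ j ∈ J', (σ' j).isSome) →
      Dominated Finset.univ (mload q J σ) (mload q J' σ') := by
  intro J J'
  induction hn : J'.card using Nat.strong_induction_on generalizing J J' with
  | _ n ih =>
  intro hJ hq hσ hσ' hs hs'
  rcases J'.eq_empty_or_nonempty with rfl | hne
  · rw [Finset.subset_empty.1 hJ]
    intro t
    simp [mload]
  obtain ⟨j₀, hj₀, hmin⟩ := Finset.exists_min_image J' q hne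
  set x := q j₀
  have hrestr : ∀ (J : Finset ℕ) (σ : Sched m), Stable q J σ →
      Stable q (J.filter fun j => x < q j) σ := by
    intro J σ h j hj i hi i' hi'
    rw [Finset.mem_filter] at hj
    have : atLeast q (J.filter fun j => x < q j) (q j) = atLeast q J (q j) := by
      ext k
      rw [mem_atLeast, mem_atLeast, Finset.mem_filter]
      exact ⟨fun h => ⟨h.1.1, h.2⟩, fun h => ⟨⟨h.1, hj.2.trans_le h.2⟩, h.2⟩⟩
    rw [this]
    exact h j hj.1 i hi i' hi'
  have hgreedy : ∀ (J : Finset ℕ) (σ : Sched m), (∀ j ∈ J, x ≤ q j) → Stable q J σ → ∀ i,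
      (onMachine (J.filter fun j => q j = x) σ i).card ≠ 0 → ∀ k,
      mload q J σ i ≤ x + mload q J σ k := by
    intro J σ hmin h i hi k
    obtain ⟨j, hj⟩ := Finset.card_ne_zero.1 hi
    rw [mem_onMachine, Finset.mem_filter] at hj
    have h1 := h j hj.1.1 i hj.2 k (Finset.mem_univ k)
    have h2 : atLeast q J (q j) = J := Finset.filter_true_of_mem fun j' hj' => by
      rw [hj.1.2]
      exact hmin j' hj'
    rwa [h2, hj.1.2] at h1
  have hassigned : ∀ (J : Finset ℕ) (σ : Sched m), (∀ j ∈ J, (σ j).isSome) →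
      ∑ i, (onMachine (J.filter fun j => q j = x) σ i).card
        = (J.filter fun j => q j = x).card := by
    intro J σ h
    refine sum_card_onMachine fun j hj => ?_
    obtain ⟨i, hi⟩ := Option.isSome_iff_exists.1 (h j (Finset.mem_filter.1 hj).1)
    exact ⟨i, Finset.mem_univ i, hi⟩
  have h1 := ih (J'.filter fun j => x < q j).card
    (by
      rw [← hn]
      refine Finset.card_lt_card (Finset.filter_ssubset.2 ⟨j₀, hj₀, lt_irrefl x⟩))
    (J.filter fun j => x < q j) (J'.filter fun j => x < q j) rfl
    (Finset.filter_subset_filter _ hJ) (fun j hj => hq j (Finset.mem_filter.1 hj).1)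
    (hrestr J σ hσ) (hrestr J' σ' hσ') (fun j hj => hs j (Finset.mem_filter.1 hj).1)
    (fun j hj => hs' j (Finset.mem_filter.1 hj).1)
  have e := mload_eq_add_card (J := J) (fun j hj => hmin j (hJ hj)) σ
  have e' := mload_eq_add_card hmin σ'
  rw [funext e, funext e']
  refine h1.add_class (hq j₀ hj₀) ?_ ?_ ?_
  · rw [hassigned J σ hs, hassigned J' σ' hs']
    exact Finset.card_le_card (Finset.filter_subset_filter _ hJ)
  · intro i _ hi k _
    rw [← e i, ← e k]
    exact hgreedy J σ (fun j hj => hmin j (hJ hj)) hσ i hi k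
  · intro i _ hi k _
    rw [← e' i, ← e' k]
    exact hgreedy J' σ' hmin hσ' i hi k

/-- Dominance compares minimum loads. -/
theorem Dominated.exists_le {m : ℕ} {L L' : Fin m → F} (h : Dominated Finset.univ L L')
    (k : Fin m) : ∃ i, L i ≤ L' k := by
  obtain ⟨π, hπ, hs, -⟩ := h.exists_matching
  obtain ⟨i, -, rfl⟩ := hs k (Finset.mem_univ k)
  exact ⟨i, (hπ i (Finset.mem_univ i)).2⟩

section Phase

variable {m : ℕ} {D : Finset (Fin m)} {L L' : Fin m → F} {c d : Fin m → ℕ} {x : F}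

/-- The situation after a phase for jobs of size `x`. The loads were `L` in the old schedule and
`L'` in the new one, they agree outside of `D` and `L'` dominates `L` on `D`. The old schedule adds
`c i` jobs to machine `i`, in a greedy way. The new schedule adds the same `c i` jobs outside of `D`
and then, by list scheduling with ties broken in favor of `D`, further `d i` jobs everywhere. -/
structure PhaseCounts (D : Finset (Fin m)) (L L' : Fin m → F) (c d : Fin m → ℕ) (x : F) : Prop where
  pos : 0 < x
  dom : Dominated D L L'
  eq : ∀ i, i ∉ D → L i = L' i
  greedy : ∀ i, c i ≠ 0 → ∀ k, L i + c i * x ≤ x + (L k + c k * x)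
  list : ∀ i, d i ≠ 0 → ∀ k, L' i + ((if i ∈ D then 0 else c i) + d i : ℕ) * x
    ≤ x + (L' k + ((if k ∈ D then 0 else c k) + d k : ℕ) * x)
  list_lt : ∀ i, d i ≠ 0 → i ∉ D → ∀ k ∈ D, L' i + ((if i ∈ D then 0 else c i) + d i : ℕ) * x
    < x + (L' k + ((if k ∈ D then 0 else c k) + d k : ℕ) * x)
  sum_le : ∑ i ∈ D, c i ≤ ∑ i, d i

/-- The minimum load is not smaller in the new schedule. -/
theorem PhaseCounts.le_load (h : PhaseCounts D L L' c d x) {t : F}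
    (ht : ∀ i, t ≤ L i + c i * x) (k : Fin m) :
    t ≤ L' k + ((if k ∈ D then 0 else c k) + d k : ℕ) * x := by
  have hx := h.pos
  have hout : ∀ i, i ∉ D → t + d i * x ≤ L' i + ((if i ∈ D then 0 else c i) + d i : ℕ) * x := by
    intro i hi
    rw [if_neg hi, ← h.eq i hi]
    push_cast
    linarith [ht i]
  by_contra! hk
  have hkD : k ∈ D := by
    by_contra hkD
    have := hout k hkD
    have : (0 : F) ≤ d k * x := by positivity
    linarith
  have hd0 : ∀ i, i ∉ D → d i = 0 := fun i hi => by
    by_contra hdi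
    have h1 := h.list i hdi k
    have h2 := hout i hi
    have h3 : (1 : F) ≤ d i := by exact_mod_cast Nat.one_le_iff_ne_zero.2 hdi
    nlinarith
  have hsum : ∑ i ∈ D, c i ≤ ∑ i ∈ D, d i := by
    refine h.sum_le.trans_eq ?_
    exact (Finset.sum_subset (Finset.subset_univ D) fun i _ hi => hd0 i hi).symm
  have := h.dom.le_of_greedy hx (t := t) (fun i _ => ht i) (fun i hi hdi => by
    have := h.list i hdi k
    rw [if_pos hi, zero_add] at this
    linarith) hsum k hkD
  rw [if_pos hkD, zero_add] at hk
  linarith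

/-- The new schedule is greedy, too. -/
theorem PhaseCounts.greedy' (h : PhaseCounts D L L' c d x) (i : Fin m)
    (hi : (if i ∈ D then 0 else c i) + d i ≠ 0) (k : Fin m) :
    L' i + ((if i ∈ D then 0 else c i) + d i : ℕ) * x
      ≤ x + (L' k + ((if k ∈ D then 0 else c k) + d k : ℕ) * x) := by
  by_cases hd : d i = 0
  · rw [hd, add_zero] at hi
    have hiD : i ∉ D := fun hiD => hi (if_pos hiD)
    rw [if_neg hiD] at hi
    have := h.le_load (t := L i + c i * x - x) (fun k => by linarith [h.greedy i hi k]) k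
    rw [hd, add_zero, if_neg hiD, ← h.eq i hiD]
    linarith
  · exact h.list i hd k

/-- The number of jobs that are added by list scheduling to machines outside of `D` is small. -/
theorem PhaseCounts.sum_extra_le (h : PhaseCounts D L L' c d x) {g : F} (hg : 0 < g) (hgx : g ≤ x)
    (hmul : ∀ i ∈ D, ∀ k ∈ D, L i < L' k → L i + g ≤ L' k) {δ : ℕ}
    (hδ : ∑ i, d i = ∑ i ∈ D, c i + δ) :
    g * (∑ i ∈ Dᶜ, d i : ℕ) ≤ g * δ + 2 * (∑ i ∈ D, L' i - ∑ i ∈ D, L i) := by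
  have hx := h.pos
  obtain ⟨π, hπ, -, hπs⟩ := h.dom.exists_matching
  have hLL : 0 ≤ ∑ i ∈ D, L' i - ∑ i ∈ D, L i := by
    rw [← hπs L', sub_nonneg]
    exact Finset.sum_le_sum fun i hi => (hπ i hi).2
  by_cases h0 : ∀ i ∈ Dᶜ, d i = 0
  · rw [Finset.sum_eq_zero h0]
    push_cast
    have : (0 : F) ≤ g * δ := by positivity
    linarith
  push Not at h0
  obtain ⟨i₀, hi₀, hdi₀⟩ := h0
  rw [Finset.mem_compl] at hi₀
  -- Since ties are broken in favor of `D`, all machines of `D` are higher than all the machines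
  -- were when the old schedule placed its last job of size `x`.
  have hhigh : ∀ i, c i ≠ 0 → ∀ k ∈ D, L i + c i * x < x + (L' k + d k * x) := by
    intro i hi k hk
    have h1 := h.list_lt i₀ hdi₀ hi₀ k hk
    rw [if_neg hi₀, if_pos hk, ← h.eq i₀ hi₀] at h1
    have h2 := h.greedy i hi i₀
    have h3 : (1 : F) ≤ d i₀ := by exact_mod_cast Nat.one_le_iff_ne_zero.2 hdi₀
    push_cast at h1
    nlinarith
  have hterm : ∀ i ∈ D, g * ((c i : F) - d (π i)) ≤ 2 * (L' (π i) - L i) := by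
    intro i hi
    have hL := (hπ i hi).2
    rcases le_or_gt (c i) (d (π i)) with hle | hlt
    · have : (c i : F) ≤ d (π i) := by exact_mod_cast hle
      nlinarith
    · have h1 := hhigh i (by omega) (π i) (hπ i hi).1
      have h2 : (d (π i) : F) + 1 ≤ c i := by exact_mod_cast hlt
      have h3 := hmul i hi (π i) (hπ i hi).1 (by nlinarith)
      nlinarith
  have hs : g * (∑ i ∈ D, (c i : F) - ∑ i ∈ D, (d i : F))
      ≤ 2 * (∑ i ∈ D, L' i - ∑ i ∈ D, L i) := by
    rw [← hπs fun i => (d i : F), ← hπs L', ← Finset.sum_sub_distrib, ← Finset.sum_sub_distrib,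
      Finset.mul_sum, Finset.mul_sum]
    exact Finset.sum_le_sum hterm
  have hδ' : (∑ i ∈ D, (d i : F)) + ((∑ i ∈ Dᶜ, d i : ℕ) : F) = ∑ i ∈ D, (c i : F) + δ := by
    rw [← Finset.sum_add_sum_compl D] at hδ
    exact_mod_cast hδ
  nlinarith

end Phase

end Dominance

/-! ### Total correctness with running times -/

/-- Whatever the free choices, the program `x` terminates within time `V ^ k`, and its result
satisfies `Q`. -/
def Prog.Spec {α : Type} (V k : ℕ) (x : Prog α) (Q : α → Prop) : Prop :=
  ∀ s, ∃ a s', x s = some (a, s') ∧ s'.clock ≤ s.clock + V ^ k ∧ Q a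

namespace Prog.Spec

variable {α β : Type} {V k : ℕ}

theorem up {x : Prog α} {Q Q' : α → Prop} {l : ℕ} (h : Spec V k x Q) (hV : 16 ≤ V) (hkl : k ≤ l)
    (hQ : ∀ a, Q a → Q' a) : Spec V l x Q' := fun s => by
  obtain ⟨a, s', h1, h2, h3⟩ := h s
  refine ⟨a, s', h1, h2.trans ?_, hQ a h3⟩
  gcongr
  omega

theorem mono {x : Prog α} {Q Q' : α → Prop} (h : Spec V k x Q) (hQ : ∀ a, Q a → Q' a) :
    Spec V k x Q' := fun s => by
  obtain ⟨a, s', h1, h2, h3⟩ := h s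
  exact ⟨a, s', h1, h2, hQ a h3⟩

theorem pure {a : α} {Q : α → Prop} (h : Q a) : Spec V k (Pure.pure a) Q :=
  fun s => ⟨a, s, rfl, Nat.le_add_right _ _, h⟩

theorem bind {x : Prog α} {f : α → Prog β} {Q : α → Prop} {R : β → Prop} {l : ℕ}
    (h : Spec V k x Q) (hV : 16 ≤ V) (hkl : k ≤ l) (hf : ∀ a, Q a → Spec V l (f a) R) :
    Spec V (l + 1) (x >>= f) R := fun s => by
  obtain ⟨a, s', h1, h2, h3⟩ := h s
  obtain ⟨b, s'', h4, h5, h6⟩ := hf a h3 s'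
  refine ⟨b, s'', ?_, ?_, h6⟩
  · change (x s).bind (fun p => f p.1 p.2) = _
    rw [h1]
    exact h4
  · have h7 : V ^ k ≤ V ^ l := Nat.pow_le_pow_right (by omega) hkl
    have h8 : 2 * V ^ l ≤ V ^ (l + 1) := by
      rw [pow_succ, mul_comm]
      exact Nat.mul_le_mul_left _ (by omega)
    omega

theorem tick {c : ℕ} (h : c ≤ V ^ k) : Spec V k (Prog.tick c) (fun _ => True) :=
  fun _ => ⟨(), _, rfl, Nat.add_le_add_left h _, trivial⟩

/-- Both summands of a sum of times are absorbed by a higher power of `V`. -/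
theorem mul_add_one_le (hV : 16 ≤ V) {l c : ℕ} (hl : l ≤ V) (hc : c ≤ V ^ k) :
    l * (c + 1) ≤ V ^ (k + 2) := by
  have h1 : 1 ≤ V ^ k := Nat.one_le_pow _ _ (by omega)
  calc l * (c + 1) ≤ V * (V ^ k * V) := by gcongr; nlinarith
    _ = V ^ (k + 2) := by ring

theorem pick {l : List α} (hV : 16 ≤ V) (hl : l ≠ []) (hlen : l.length ≤ V) :
    Spec V 2 (Prog.pick l) (· ∈ l) := fun s => by
  have h1 : s.coins 0 % l.length < l.length := Nat.mod_lt _ (List.length_pos_iff.2 hl)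
  refine ⟨l[s.coins 0 % l.length],
    { clock := s.clock + l.length + 1, coins := fun k => s.coins (k + 1) }, ?_, ?_,
    List.getElem_mem h1⟩
  · unfold Prog.pick
    rw [List.getElem?_eq_getElem h1]
    rfl
  · have : V * 2 ≤ V ^ 2 := by
      rw [pow_two]
      exact Nat.mul_le_mul_left _ (by omega)
    simp only
    omega

/-- Filtering a list of length at most `V`. -/
theorem filter {t : α → Prog Bool} {p : α → Prop} {l : List α} (hV : 16 ≤ V) (hlen : l.length ≤ V)
    (h : ∀ a ∈ l, Spec V k (t a) (fun b => b = true ↔ p a)) :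
    Spec V (k + 2) (Prog.filter t l) (fun r => r.Sublist l ∧ ∀ a, a ∈ r ↔ a ∈ l ∧ p a) := by
  have key : ∀ l : List α, (∀ a ∈ l, Spec V k (t a) (fun b => b = true ↔ p a)) → ∀ s,
      ∃ r s', Prog.filter t l s = some (r, s') ∧ s'.clock ≤ s.clock + l.length * (V ^ k + 1) ∧
        r.Sublist l ∧ ∀ a, a ∈ r ↔ a ∈ l ∧ p a := by
    intro l
    induction l with
    | nil => exact fun _ s => ⟨[], s, rfl, by simp, List.Sublist.refl _, by simp⟩
    | cons a l ih =>
      intro h s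
      obtain ⟨b, s1, h1, h2, h3⟩ := h a List.mem_cons_self { s with clock := s.clock + 1 }
      obtain ⟨r, s2, h4, h5, h6, h7⟩ := ih (fun a ha => h a (List.mem_cons_of_mem _ ha)) s1
      refine ⟨if b then a :: r else r, s2, ?_, ?_, ?_, ?_⟩
      · change (t a { s with clock := s.clock + 1 }).bind (fun p => (Prog.filter t l p.2).bind
          fun p' => some (if p.1 then a :: p'.1 else p'.1, p'.2)) = _
        rw [h1]
        change (Prog.filter t l s1).bind _ = _
        rw [h4]
        rfl
      · simp only at h2
        rw [List.length_cons, add_mul]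
        omega
      · split_ifs
        exacts [h6.cons_cons a, h6.cons a]
      · intro a'
        split_ifs with hb
        · rw [List.mem_cons, List.mem_cons, h7]
          constructor
          · rintro (rfl | h)
            exacts [⟨Or.inl rfl, h3.1 hb⟩, ⟨Or.inr h.1, h.2⟩]
          · rintro ⟨rfl | h, h'⟩
            exacts [Or.inl rfl, Or.inr ⟨h, h'⟩]
        · rw [List.mem_cons, h7]
          constructor
          · exact fun h => ⟨Or.inr h.1, h.2⟩
          · rintro ⟨rfl | h, h'⟩
            exacts [absurd (h3.2 h') hb, ⟨h, h'⟩]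
  intro s
  obtain ⟨r, s', h1, h2, h3⟩ := key l h s
  exact ⟨r, s', h1, h2.trans (Nat.add_le_add_left (mul_add_one_le hV hlen le_rfl) _), h3⟩

theorem all {t : α → Prog Bool} {p : α → Prop} {l : List α} (hV : 16 ≤ V) (hlen : l.length ≤ V)
    (h : ∀ a ∈ l, Spec V k (t a) (fun b => b = true ↔ p a)) :
    Spec V (k + 2) (Prog.all t l) (fun r => r = true ↔ ∀ a ∈ l, p a) := by
  have key : ∀ l : List α, (∀ a ∈ l, Spec V k (t a) (fun b => b = true ↔ p a)) → ∀ s,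
      ∃ r s', Prog.all t l s = some (r, s') ∧ s'.clock ≤ s.clock + l.length * (V ^ k + 1) ∧
        (r = true ↔ ∀ a ∈ l, p a) := by
    intro l
    induction l with
    | nil => exact fun _ s => ⟨true, s, rfl, by simp, by simp⟩
    | cons a l ih =>
      intro h s
      obtain ⟨b, s1, h1, h2, h3⟩ := h a List.mem_cons_self { s with clock := s.clock + 1 }
      obtain ⟨r, s2, h4, h5, h6⟩ := ih (fun a ha => h a (List.mem_cons_of_mem _ ha)) s1
      refine ⟨b && r, s2, ?_, ?_, ?_⟩
      · change (t a { s with clock := s.clock + 1 }).bind (fun p => (Prog.all t l p.2).bind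
          fun p' => some (p.1 && p'.1, p'.2)) = _
        rw [h1]
        change (Prog.all t l s1).bind _ = _
        rw [h4]
        rfl
      · simp only at h2
        rw [List.length_cons, add_mul]
        omega
      · rw [Bool.and_eq_true, h3, h6, List.forall_mem_cons]
  intro s
  obtain ⟨r, s', h1, h2, h3⟩ := key l h s
  exact ⟨r, s', h1, h2.trans (Nat.add_le_add_left (mul_add_one_le hV hlen le_rfl) _), h3⟩

theorem map {f : α → Prog β} {g : α → β} {l : List α} (hV : 16 ≤ V) (hlen : l.length ≤ V)
    (h : ∀ a ∈ l, Spec V k (f a) (fun b => b = g a)) :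
    Spec V (k + 2) (Prog.map f l) (fun r => r = l.map g) := by
  have key : ∀ l : List α, (∀ a ∈ l, Spec V k (f a) (fun b => b = g a)) → ∀ s,
      ∃ r s', Prog.map f l s = some (r, s') ∧ s'.clock ≤ s.clock + l.length * (V ^ k + 1) ∧
        r = l.map g := by
    intro l
    induction l with
    | nil => exact fun _ s => ⟨[], s, rfl, by simp, rfl⟩
    | cons a l ih =>
      intro h s
      obtain ⟨b, s1, h1, h2, h3⟩ := h a List.mem_cons_self { s with clock := s.clock + 1 }
      obtain ⟨r, s2, h4, h5, h6⟩ := ih (fun a ha => h a (List.mem_cons_of_mem _ ha)) s1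
      refine ⟨b :: r, s2, ?_, ?_, ?_⟩
      · change (f a { s with clock := s.clock + 1 }).bind (fun p => (Prog.map f l p.2).bind
          fun p' => some (p.1 :: p'.1, p'.2)) = _
        rw [h1]
        change (Prog.map f l s1).bind _ = _
        rw [h4]
        rfl
      · simp only at h2
        rw [List.length_cons, add_mul]
        omega
      · rw [h3, h6, List.map_cons]
  intro s
  obtain ⟨r, s', h1, h2, h3⟩ := key l h s
  exact ⟨r, s', h1, h2.trans (Nat.add_le_add_left (mul_add_one_le hV hlen le_rfl) _), h3⟩

/-- Folding over a list of length at most `V`; the invariant `I` depends on the remaining list. -/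
theorem fold {f : β → α → Prog β} {I : List α → β → Prop} {l : List α} {b : β} (hV : 16 ≤ V)
    (hlen : l.length ≤ V) (hI : I l b)
    (h : ∀ a r b, I (a :: r) b → Spec V k (f b a) (I r)) :
    Spec V (k + 2) (Prog.fold f b l) (I []) := by
  have key : ∀ (l : List α) (b : β), I l b → ∀ s,
      ∃ r s', Prog.fold f b l s = some (r, s') ∧ s'.clock ≤ s.clock + l.length * (V ^ k + 1) ∧
        I [] r := by
    intro l
    induction l with
    | nil => exact fun b hb s => ⟨b, s, rfl, by simp, hb⟩
    | cons a l ih =>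
      intro b hb s
      obtain ⟨b', s1, h1, h2, h3⟩ := h a l b hb { s with clock := s.clock + 1 }
      obtain ⟨r, s2, h4, h5, h6⟩ := ih b' h3 s1
      refine ⟨r, s2, ?_, ?_, h6⟩
      · change (f b a { s with clock := s.clock + 1 }).bind
          (fun p => Prog.fold f p.1 l p.2) = _
        rw [h1]
        exact h4
      · simp only at h2
        rw [List.length_cons, add_mul]
        omega
  intro s
  obtain ⟨r, s', h1, h2, h3⟩ := key l b hI s
  exact ⟨r, s', h1, h2.trans (Nat.add_le_add_left (mul_add_one_le hV hlen le_rfl) _), h3⟩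

theorem mem [DecidableEq α] {a : α} {l : List α} (hV : 16 ≤ V) (hlen : l.length ≤ V) :
    Spec V 3 (Prog.mem a l) (fun b => b = true ↔ a ∈ l) := by
  refine (tick (k := 2) ?_).bind hV le_rfl fun _ _ => pure ?_
  · nlinarith
  · simp

/-- Iterating a program a number `N ≤ V` of times, where the invariant `I` counts the remaining
iterations. -/
theorem iterate {γ : Type} {prog : ℕ → γ → Prog β} {I : ℕ → γ → Prop} {Q : γ → β → Prop}
    (hV : 16 ≤ V) (h0 : ∀ a, I 0 a → ∀ s, ∃ b, prog 0 a s = some (b, s) ∧ Q a b)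
    (hs : ∀ N a, I (N + 1) a → ∀ s, ∃ a' s', prog (N + 1) a s = prog N a' s' ∧
      s'.clock ≤ s.clock + V ^ k ∧ I N a' ∧ ∀ b, Q a' b → Q a b)
    {N : ℕ} (hN : N ≤ V) {a : γ} (ha : I N a) : Spec V (k + 2) (prog N a) (Q a) := by
  have key : ∀ N a, I N a → ∀ s, ∃ b s', prog N a s = some (b, s') ∧
      s'.clock ≤ s.clock + N * (V ^ k + 1) ∧ Q a b := by
    intro N
    induction N with
    | zero =>
      intro a ha s
      obtain ⟨b, h1, h2⟩ := h0 a ha s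
      exact ⟨b, s, h1, by simp, h2⟩
    | succ N ih =>
      intro a ha s
      obtain ⟨a', s1, h1, h2, h3, h4⟩ := hs N a ha s
      obtain ⟨b, s2, h5, h6, h7⟩ := ih a' h3 s1
      refine ⟨b, s2, h1.trans h5, ?_, h4 b h7⟩
      rw [add_mul]
      omega
  intro s
  obtain ⟨r, s', h1, h2, h3⟩ := key N a ha s
  exact ⟨r, s', h1, h2.trans (Nat.add_le_add_left (mul_add_one_le hV hN le_rfl) _), h3⟩

/-- A loop whose invariant `I` comes with a measure `μ ≤ V` that decreases in each step. -/
theorem loop {body : α → Prog (α × Bool)} {I Q : α → Prop} {μ : α → ℕ} (hV : 16 ≤ V)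
    (h : ∀ a, I a → Spec V k (body a) (fun r => (r.2 = true ∧ Q r.1) ∨
      (r.2 = false ∧ I r.1 ∧ μ r.1 < μ a))) {a : α} (ha : I a) (hμ : μ a + 1 ≤ V) :
    Spec V (k + 2) (Prog.loop body a) Q := by
  have step : ∀ N a s, Prog.loopAtMost body (N + 1) a s =
      (body a s).bind fun p => (if p.1.2 then Pure.pure p.1.1
        else Prog.loopAtMost body N p.1.1 : Prog α) p.2 := fun N a s => rfl
  have key : ∀ N a, I a → μ a < N → ∀ s, ∃ b s', Prog.loopAtMost body N a s = some (b, s') ∧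
      s'.clock ≤ s.clock + N * (V ^ k + 1) ∧ Q b := by
    intro N
    induction N with
    | zero => exact fun a _ h => absurd h (Nat.not_lt_zero _)
    | succ N ih =>
      intro a ha hlt s
      obtain ⟨⟨a', b⟩, s1, h1, h2, h3⟩ := h a ha s
      rw [step, h1, Option.bind_some]
      rcases h3 with ⟨hb, hQ⟩ | ⟨hb, hI, hlt'⟩
      · simp only at hb
        subst hb
        refine ⟨a', s1, rfl, h2.trans ?_, hQ⟩
        rw [add_mul]
        omega
      · simp only at hb hlt'
        subst hb
        obtain ⟨b, s2, h4, h5, h6⟩ := ih a' hI (by omega) s1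
        refine ⟨b, s2, h4, ?_, h6⟩
        rw [add_mul]
        omega
  -- More rounds than necessary do not change the result.
  have stable : ∀ N a s r, Prog.loopAtMost body N a s = some r →
      ∀ N', N ≤ N' → Prog.loopAtMost body N' a s = some r := by
    intro N
    induction N with
    | zero => exact fun a s r h => by simp [Prog.loopAtMost] at h
    | succ N ih =>
      intro a s r h N' hN'
      obtain ⟨N', rfl⟩ : ∃ k, N' = k + 1 := ⟨N' - 1, by omega⟩
      rw [step] at h ⊢
      rcases hb : body a s with _ | ⟨⟨a', b⟩, s1⟩
      · rw [hb] at h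
        exact absurd h (by simp)
      · rw [hb, Option.bind_some] at h
        rw [Option.bind_some]
        cases b
        · exact ih a' s1 r h N' (by omega)
        · exact h
  intro s
  obtain ⟨b, s', h1, h2, h3⟩ := key (μ a + 1) a ha (Nat.lt_succ_self _) s
  refine ⟨b, s', ?_, h2.trans (Nat.add_le_add_left (mul_add_one_le hV hμ le_rfl) _), h3⟩
  have hex : ∃ k, (Prog.loopAtMost body k a s).isSome := ⟨μ a + 1, by rw [h1]; rfl⟩
  unfold Prog.loop
  rw [dif_pos hex]
  classical
  obtain ⟨r, hr⟩ := Option.isSome_iff_exists.1 (Nat.find_spec hex)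
  have h4 := stable _ a s r hr (μ a + 1) (Nat.find_min' hex (by rw [h1]; rfl))
  rw [h1] at h4
  rw [h4]
  convert hr

section Arithmetic

variable {F : Type} [Field F] [LinearOrder F] [IsStrictOrderedRing F] [FloorRing F]
  {size : F → ℕ} {x y : F}

theorem charge₁ (hV : 16 ≤ V) (hx : size x ≤ V) :
    Spec V 4 (Prog.charge size [x]) (fun _ => True) := by
  refine tick ?_
  simp only [List.map_cons, List.map_nil, List.sum_cons, List.sum_nil]
  calc (1 + (size x + 0)) ^ 2 ≤ (V * V) ^ 2 := by gcongr; nlinarith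
    _ = V ^ 4 := by ring

theorem charge₂ (hV : 16 ≤ V) (hx : size x ≤ V) (hy : size y ≤ V) :
    Spec V 4 (Prog.charge size [x, y]) (fun _ => True) := by
  refine tick ?_
  simp only [List.map_cons, List.map_nil, List.sum_cons, List.sum_nil]
  calc (1 + (size x + (size y + 0))) ^ 2 ≤ (V * V) ^ 2 := by gcongr; nlinarith
    _ = V ^ 4 := by ring

theorem add (hV : 16 ≤ V) (hx : size x ≤ V) (hy : size y ≤ V) :
    Spec V 5 (Prog.add size x y) (fun r => r = x + y) :=
  (charge₂ hV hx hy).bind hV le_rfl fun _ _ => pure rfl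

theorem sub (hV : 16 ≤ V) (hx : size x ≤ V) (hy : size y ≤ V) :
    Spec V 5 (Prog.sub size x y) (fun r => r = x - y) :=
  (charge₂ hV hx hy).bind hV le_rfl fun _ _ => pure rfl

theorem mul (hV : 16 ≤ V) (hx : size x ≤ V) (hy : size y ≤ V) :
    Spec V 5 (Prog.mul size x y) (fun r => r = x * y) :=
  (charge₂ hV hx hy).bind hV le_rfl fun _ _ => pure rfl

theorem div (hV : 16 ≤ V) (hx : size x ≤ V) (hy : size y ≤ V) :
    Spec V 5 (Prog.div size x y) (fun r => r = x / y) :=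
  (charge₂ hV hx hy).bind hV le_rfl fun _ _ => pure rfl

theorem lt (hV : 16 ≤ V) (hx : size x ≤ V) (hy : size y ≤ V) :
    Spec V 5 (Prog.lt size x y) (fun r => r = true ↔ x < y) :=
  (charge₂ hV hx hy).bind hV le_rfl fun _ _ => pure (by simp)

theorem le (hV : 16 ≤ V) (hx : size x ≤ V) (hy : size y ≤ V) :
    Spec V 5 (Prog.le size x y) (fun r => r = true ↔ x ≤ y) :=
  (charge₂ hV hx hy).bind hV le_rfl fun _ _ => pure (by simp)

theorem eq (hV : 16 ≤ V) (hx : size x ≤ V) (hy : size y ≤ V) :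
    Spec V 5 (Prog.eq size x y) (fun r => r = true ↔ x = y) :=
  (charge₂ hV hx hy).bind hV le_rfl fun _ _ => pure (by simp)

theorem floor (hV : 16 ≤ V) (hx : size x ≤ V) :
    Spec V 5 (Prog.floor size x) (fun r => r = (⌊x⌋ : F)) :=
  (charge₁ hV hx).bind hV le_rfl fun _ _ => pure rfl

theorem log2 (hV : 16 ≤ V) (hx : size x ≤ V) :
    Spec V 5 (Prog.log2 size x) (fun r => r = Int.log 2 x) :=
  (charge₁ hV hx).bind hV le_rfl fun _ _ => pure rfl

theorem clog2 (hV : 16 ≤ V) (hx : size x ≤ V) :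
    Spec V 5 (Prog.clog2 size x) (fun r => r = Int.clog 2 x) :=
  (charge₁ hV hx).bind hV le_rfl fun _ _ => pure rfl

theorem pow2 (hV : 16 ≤ V) {e : ℤ} (he : e.natAbs ≤ V) :
    Spec V 5 (Prog.pow2 e : Prog F) (fun r => r = (2 : F) ^ e) := by
  refine (tick (k := 4) ?_).bind hV le_rfl fun _ _ => pure rfl
  calc (1 + e.natAbs) ^ 2 ≤ (V * V) ^ 2 := by gcongr; nlinarith
    _ = V ^ 4 := by ring

end Arithmetic

end Prog.Spec

/-! ### The schedules produced by list scheduling and LPT -/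

namespace OnlineLPT

section Programs

variable {F : Type} [Field F] [LinearOrder F] [IsStrictOrderedRing F] [FloorRing F]
  {m : ℕ} {size : F → ℕ} {q : ℕ → F} {n V : ℕ}

/-- The set of the jobs `0, …, n`. -/
abbrev jobs (n : ℕ) : Finset ℕ := Finset.range (n + 1)

/-- The numbers `m` and `n + 1` and the sizes of the representations of all sums of distinct job
sizes are at most `V`. -/
structure SumBound (m : ℕ) (size : F → ℕ) (q : ℕ → F) (n V : ℕ) : Prop where
  le_V : 16 ≤ V
  m_le : m ≤ V
  n_le : n + 1 ≤ V
  sum_le : ∀ s ⊆ jobs n, size (∑ j ∈ s, q j) ≤ V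

theorem SumBound.size_le (h : SumBound m size q n V) {j : ℕ} (hj : j ≤ n) : size (q j) ≤ V := by
  have := h.sum_le {j} (by simpa [jobs] using Nat.lt_succ_of_le hj)
  rwa [Finset.sum_singleton] at this

theorem SumBound.mload_le (h : SumBound m size q n V) (σ : Sched m) (i : Fin m) :
    size (mload q (jobs n) σ i) ≤ V := h.sum_le _ (Finset.filter_subset _ _)

theorem SumBound.range_le (h : SumBound m size q n V) : (List.range (n + 1)).length ≤ V := by
  rw [List.length_range]
  exact h.n_le

theorem SumBound.finRange_le (h : SumBound m size q n V) : (List.finRange m).length ≤ V := by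
  rw [List.length_finRange]
  exact h.m_le

theorem SumBound.sublist_le (h : SumBound m size q n V) {l : List (Fin m)}
    (hl : l.Sublist (List.finRange m)) : l.length ≤ V := hl.length_le.trans h.finRange_le

theorem SumBound.sublist_range_le (h : SumBound m size q n V) {l : List ℕ}
    (hl : l.Sublist (List.range (n + 1))) : l.length ≤ V := hl.length_le.trans h.range_le

theorem load_spec (h : SumBound m size q n V) (σ : Sched m) (i : Fin m) :
    Prog.Spec V 7 (load size q n σ i) (fun r => r = mload q (jobs n) σ i) := by
  refine (Prog.Spec.fold (k := 5) (I := fun r a => ∃ l, l ++ r = List.range (n + 1) ∧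
    a = ∑ j ∈ l.toFinset with σ j = some i, q j) h.le_V h.range_le ⟨[], rfl, by simp⟩ ?_).mono ?_
  · rintro j r a ⟨l, hl, rfl⟩
    have hnd : (l ++ j :: r).Nodup := hl ▸ List.nodup_range
    have hsub : ∀ k ∈ l ++ j :: r, k ≤ n := fun k hk => by
      rw [hl, List.mem_range] at hk
      omega
    have hj : j ∉ l.toFinset := fun hj => by
      rw [List.mem_toFinset] at hj
      exact (List.disjoint_of_nodup_append hnd) hj List.mem_cons_self
    have h1 : (l ++ [j]).toFinset = insert j l.toFinset := by
      ext k
      simp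
    split_ifs with hji
    · refine (Prog.Spec.add h.le_V (h.sum_le _ ?_) (h.size_le (hsub j (by simp)))).mono ?_
      · intro k hk
        have := hsub k (by simp [List.mem_toFinset.1 (Finset.mem_filter.1 hk).1])
        simpa [jobs] using Nat.lt_succ_of_le this
      · rintro _ rfl
        refine ⟨l ++ [j], by simpa using hl, ?_⟩
        rw [h1, Finset.filter_insert, if_pos hji, Finset.sum_insert, add_comm]
        exact fun h => hj (Finset.mem_filter.1 h).1
    · refine Prog.Spec.pure ⟨l ++ [j], by simpa using hl, ?_⟩
      rw [h1, Finset.filter_insert, if_neg hji]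
  · rintro a ⟨l, hl, rfl⟩
    rw [List.append_nil] at hl
    rw [mload, hl]
    congr 2
    ext k
    simp [jobs]

theorem leastLoaded_spec (h : SumBound m size q n V) (σ : Sched m) :
    Prog.Spec V 14 (leastLoaded size q n σ) (fun L => L.Sublist (List.finRange m) ∧
      ∀ i, i ∈ L ↔ ∀ i', mload q (jobs n) σ i ≤ mload q (jobs n) σ i') := by
  refine (Prog.Spec.filter h.le_V h.finRange_le
    (p := fun i => ∀ i', mload q (jobs n) σ i ≤ mload q (jobs n) σ i') fun i _ =>
    (Prog.Spec.all h.le_V h.finRange_le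
      (p := fun i' => mload q (jobs n) σ i ≤ mload q (jobs n) σ i') fun i' _ =>
      (load_spec h σ i).bind h.le_V (by norm_num : 7 ≤ 9) fun a ha =>
      (load_spec h σ i').bind h.le_V (by norm_num : 7 ≤ 8) fun b hb => ?_).mono
    fun b hb => by simpa using hb).mono fun L hL => ⟨hL.1, fun i => by simpa using hL.2 i⟩
  subst ha hb
  exact (Prog.Spec.le h.le_V (h.mload_le σ i) (h.mload_le σ i')).up h.le_V (by norm_num)
    fun _ h => h

/-- `pickLeast` returns a least loaded machine, and if it is not in `pref`, then all machines in
`pref` have larger load. -/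
theorem pickLeast_spec (h : SumBound m size q n V) (hm : 0 < m) {pref : List (Fin m)}
    (hpref : pref.length ≤ V) (σ : Sched m) :
    Prog.Spec V 17 (pickLeast size q n pref σ) (fun i =>
      (∀ i', mload q (jobs n) σ i ≤ mload q (jobs n) σ i') ∧
      (i ∉ pref → ∀ i' ∈ pref, mload q (jobs n) σ i < mload q (jobs n) σ i')) := by
  refine (leastLoaded_spec h σ).bind h.le_V (by norm_num : 14 ≤ 16) fun L hL => ?_
  refine (Prog.Spec.filter h.le_V (h.sublist_le hL.1) (p := fun i => i ∈ pref)
    fun i _ => Prog.Spec.mem h.le_V hpref).bind h.le_V (by norm_num : 5 ≤ 15) fun L' hL' => ?_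
  have hne : L ≠ [] := by
    obtain ⟨i, -, hi⟩ := Finset.exists_min_image (Finset.univ : Finset (Fin m))
      (mload q (jobs n) σ) ⟨⟨0, hm⟩, Finset.mem_univ _⟩
    exact List.ne_nil_of_mem ((hL.2 i).2 fun i' => hi i' (Finset.mem_univ _))
  refine (Prog.Spec.pick h.le_V ?_ ?_).up h.le_V (by norm_num : 2 ≤ 15) fun i hi => ?_
  · split_ifs with h0
    · exact hne
    · simpa using h0
  · split_ifs with h0
    · exact h.sublist_le hL.1
    · exact h.sublist_le (hL'.1.trans hL.1)
  · split_ifs at hi with h0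
    · refine ⟨(hL.2 i).1 hi, fun _ i' hi' => lt_of_le_of_ne ((hL.2 i).1 hi i') fun heq => ?_⟩
      have : i' ∈ L' := (hL'.2 i').2 ⟨(hL.2 i').2 fun k => heq ▸ (hL.2 i).1 hi k, hi'⟩
      rw [List.isEmpty_iff.1 h0] at this
      simp at this
    · have := (hL'.2 i).1 hi
      exact ⟨(hL.2 i).1 this.1, fun hp => absurd this.2 hp⟩

/-- `σ₂` arises from `σ` by list scheduling of the jobs in the list `js`, with ties broken in favor
of `pref`: on every machine that gets some of these jobs, the last one was added when the machine
was least loaded. -/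
structure ListScheduled (q : ℕ → F) (n : ℕ) (pref : List (Fin m)) (js : List ℕ)
    (σ σ₂ : Sched m) : Prop where
  eq : ∀ j, j ∉ js → σ₂ j = σ j
  isSome : ∀ j ∈ js, (σ₂ j).isSome
  last : ∀ j ∈ js, ∀ i, σ₂ j = some i → ∃ j' ∈ js, σ₂ j' = some i ∧
    (∀ i', mload q (jobs n) σ₂ i ≤ q j' + mload q (jobs n) σ₂ i') ∧
    (i ∉ pref → ∀ i' ∈ pref, mload q (jobs n) σ₂ i < q j' + mload q (jobs n) σ₂ i')

theorem mload_update {J : Finset ℕ} {σ : Sched m} {j : ℕ} (hj : j ∈ J) (hσ : σ j = none)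
    (i : Fin m) : mload q J (Function.update σ j (some i)) i = q j + mload q J σ i := by
  have h1 : onMachine J (Function.update σ j (some i)) i = insert j (onMachine J σ i) := by
    ext k
    rw [Finset.mem_insert, mem_onMachine, mem_onMachine]
    by_cases hk : k = j
    · subst hk
      simp [hj]
    · simp [hk]
  rw [mload_eq, mload_eq, h1, Finset.sum_insert]
  rw [mem_onMachine, hσ]
  simp

theorem mload_le_of_extends {J : Finset ℕ} {σ σ' : Sched m} (hq : ∀ j ∈ J, 0 ≤ q j)
    (h : ∀ j i, σ j = some i → σ' j = some i) (i : Fin m) : mload q J σ i ≤ mload q J σ' i := by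
  refine Finset.sum_le_sum_of_subset_of_nonneg (fun j hj => ?_)
    fun j hj _ => hq j (Finset.mem_filter.1 hj).1
  rw [Finset.mem_filter] at hj ⊢
  exact ⟨hj.1, h j i hj.2⟩

theorem listSchedule_spec (h : SumBound m size q n V) (hm : 0 < m) (hq : ∀ j ∈ jobs n, 0 ≤ q j)
    {pref : List (Fin m)} (hpref : pref.length ≤ V) {js : List ℕ} (hjs : js.Nodup)
    (hsub : ∀ j ∈ js, j ≤ n) {σ : Sched m} (hσ : ∀ j ∈ js, σ j = none) (hlen : js.length ≤ V) :
    Prog.Spec V 22 (listSchedule size q n pref js.length js σ)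
      (ListScheduled q n pref js σ) := by
  have key := Prog.Spec.iterate (k := 20)
    (prog := fun N (a : List ℕ × Sched m) => listSchedule size q n pref N a.1 a.2)
    (I := fun N a => a.1.length = N ∧ N ≤ V ∧ a.1.Nodup ∧ (∀ j ∈ a.1, j ≤ n) ∧
      ∀ j ∈ a.1, a.2 j = none)
    (Q := fun a b => ListScheduled q n pref a.1 a.2 b) h.le_V ?_ ?_ hlen
    (a := (js, σ)) ⟨rfl, hlen, hjs, hsub, hσ⟩
  · exact key
  · rintro ⟨js, σ⟩ ⟨h0, -⟩ s
    have : js = [] := List.length_eq_zero_iff.1 h0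
    subst this
    exact ⟨σ, rfl, fun _ _ => rfl, by simp, by simp⟩
  · rintro N ⟨js, σ⟩ ⟨h0, hN, hnd, hsub, hσ⟩ s
    simp only at h0 hnd hsub hσ
    have hone : Prog.Spec V 20 (do
        let j ← Prog.pick js
        let i ← pickLeast size q n pref σ
        Prog.tick (js.length + 1)
        pure (j, i)) (fun r => r.1 ∈ js ∧
          (∀ i', mload q (jobs n) σ r.2 ≤ mload q (jobs n) σ i') ∧
          (r.2 ∉ pref → ∀ i' ∈ pref, mload q (jobs n) σ r.2 < mload q (jobs n) σ i')) := by
      refine (Prog.Spec.pick h.le_V ?_ (h0 ▸ hN)).bind h.le_V (by norm_num : 2 ≤ 19) fun j hj => ?_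
      · rintro rfl
        simp at h0
      refine (pickLeast_spec h hm hpref σ).bind h.le_V (by norm_num : 17 ≤ 18) fun i hi => ?_
      refine (Prog.Spec.tick (k := 2) ?_).bind h.le_V (by norm_num : 2 ≤ 17) fun _ _ => ?_
      · have := h.le_V
        rw [h0]
        nlinarith
      exact Prog.Spec.pure ⟨hj, hi⟩
    obtain ⟨⟨j, i⟩, s', h1, h2, hj, hi, hip⟩ := hone s
    refine ⟨(js.erase j, Function.update σ j (some i)), s', ?_, h2, ?_, ?_⟩
    · have e : listSchedule size q n pref (N + 1) js σ = (do
          let j ← Prog.pick js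
          let i ← pickLeast size q n pref σ
          Prog.tick (js.length + 1)
          pure (j, i)) >>= fun r =>
            listSchedule size q n pref N (js.erase r.1) (Function.update σ r.1 (some r.2)) := by
        simp only [listSchedule, bind_assoc, pure_bind]
      change listSchedule size q n pref (N + 1) js σ s = _
      rw [e]
      change Option.bind _ _ = _
      rw [h1]
      rfl
    · refine ⟨?_, by omega, hnd.erase j, fun k hk => hsub k (List.mem_of_mem_erase hk),
        fun k hk => ?_⟩
      · rw [List.length_erase_of_mem hj]
        omega
      · rw [hnd.mem_erase_iff] at hk
        change Function.update σ j (some i) k = none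
        rw [Function.update_of_ne hk.1]
        exact hσ k hk.2
    · rintro σ₂ ⟨e1, e2, e3⟩
      simp only at e1 e2 e3 hj hi hip ⊢
      have hjn : j ∈ jobs n := Finset.mem_range.2 (Nat.lt_succ_of_le (hsub j hj))
      have hj2 : σ₂ j = some i := by
        rw [e1 j fun h => (hnd.mem_erase_iff.1 h).1 rfl, Function.update_self]
      have hext : ∀ k l, σ k = some l → σ₂ k = some l := fun k l hk => by
        have hkj : k ∉ js := fun hkj => by
          rw [hσ k hkj] at hk
          simp at hk
        rw [e1 k fun h => hkj (List.mem_of_mem_erase h), Function.update_of_ne, hk]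
        rintro rfl
        exact hkj hj
      refine ⟨fun k hk => ?_, fun k hk => ?_, fun k hk l hkl => ?_⟩
      · rw [e1 k fun h => hk (List.mem_of_mem_erase h), Function.update_of_ne]
        rintro rfl
        exact hk hj
      · by_cases hkj : k = j
        · rw [hkj, hj2]
          rfl
        · exact e2 k (hnd.mem_erase_iff.2 ⟨hkj, hk⟩)
      · by_cases hex : ∃ k' ∈ js.erase j, σ₂ k' = some l
        · obtain ⟨k', hk', hk'l⟩ := hex
          obtain ⟨j', hj', h'⟩ := e3 k' hk' l hk'l
          exact ⟨j', List.mem_of_mem_erase hj', h'⟩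
        · push Not at hex
          have hkj : k = j := by
            by_contra hkj
            exact hex k (hnd.mem_erase_iff.2 ⟨hkj, hk⟩) hkl
          subst hkj
          have hli : l = i := by
            rw [hj2] at hkl
            simpa using hkl.symm
          subst hli
          have hload : mload q (jobs n) σ₂ l = q k + mload q (jobs n) σ l := by
            rw [← mload_update hjn (hσ k hj) l]
            refine mload_congr fun k' => and_congr_right fun _ => ?_
            by_cases hk' : k' ∈ js.erase k
            · have h1 := hex k' hk'
              have h2 := hnd.mem_erase_iff.1 hk'
              rw [Function.update_of_ne h2.1, hσ k' h2.2]
              simp [h1]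
            · rw [e1 k' hk']
          refine ⟨k, hj, hj2, fun i' => ?_, fun hl i' hi' => ?_⟩
          · rw [hload]
            have := mload_le_of_extends hq hext i'
            linarith [hi i']
          · rw [hload]
            have := mload_le_of_extends hq hext i'
            linarith [hip hl i' hi']

theorem scheduleRest_spec (h : SumBound m size q n V) (hm : 0 < m) (hq : ∀ j ∈ jobs n, 0 ≤ q j)
    {pref : List (Fin m)} (hpref : pref.length ≤ V) {js : List ℕ}
    (hjs : js.Sublist (List.range (n + 1))) (σ : Sched m) :
    Prog.Spec V 23 (scheduleRest size q n pref js σ) (fun σ₂ => ∃ rest : List ℕ,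
      (∀ j, j ∈ rest ↔ j ∈ js ∧ σ j = none) ∧ ListScheduled q n pref rest σ σ₂) := by
  refine (Prog.Spec.filter (k := 1) h.le_V (h.sublist_range_le hjs) (p := fun j => σ j = none)
    fun j _ => Prog.Spec.pure (by simp)).bind h.le_V (by norm_num : 3 ≤ 22) fun rest hr => ?_
  have hsub := hr.1.trans hjs
  refine (listSchedule_spec h hm hq hpref (hsub.nodup List.nodup_range) (fun j hj => ?_)
    (fun j hj => ((hr.2 j).1 hj).2) (h.sublist_range_le hsub)).mono fun σ₂ h2 => ⟨rest, hr.2, h2⟩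
  have := List.mem_range.1 (hsub.subset hj)
  omega

theorem largest_spec (h : SumBound m size q n V) {js : List ℕ}
    (hjs : js.Sublist (List.range (n + 1))) :
    Prog.Spec V 9 (largest size q js) (fun L => L.Sublist js ∧
      ∀ j, j ∈ L ↔ j ∈ js ∧ ∀ j' ∈ js, q j' ≤ q j) := by
  have hle : ∀ j ∈ js, size (q j) ≤ V := fun j hj =>
    h.size_le (Nat.lt_succ_iff.1 (List.mem_range.1 (hjs.subset hj)))
  exact Prog.Spec.filter h.le_V (h.sublist_range_le hjs) fun j hj =>
    Prog.Spec.all h.le_V (h.sublist_range_le hjs) fun j' hj' =>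
      Prog.Spec.le h.le_V (hle j' hj') (hle j hj)

theorem smallest_spec (h : SumBound m size q n V) {js : List ℕ}
    (hjs : js.Sublist (List.range (n + 1))) :
    Prog.Spec V 9 (smallest size q js) (fun L => L.Sublist js ∧
      ∀ j, j ∈ L ↔ j ∈ js ∧ ∀ j' ∈ js, q j ≤ q j') := by
  have hle : ∀ j ∈ js, size (q j) ≤ V := fun j hj =>
    h.size_le (Nat.lt_succ_iff.1 (List.mem_range.1 (hjs.subset hj)))
  exact Prog.Spec.filter h.le_V (h.sublist_range_le hjs) fun j hj =>
    Prog.Spec.all h.le_V (h.sublist_range_le hjs) fun j' hj' =>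
      Prog.Spec.le h.le_V (hle j hj) (hle j' hj')

theorem exists_extremal {js : List ℕ} (hne : js ≠ []) (f : ℕ → F) :
    ∃ j ∈ js, ∀ j' ∈ js, f j ≤ f j' := by
  obtain ⟨j, hj, hmin⟩ := Finset.exists_min_image js.toFinset f (by
    obtain ⟨a, ha⟩ := List.exists_mem_of_ne_nil js hne
    exact ⟨a, List.mem_toFinset.2 ha⟩)
  exact ⟨j, List.mem_toFinset.1 hj, fun j' hj' => hmin j' (List.mem_toFinset.2 hj')⟩

/-- The invariant of LPT: the jobs assigned so far satisfy the LPT condition, and they are the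
largest ones. -/
structure LPTInv (q : ℕ → F) (n : ℕ) (σ : Sched m) : Prop where
  le : ∀ j, (σ j).isSome → j ≤ n
  stable : Stable q ((jobs n).filter fun j => (σ j).isSome) σ
  largest : ∀ j j', (σ j).isSome → j' ≤ n → σ j' = none → q j' ≤ q j

theorem LPTInv.update {σ : Sched m} (h : LPTInv q n σ) (hq : ∀ j ∈ jobs n, 0 ≤ q j) {j : ℕ}
    (hj : j ≤ n) (hσj : σ j = none) (hmax : ∀ j', j' ≤ n → σ j' = none → q j' ≤ q j) {i : Fin m}
    (hi : ∀ i', mload q (jobs n) σ i ≤ mload q (jobs n) σ i') :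
    LPTInv q n (Function.update σ j (some i)) := by
  set σ' := Function.update σ j (some i) with hσ'
  have hσ'j : σ' j = some i := Function.update_self _ _ _
  have hne : ∀ k, k ≠ j → σ' k = σ k := fun k hk => Function.update_of_ne hk _ _
  have hjn : j ∈ jobs n := Finset.mem_range.2 (Nat.lt_succ_of_le hj)
  set A := (jobs n).filter fun j => (σ j).isSome with hA
  set A' := (jobs n).filter fun j => (σ' j).isSome with hA'
  have hloadA : ∀ i', mload q A σ i' = mload q (jobs n) σ i' := fun i' => mload_congr fun k => by
    rw [hA, Finset.mem_filter]
    refine ⟨fun h => ⟨h.1.1, h.2⟩, fun h => ⟨⟨h.1, ?_⟩, h.2⟩⟩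
    rw [h.2]
    rfl
  have hloadA' : ∀ i', mload q A' σ' i' = mload q (jobs n) σ' i' := fun i' =>
    mload_congr fun k => by
    rw [hA', Finset.mem_filter]
    refine ⟨fun h => ⟨h.1.1, h.2⟩, fun h => ⟨⟨h.1, ?_⟩, h.2⟩⟩
    rw [h.2]
    rfl
  have hext : ∀ k l, σ k = some l → σ' k = some l := fun k l hk => by
    rw [hne k, hk]
    rintro rfl
    rw [hσj] at hk
    simp at hk
  have hle : ∀ i', mload q (jobs n) σ i' ≤ mload q (jobs n) σ' i' :=
    mload_le_of_extends hq hext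
  have hsmall : ∀ k, k ∈ A' → q j ≤ q k := fun k hk => by
    rw [hA', Finset.mem_filter] at hk
    by_cases hkj : k = j
    · rw [hkj]
    · rw [hne k hkj] at hk
      exact h.largest k j hk.2 hj hσj
  -- For a job of the same size as `j`, all jobs count.
  have hall : ∀ k, q k = q j → atLeast q A' (q k) = A' := fun k hk =>
    Finset.filter_true_of_mem fun l hl => by
      rw [hk]
      exact hsmall l hl
  have hi' : mload q (jobs n) σ' i = q j + mload q (jobs n) σ i := mload_update hjn hσj i
  refine ⟨fun k hk => ?_, fun k hk l hkl l' _ => ?_, fun k k' hk hk' hσk' => ?_⟩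
  · by_cases hkj : k = j
    · rwa [hkj]
    · rw [hne k hkj] at hk
      exact h.le k hk
  · by_cases hkq : q k = q j
    · rw [hall k hkq, hloadA', hloadA', hkq]
      by_cases hli : l = i
      · rw [hli, hi']
        linarith [hi l', hle l']
      · have hkj : k ≠ j := by
          rintro rfl
          rw [hσ'j] at hkl
          exact hli (by simpa using hkl.symm)
        rw [hne k hkj] at hkl
        have hkA : k ∈ A := by
          rw [hA, Finset.mem_filter, hkl]
          exact ⟨(Finset.mem_filter.1 hk).1, rfl⟩
        have h1 := h.stable k hkA l hkl l' (Finset.mem_univ _)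
        have h2 : atLeast q A (q k) = A := Finset.filter_true_of_mem fun k' hk' => by
          rw [hkq]
          exact h.largest k' j (Finset.mem_filter.1 hk').2 hj hσj
        rw [h2, hloadA, hloadA] at h1
        have h3 : mload q (jobs n) σ' l = mload q (jobs n) σ l := mload_congr fun k' => by
          refine and_congr_right fun _ => ?_
          by_cases hk' : k' = j
          · subst hk'
            rw [hσ'j, hσj]
            simp [Ne.symm hli]
          · rw [hne k' hk']
        rw [h3, ← hkq]
        linarith [hle l']
    · have hkj : k ≠ j := fun h => hkq (by rw [h])
      have hlt : q j < q k := lt_of_le_of_ne (hsmall k hk) (Ne.symm hkq)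
      have h1 : ∀ l, mload q (atLeast q A' (q k)) σ' l = mload q (atLeast q A (q k)) σ l := by
        intro l
        refine mload_congr fun k' => ?_
        rw [mem_atLeast, mem_atLeast, hA, hA', Finset.mem_filter, Finset.mem_filter]
        by_cases hk' : k' = j
        · subst hk'
          simp [hlt.not_ge]
        · rw [hne k' hk']
      rw [h1, h1]
      rw [hne k hkj] at hkl
      refine h.stable k ?_ l hkl l' (Finset.mem_univ _)
      rw [Finset.mem_filter, hkl]
      exact ⟨(Finset.mem_filter.1 hk).1, rfl⟩
  · have hk'j : k' ≠ j := by
      rintro rfl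
      rw [hσ'j] at hσk'
      simp at hσk'
    rw [hne k' hk'j] at hσk'
    by_cases hkj : k = j
    · rw [hkj]
      exact hmax k' hk' hσk'
    · rw [hne k hkj] at hk
      exact h.largest k k' hk hk' hσk'

/-- LPT computes a schedule that satisfies the LPT condition. -/
theorem lpt_spec (h : SumBound m size q n V) (hm : 0 < m) (hq : ∀ j ∈ jobs n, 0 ≤ q j) :
    Prog.Spec V 23 (lpt size q n (n + 1) (emptySched m)) (fun σ =>
      (∀ j, (σ j).isSome ↔ j ≤ n) ∧ Stable q (jobs n) σ) := by
  refine (Prog.Spec.iterate (k := 21) (prog := fun N (σ : Sched m) => lpt size q n N σ)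
    (I := fun N σ => LPTInv q n σ ∧ ((jobs n).filter fun j => σ j = none).card = N)
    (Q := fun _ σ => LPTInv q n σ ∧ ((jobs n).filter fun j => σ j = none).card = 0) h.le_V
    (fun σ hσ s => ⟨σ, rfl, hσ⟩) ?_ h.n_le (a := emptySched m) ⟨⟨?_, ?_, ?_⟩, ?_⟩).mono ?_
  · rintro N σ ⟨hσ, hN⟩ s
    have hone : Prog.Spec V 21 (do
        let js ← Prog.filter (fun j => pure (σ j).isNone) (List.range (n + 1))
        let L ← OnlineLPT.largest size q js
        let j ← Prog.pick L
        let i ← pickLeast size q n [] σ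
        pure (j, i)) (fun r => r.1 ≤ n ∧ σ r.1 = none ∧
          (∀ j', j' ≤ n → σ j' = none → q j' ≤ q r.1) ∧
          (∀ i', mload q (jobs n) σ r.2 ≤ mload q (jobs n) σ i')) := by
      refine (Prog.Spec.filter (k := 1) h.le_V h.range_le (p := fun j => σ j = none)
        fun j _ => Prog.Spec.pure (by simp)).bind h.le_V (by norm_num : 3 ≤ 20) fun js hjs => ?_
      have hmem : ∀ j, j ∈ js ↔ j ≤ n ∧ σ j = none := fun j => by
        rw [hjs.2, List.mem_range, Nat.lt_succ_iff]
      refine (largest_spec h hjs.1).bind h.le_V (by norm_num : 9 ≤ 19) fun L hL => ?_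
      refine (Prog.Spec.pick h.le_V ?_ (h.sublist_range_le (hL.1.trans hjs.1))).bind h.le_V
        (by norm_num : 2 ≤ 18) fun j hj => ?_
      · obtain ⟨j₀, hj₀⟩ := Finset.card_pos.1 (hN.symm ▸ Nat.succ_pos N :
          0 < ((jobs n).filter fun j => σ j = none).card)
        rw [Finset.mem_filter, Finset.mem_range, Nat.lt_succ_iff] at hj₀
        obtain ⟨j, hj, hmax⟩ := exists_extremal (js := js)
          (List.ne_nil_of_mem ((hmem j₀).2 hj₀)) (fun j => - q j)
        exact List.ne_nil_of_mem ((hL.2 j).2 ⟨hj, fun j' hj' => neg_le_neg_iff.1 (hmax j' hj')⟩)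
      refine (pickLeast_spec h hm (by simp) σ).bind h.le_V (by norm_num : 17 ≤ 17) fun i hi => ?_
      have := (hL.2 j).1 hj
      exact Prog.Spec.pure ⟨((hmem j).1 this.1).1, ((hmem j).1 this.1).2,
        fun j' hj' hσ' => this.2 j' ((hmem j').2 ⟨hj', hσ'⟩), hi.1⟩
    obtain ⟨⟨j, i⟩, s', h1, h2, hj, hσj, hmax, hi⟩ := hone s
    simp only at hj hσj hmax hi
    refine ⟨Function.update σ j (some i), s', ?_, h2, ⟨hσ.update hq hj hσj hmax hi, ?_⟩,
      fun _ h => h⟩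
    · have e : lpt size q n (N + 1) σ = (do
          let js ← Prog.filter (fun j => pure (σ j).isNone) (List.range (n + 1))
          let L ← OnlineLPT.largest size q js
          let j ← Prog.pick L
          let i ← pickLeast size q n [] σ
          pure (j, i)) >>= fun r => lpt size q n N (Function.update σ r.1 (some r.2)) := by
        simp only [lpt, bind_assoc, pure_bind]
      change lpt size q n (N + 1) σ s = _
      rw [e]
      change Option.bind _ _ = _
      rw [h1]
      rfl
    · have : ((jobs n).filter fun k => Function.update σ j (some i) k = none)
          = ((jobs n).filter fun k => σ k = none).erase j := by
        ext k
        rw [Finset.mem_erase, Finset.mem_filter, Finset.mem_filter]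
        by_cases hk : k = j
        · subst hk
          simp
        · simp [hk]
      rw [this, Finset.card_erase_of_mem, hN]
      · rfl
      · exact Finset.mem_filter.2 ⟨Finset.mem_range.2 (Nat.lt_succ_of_le hj), hσj⟩
  · simp [emptySched]
  · intro j hj
    simp [emptySched] at hj
  · simp [emptySched]
  · simp [emptySched]
  · rintro σ ⟨hσ, h0⟩
    have h1 : ∀ j, j ≤ n → (σ j).isSome := fun j hj => by
      by_contra hn
      have : j ∈ (jobs n).filter fun k => σ k = none := Finset.mem_filter.2
        ⟨Finset.mem_range.2 (Nat.lt_succ_of_le hj), by simpa using hn⟩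
      rw [Finset.card_eq_zero.1 h0] at this
      simp at this
    refine ⟨fun j => ⟨hσ.le j, h1 j⟩, ?_⟩
    have := hσ.stable
    rwa [Finset.filter_true_of_mem fun j hj =>
      h1 j (Nat.lt_succ_iff.1 (Finset.mem_range.1 hj))] at this

end Programs

/-! ### Rounding, thresholds and the steps of the algorithm -/

section Programs

variable {F : Type} [Field F] [LinearOrder F] [IsStrictOrderedRing F] [FloorRing F]
  {m : ℕ} {size : F → ℕ} {q : ℕ → F} {n V K : ℕ}

/-- The number `2 ^ i + k ε 2 ^ i`, where `ε = 1 / K`. -/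
def sizeClass (K : ℕ) (i : ℤ) (k : F) : F := (2 : F) ^ i + k * ((2 : F) ^ i / K)

/-- The value of `x`, rounded down. -/
def rounded (K : ℕ) (x : F) : F :=
  sizeClass K (Int.log 2 x)
    (⌊(x - (2 : F) ^ Int.log 2 x) / ((2 : F) ^ Int.log 2 x / K)⌋ : F)

/-- Bounds on the numbers that occur when `x` is rounded. -/
structure RoundBound (size : F → ℕ) (K : ℕ) (x : F) (V : ℕ) : Prop where
  size_x : size x ≤ V
  size_K : size (K : F) ≤ V
  log : (Int.log 2 x).natAbs ≤ V
  pow : size ((2 : F) ^ Int.log 2 x) ≤ V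
  gap : size ((2 : F) ^ Int.log 2 x / K) ≤ V
  sub : size (x - (2 : F) ^ Int.log 2 x) ≤ V
  div : size ((x - (2 : F) ^ Int.log 2 x) / ((2 : F) ^ Int.log 2 x / K)) ≤ V
  floor : size (⌊(x - (2 : F) ^ Int.log 2 x) / ((2 : F) ^ Int.log 2 x / K)⌋ : F) ≤ V
  mul : size ((⌊(x - (2 : F) ^ Int.log 2 x) / ((2 : F) ^ Int.log 2 x / K)⌋ : F)
    * ((2 : F) ^ Int.log 2 x / K)) ≤ V

theorem roundDown_spec (hV : 16 ≤ V) {x : F} (h : RoundBound size K x V) :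
    Prog.Spec V 12 (roundDown size K x) (fun r => r = rounded K x) := by
  refine (Prog.Spec.log2 hV h.size_x).bind hV (by norm_num : 5 ≤ 11) ?_
  rintro _ rfl
  refine (Prog.Spec.pow2 hV h.log).bind hV (by norm_num : 5 ≤ 10) ?_
  rintro _ rfl
  refine (Prog.Spec.div hV h.pow h.size_K).bind hV (by norm_num : 5 ≤ 9) ?_
  rintro _ rfl
  refine (Prog.Spec.sub hV h.size_x h.pow).bind hV (by norm_num : 5 ≤ 8) ?_
  rintro _ rfl
  refine (Prog.Spec.div hV h.sub h.gap).bind hV (by norm_num : 5 ≤ 7) ?_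
  rintro _ rfl
  refine (Prog.Spec.floor hV h.div).bind hV (by norm_num : 5 ≤ 6) ?_
  rintro _ rfl
  refine (Prog.Spec.mul hV h.floor h.gap).bind hV (by norm_num : 5 ≤ 5) ?_
  rintro _ rfl
  exact Prog.Spec.add hV h.pow h.mul

theorem roundAll_spec (hV : 16 ≤ V) (hn : n + 1 ≤ V) {p : ℕ → F}
    (h : ∀ j ≤ n, RoundBound size K (p j) V) :
    Prog.Spec V 15 (roundAll size K p n) (fun r => ∀ j ≤ n, r j = rounded K (p j)) := by
  refine (Prog.Spec.fold (k := 13) (I := fun rem r => ∃ l, l ++ rem = List.range (n + 1) ∧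
    ∀ j ∈ l, r j = rounded K (p j)) hV (by rwa [List.length_range]) ⟨[], rfl, by simp⟩ ?_).mono ?_
  · rintro j rem r ⟨l, hl, hr⟩
    have hj : j ≤ n := by
      have : j ∈ l ++ j :: rem := by simp
      rw [hl, List.mem_range] at this
      omega
    refine (roundDown_spec hV (h j hj)).bind hV le_rfl ?_
    rintro _ rfl
    refine Prog.Spec.pure ⟨l ++ [j], by simpa using hl, fun k hk => ?_⟩
    by_cases hkj : k = j
    · subst hkj
      simp
    · rw [Function.update_of_ne hkj]
      exact hr k (by simpa [hkj] using hk)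
  · rintro r ⟨l, hl, hr⟩ j hj
    refine hr j ?_
    rw [List.append_nil] at hl
    rw [hl, List.mem_range]
    omega

/-- The threshold `2 ^ ℓ` between small and big jobs. -/
def lowThreshold (K : ℕ) (UB : F) : F := if 0 < UB then (2 : F) ^ Int.clog 2 (UB / K) else 0

/-- The threshold `2 ^ (u + 1)` between big and huge jobs. -/
def highThreshold (UB : F) : F := if 0 < UB then (2 : F) ^ Int.clog 2 UB else 0

/-- The list of the rounded sizes of big jobs, in decreasing order. -/
def bigSizes (K : ℕ) (UB : F) : List F :=
  if 0 < UB then ((exponents (Int.clog 2 (UB / K)) (Int.clog 2 UB)).map fun i =>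
    (List.range K).reverse.map fun k : ℕ => sizeClass K i (k : F)).flatten else []

/-- Bounds on the numbers that occur when the thresholds are computed. -/
structure ThresholdBound (size : F → ℕ) (K : ℕ) (UB : F) (V : ℕ) : Prop where
  K_le : K ≤ V
  zero : size (0 : F) ≤ V
  size_UB : size UB ≤ V
  size_K : size (K : F) ≤ V
  div : size (UB / K) ≤ V
  count : (Int.clog 2 UB - Int.clog 2 (UB / K)).toNat ≤ V
  low : (Int.clog 2 (UB / K)).natAbs ≤ V
  high : (Int.clog 2 UB).natAbs ≤ V
  pow : ∀ i : ℤ, Int.clog 2 (UB / K) ≤ i → i < Int.clog 2 UB → i.natAbs ≤ V ∧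
    size ((2 : F) ^ i) ≤ V ∧ size ((2 : F) ^ i / K) ≤ V ∧
    ∀ k : ℕ, k < K → size (k : F) ≤ V ∧ size ((k : F) * ((2 : F) ^ i / K)) ≤ V
  size_low : size (lowThreshold K UB) ≤ V
  size_high : size (highThreshold UB) ≤ V
  size_big : ∀ x ∈ bigSizes K UB, size x ≤ V
  length : (bigSizes K UB).length ≤ V

theorem exponents_eq (l c : ℤ) :
    exponents l c = (List.range (c - l).toNat).map fun t : ℕ => c - 1 - (t : ℤ) := by
  unfold exponents
  induction List.range (c - l).toNat with
  | nil => rfl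
  | cons a r ih => simpa using ih

theorem mem_exponents {l c i : ℤ} : i ∈ exponents l c ↔ l ≤ i ∧ i < c := by
  rw [exponents_eq]
  simp only [List.mem_map, List.mem_range]
  constructor
  · rintro ⟨t, ht, rfl⟩
    omega
  · rintro ⟨h1, h2⟩
    exact ⟨(c - 1 - i).toNat, by omega, by omega⟩

theorem thresholds_spec (hV : 16 ≤ V) {UB : F} (h : ThresholdBound size K UB V) :
    Prog.Spec V 19 (thresholds size K UB)
      (fun r => r = (lowThreshold K UB, highThreshold UB, bigSizes K UB)) := by
  unfold lowThreshold highThreshold bigSizes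
  refine (Prog.Spec.lt hV h.zero h.size_UB).bind hV (by norm_num : 5 ≤ 18) fun b hb => ?_
  by_cases hU : 0 < UB
  · rw [if_pos (hb.2 hU), if_pos hU, if_pos hU, if_pos hU]
    refine (Prog.Spec.div hV h.size_UB h.size_K).bind hV (by norm_num : 5 ≤ 17) ?_
    rintro _ rfl
    refine (Prog.Spec.clog2 hV h.div).bind hV (by norm_num : 5 ≤ 16) ?_
    rintro _ rfl
    refine (Prog.Spec.clog2 hV h.size_UB).bind hV (by norm_num : 5 ≤ 15) ?_
    rintro _ rfl
    refine (Prog.Spec.pow2 hV h.low).bind hV (by norm_num : 5 ≤ 14) ?_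
    rintro _ rfl
    refine (Prog.Spec.pow2 hV h.high).bind hV (by norm_num : 5 ≤ 13) ?_
    rintro _ rfl
    refine (Prog.Spec.map (k := 10) (g := fun i => (List.range K).reverse.map
      fun k : ℕ => sizeClass K i (k : F)) hV ?_ fun i hi => ?_).bind hV (by norm_num : 12 ≤ 12) ?_
    · rw [exponents_eq, List.length_map, List.length_range]
      exact h.count
    · rw [mem_exponents] at hi
      obtain ⟨h1, h2, h3, h4⟩ := h.pow i hi.1 hi.2
      refine (Prog.Spec.pow2 hV h1).bind hV (by norm_num : 5 ≤ 9) ?_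
      rintro _ rfl
      refine (Prog.Spec.div hV h2 h.size_K).bind hV (by norm_num : 5 ≤ 8) ?_
      rintro _ rfl
      refine Prog.Spec.map (k := 6) hV (by simpa using h.K_le) fun k hk => ?_
      obtain ⟨h5, h6⟩ := h4 k (by simpa using hk)
      refine (Prog.Spec.mul hV h5 h3).bind hV (by norm_num : 5 ≤ 5) ?_
      rintro _ rfl
      exact Prog.Spec.add hV h2 h6
    · rintro _ rfl
      exact Prog.Spec.pure rfl
  · rw [if_neg fun h => hU (hb.1 h), if_neg hU, if_neg hU, if_neg hU]
    exact Prog.Spec.pure rfl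

/-- In `σ₁`, the jobs in `js` which `σ` assigns to a machine that is not in `ne` are assigned to
this same machine, and all other jobs are assigned as in `σ'`. -/
structure Kept (σ : Sched m) (ne : List (Fin m)) (js : List ℕ) (σ' σ₁ : Sched m) : Prop where
  kept : ∀ j ∈ js, ∀ i, σ j = some i → i ∉ ne → σ₁ j = some i
  other : ∀ j, (∀ i, j ∈ js → σ j = some i → i ∈ ne) → σ₁ j = σ' j

theorem keep_spec (hV : 16 ≤ V) {ne : List (Fin m)} (hne : ne.length ≤ V) {js : List ℕ}
    (hjs : js.length ≤ V) (σ σ' : Sched m) :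
    Prog.Spec V 6 (keep σ ne js σ') (Kept σ ne js σ') := by
  refine (Prog.Spec.fold (k := 4) (I := fun rem τ => ∃ l, l ++ rem = js ∧ Kept σ ne l σ' τ) hV hjs
    ⟨[], rfl, by simp, fun _ _ => rfl⟩ ?_).mono ?_
  · rintro j rem τ ⟨l, hl, hτ⟩
    -- The step leaves `τ` unchanged.
    have hskip : (∀ i, σ j = some i → i ∈ ne) → Kept σ ne (l ++ [j]) σ' τ := fun h =>
      ⟨fun k hk i hki hi => by
        rcases List.mem_append.1 hk with hk | hk
        · exact hτ.kept k hk i hki hi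
        · rw [List.mem_singleton] at hk
          subst hk
          exact absurd (h i hki) hi,
       fun k hk => hτ.other k fun i hki => hk i (by simp [hki])⟩
    rcases hσ : σ j with _ | i
    · exact Prog.Spec.pure ⟨l ++ [j], by simpa using hl, hskip (by simp [hσ])⟩
    · refine (Prog.Spec.mem hV hne).bind hV le_rfl fun b hb => Prog.Spec.pure ?_
      refine ⟨l ++ [j], by simpa using hl, ?_⟩
      split_ifs with hb'
      · refine hskip fun i' hi' => ?_
        rw [hσ] at hi'
        exact (by simpa using hi' : i = i') ▸ hb.1 hb'
      · have hi : i ∉ ne := fun h => hb' (hb.2 h)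
        refine ⟨fun k hk i' hki hi' => ?_, fun k hk => ?_⟩
        · by_cases hkj : k = j
          · subst hkj
            rw [Function.update_self, ← hσ, hki]
          · rw [Function.update_of_ne hkj]
            exact hτ.kept k (by simpa [hkj] using hk) i' hki hi'
        · have hkj : k ≠ j := by
            rintro rfl
            exact hi (hk i (by simp) hσ)
          rw [Function.update_of_ne hkj]
          exact hτ.other k fun i' hki => hk i' (by simp [hki])
  · rintro τ ⟨l, hl, hτ⟩
    rw [List.append_nil] at hl
    exact hl ▸ hτ

theorem differing_spec (h : SumBound m size q n V) {x : F} (hx : size x ≤ V) (σ σ' : Sched m) :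
    Prog.Spec V 11 (differing size q n x σ σ') (fun ne => ne.Sublist (List.finRange m) ∧
      ∀ i, i ∈ ne ↔ ¬ ∀ j ≤ n, x ≤ q j → (σ j = some i ↔ σ' j = some i)) := by
  refine (Prog.Spec.filter (k := 9)
    (p := fun i => ¬ ∀ j ≤ n, x ≤ q j → (σ j = some i ↔ σ' j = some i))
    h.le_V h.finRange_le fun i _ => ?_).mono fun r hr => ⟨hr.1, fun i => by simpa using hr.2 i⟩
  refine (Prog.Spec.all (k := 6) (p := fun j => x ≤ q j → (σ j = some i ↔ σ' j = some i))
    h.le_V h.range_le fun j hj => ?_).bind h.le_V (by norm_num) fun b hb => Prog.Spec.pure ?_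
  · have hj' : j ≤ n := Nat.lt_succ_iff.1 (List.mem_range.1 hj)
    refine (Prog.Spec.lt h.le_V (h.size_le hj') hx).bind h.le_V le_rfl fun b hb =>
      Prog.Spec.pure ?_
    rw [Bool.or_eq_true, hb, decide_eq_true_iff, ← not_le]
    tauto
  · have hb' : b = true ↔ ∀ j ≤ n, x ≤ q j → (σ j = some i ↔ σ' j = some i) := by
      rw [hb]
      simp only [List.mem_range, Nat.lt_succ_iff]
    rw [← hb']
    simp

/-- The result `r` of a phase that started from `st` and assigned the jobs with the property `p`.
-/
structure PhaseResult (q : ℕ → F) (n : ℕ) (σ : Sched m) (p : ℕ → Prop) (x : F)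
    (st r : Sched m × List (Fin m)) : Prop where
  sublist : r.2.Sublist (List.finRange m)
  mem_iff : ∀ i, i ∈ r.2 ↔ ¬ ∀ j ≤ n, x ≤ q j → (σ j = some i ↔ r.1 j = some i)
  result : ∃ (js rest : List ℕ) (σ₁ : Sched m), (∀ j, j ∈ js ↔ j ≤ n ∧ p j) ∧
    (∀ j, j ∈ rest ↔ j ∈ js ∧ σ₁ j = none) ∧ Kept σ st.2 js st.1 σ₁ ∧
    ListScheduled q n st.2 rest σ₁ r.1

theorem phase_spec (h : SumBound m size q n V) (hm : 0 < m) (hq : ∀ j ∈ jobs n, 0 ≤ q j)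
    {t : ℕ → Prog Bool} {p : ℕ → Prop} (ht : ∀ j ≤ n, Prog.Spec V 5 (t j) (fun b => b = true ↔ p j))
    {x : F} (hx : size x ≤ V) (σ : Sched m) {st : Sched m × List (Fin m)}
    (hst : st.2.Sublist (List.finRange m)) :
    Prog.Spec V 26 (phase size q n σ t x st) (PhaseResult q n σ p x st) := by
  refine (Prog.Spec.filter (p := p) h.le_V h.range_le fun j hj =>
    ht j (Nat.lt_succ_iff.1 (List.mem_range.1 hj))).bind h.le_V (by norm_num : 7 ≤ 25)
    fun js hjs => ?_
  refine (keep_spec h.le_V (h.sublist_le hst) (h.sublist_range_le hjs.1) σ st.1).bind h.le_V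
    (by norm_num : 6 ≤ 24) fun σ₁ hσ₁ => ?_
  refine (scheduleRest_spec h hm hq (h.sublist_le hst) hjs.1 σ₁).bind h.le_V
    (by norm_num : 23 ≤ 23) ?_
  rintro σ₂ ⟨rest, hrest, hσ₂⟩
  refine (differing_spec h hx σ σ₂).bind h.le_V (by norm_num : 11 ≤ 22) fun ne hne => ?_
  refine Prog.Spec.pure ⟨hne.1, hne.2, js, rest, σ₁, fun j => ?_, hrest, hσ₁, hσ₂⟩
  rw [hjs.2, List.mem_range, Nat.lt_succ_iff]

theorem jobsOn_spec (h : SumBound m size q n V) (σ : Sched m) (i : Fin m) :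
    Prog.Spec V 3 (jobsOn n σ i) (fun js => js.Sublist (List.range (n + 1)) ∧
      ∀ j, j ∈ js ↔ j ≤ n ∧ σ j = some i) :=
  (Prog.Spec.filter (k := 1) (p := fun j => σ j = some i) h.le_V h.range_le
    fun j _ => Prog.Spec.pure (by simp)).mono fun js hjs =>
      ⟨hjs.1, fun j => by rw [hjs.2, List.mem_range, Nat.lt_succ_iff]⟩

/-- Machine `i` contains a job of size less than `lo`. -/
def HasSmall (q : ℕ → F) (n : ℕ) (lo : F) (σ : Sched m) (i : Fin m) : Prop :=
  ∃ j ≤ n, σ j = some i ∧ q j < lo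

theorem withSmall_spec (h : SumBound m size q n V) {lo : F} (hlo : size lo ≤ V) (σ : Sched m) :
    Prog.Spec V 11 (withSmall size q n lo σ) (fun M => M.Sublist (List.finRange m) ∧
      ∀ i, i ∈ M ↔ HasSmall q n lo σ i) := by
  refine (Prog.Spec.filter (k := 9) (p := HasSmall q n lo σ) h.le_V h.finRange_le
    fun i _ => ?_).mono fun r hr => ⟨hr.1, fun i => by simpa using hr.2 i⟩
  refine (jobsOn_spec h σ i).bind h.le_V (by norm_num : 3 ≤ 8) fun js hjs => ?_
  have hle : ∀ j ∈ js, size (q j) ≤ V := fun j hj => h.size_le ((hjs.2 j).1 hj).1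
  refine (Prog.Spec.filter (p := fun j => q j < lo) h.le_V (h.sublist_range_le hjs.1) fun j hj =>
    Prog.Spec.lt h.le_V (hle j hj) hlo).bind h.le_V (by norm_num) fun sm hsm => Prog.Spec.pure ?_
  constructor
  · intro h0
    have hne : sm ≠ [] := by
      rintro rfl
      simp at h0
    obtain ⟨j, hj⟩ := List.exists_mem_of_ne_nil sm hne
    have h1 := (hsm.2 j).1 hj
    have h2 := (hjs.2 j).1 h1.1
    exact ⟨j, h2.1, h2.2, h1.2⟩
  · rintro ⟨j, h1, h2, h3⟩
    have : j ∈ sm := (hsm.2 j).2 ⟨(hjs.2 j).2 ⟨h1, h2⟩, h3⟩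
    cases sm
    · simp at this
    · rfl

theorem mostLoaded_spec (h : SumBound m size q n V) (σ : Sched m) {M : List (Fin m)}
    (hM : M.Sublist (List.finRange m)) :
    Prog.Spec V 14 (mostLoaded size q n σ M) (fun L => L.Sublist M ∧
      ∀ i, i ∈ L ↔ i ∈ M ∧ ∀ i' ∈ M, mload q (jobs n) σ i' ≤ mload q (jobs n) σ i) := by
  refine Prog.Spec.filter h.le_V (h.sublist_le hM) fun i _ =>
    Prog.Spec.all h.le_V (h.sublist_le hM) fun i' _ =>
      (load_spec h σ i).bind h.le_V (by norm_num : 7 ≤ 9) fun a ha =>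
      (load_spec h σ i').bind h.le_V (by norm_num : 7 ≤ 8) fun b hb => ?_
  subst ha hb
  exact (Prog.Spec.le h.le_V (h.mload_le σ i') (h.mload_le σ i)).up h.le_V (by norm_num)
    fun _ h => h

/-- A move of the final loop: the small job `j` is moved from machine `i` to machine `k`. -/
structure SmallMove (q : ℕ → F) (n : ℕ) (lo : F) (σ : Sched m) (j : ℕ) (i k : Fin m) : Prop where
  le : j ≤ n
  on : σ j = some i
  lt_lo : q j < lo
  least : ∀ i', mload q (jobs n) σ k ≤ mload q (jobs n) σ i'
  bad : mload q (jobs n) σ k + lo < mload q (jobs n) σ i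
  most : ∀ i', HasSmall q n lo σ i' → mload q (jobs n) σ i' ≤ mload q (jobs n) σ i

theorem rebalanceStep_spec (h : SumBound m size q n V) (hm : 0 < m) {lo : F} (hlo : size lo ≤ V)
    (hadd : ∀ s ⊆ jobs n, size (∑ j ∈ s, q j + lo) ≤ V) (σ : Sched m) :
    Prog.Spec V 25 (rebalanceStep size q n lo σ) (fun r =>
      (r.2 = true ∧ r.1 = σ ∧ ∀ i, HasSmall q n lo σ i → ∀ i',
        mload q (jobs n) σ i ≤ mload q (jobs n) σ i' + lo) ∨
      (r.2 = false ∧ ∃ j i k, SmallMove q n lo σ j i k ∧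
        r.1 = Function.update σ j (some k))) := by
  have hV := h.le_V
  refine (withSmall_spec h hlo σ).bind hV (by norm_num : 11 ≤ 24) fun M hM => ?_
  refine (pickLeast_spec h hm (by simp) σ).bind hV (by norm_num : 17 ≤ 23) fun k hk => ?_
  refine (Prog.Spec.filter (k := 14)
    (p := fun i => mload q (jobs n) σ k + lo < mload q (jobs n) σ i) hV (h.sublist_le hM.1)
    fun i _ => ?_).bind hV (by norm_num : 16 ≤ 22) fun bad hbad => ?_
  · refine (load_spec h σ k).bind hV (by norm_num : 7 ≤ 13) ?_
    rintro _ rfl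
    refine (Prog.Spec.add hV (h.mload_le σ k) hlo).bind hV (by norm_num : 5 ≤ 12) ?_
    rintro _ rfl
    refine (load_spec h σ i).bind hV (by norm_num : 7 ≤ 11) ?_
    rintro _ rfl
    exact (Prog.Spec.lt hV (hadd _ (Finset.filter_subset _ _)) (h.mload_le σ i)).up hV
      (by norm_num) fun _ h => h
  split_ifs with hb
  · refine Prog.Spec.pure (Or.inl ⟨rfl, rfl, fun i hi i' => ?_⟩)
    by_contra! hlt
    have : i ∈ bad := (hbad.2 i).2 ⟨(hM.2 i).2 hi, by linarith [hk.1 i']⟩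
    rw [List.isEmpty_iff.1 hb] at this
    simp at this
  have hbne : bad ≠ [] := by simpa using hb
  obtain ⟨i₁, hi₁⟩ := List.exists_mem_of_ne_nil bad hbne
  obtain ⟨hi₁M, hi₁b⟩ := (hbad.2 i₁).1 hi₁
  refine (mostLoaded_spec h σ hM.1).bind hV (by norm_num : 14 ≤ 21) fun top htop => ?_
  refine (Prog.Spec.pick hV ?_ (h.sublist_le (htop.1.trans hM.1))).bind hV (by norm_num : 2 ≤ 20)
    fun i hi => ?_
  · obtain ⟨i, hi, hmax⟩ := Finset.exists_max_image M.toFinset (mload q (jobs n) σ)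
      ⟨i₁, List.mem_toFinset.2 hi₁M⟩
    exact List.ne_nil_of_mem ((htop.2 i).2 ⟨List.mem_toFinset.1 hi,
      fun i' hi' => hmax i' (List.mem_toFinset.2 hi')⟩)
  obtain ⟨hiM, hmax⟩ := (htop.2 i).1 hi
  obtain ⟨j₀, hj₀, hj₀i, hj₀lo⟩ := (hM.2 i).1 hiM
  refine (jobsOn_spec h σ i).bind hV (by norm_num : 3 ≤ 19) fun js hjs => ?_
  have hj₀js := (hjs.2 j₀).2 ⟨hj₀, hj₀i⟩
  refine (smallest_spec h hjs.1).bind hV (by norm_num : 9 ≤ 18) fun L hL => ?_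
  refine (Prog.Spec.pick hV ?_ (h.sublist_range_le (hL.1.trans hjs.1))).bind hV
    (by norm_num : 2 ≤ 17) fun j hj => ?_
  · obtain ⟨j, hj, hmin⟩ := exists_extremal (List.ne_nil_of_mem hj₀js) q
    exact List.ne_nil_of_mem ((hL.2 j).2 ⟨hj, hmin⟩)
  obtain ⟨hjjs, hmin⟩ := (hL.2 j).1 hj
  obtain ⟨hjn, hji⟩ := (hjs.2 j).1 hjjs
  exact Prog.Spec.pure (Or.inr ⟨rfl, j, i, k, ⟨hjn, hji, (hmin j₀ hj₀js).trans_lt hj₀lo, hk.1,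
    hi₁b.trans_le (hmax i₁ hi₁M), fun i' hi' => hmax i' ((hM.2 i').2 hi')⟩, rfl⟩)

end Programs

/-! ### Rounded sizes and thresholds -/

section Thresholds

variable {F : Type} [Field F] [LinearOrder F] [IsStrictOrderedRing F] [FloorRing F] {K : ℕ}

theorem sizeClass_nat (hK : 0 < K) (i : ℤ) (k : ℕ) :
    sizeClass K i (k : F) = ((K + k : ℕ) : F) * ((2 : F) ^ i / K) := by
  have : (K : F) ≠ 0 := by exact_mod_cast hK.ne'
  unfold sizeClass
  push_cast
  field_simp

theorem pow_le_sizeClass (i : ℤ) (k : ℕ) : (2 : F) ^ i ≤ sizeClass K i (k : F) :=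
  le_add_of_nonneg_right (by positivity)

theorem sizeClass_lt_pow {i : ℤ} {k : ℕ} (hk : k < K) :
    sizeClass K i (k : F) < (2 : F) ^ (i + 1) := by
  have hK : (0 : F) < K := by exact_mod_cast (Nat.zero_le k).trans_lt hk
  have h1 : (k : F) < K := by exact_mod_cast hk
  have h2 : (0 : F) < (2 : F) ^ i / K := by positivity
  have h3 : (K : F) * ((2 : F) ^ i / K) = 2 ^ i := by field_simp
  rw [zpow_add_one₀ (two_ne_zero)]
  unfold sizeClass
  nlinarith

theorem sizeClass_lt_sizeClass {i : ℤ} {k k' : ℕ} (hK : 0 < K) (h : k < k') :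
    sizeClass K i (k : F) < sizeClass K i (k' : F) := by
  have hK : (0 : F) < K := by exact_mod_cast hK
  have h1 : (k : F) < k' := by exact_mod_cast h
  have h2 : (0 : F) < (2 : F) ^ i / K := by positivity
  unfold sizeClass
  nlinarith

theorem exists_floor_eq (hK : 0 < K) {x : F} (hx : 0 < x) : ∃ k : ℕ, k < K ∧
    ⌊(x - (2 : F) ^ Int.log 2 x) / ((2 : F) ^ Int.log 2 x / K)⌋ = (k : ℤ) := by
  have h1 : (2 : F) ^ Int.log 2 x ≤ x := by
    simpa using Int.zpow_log_le_self (b := 2) one_lt_two hx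
  have h2 : x < (2 : F) ^ (Int.log 2 x + 1) := by
    simpa using Int.lt_zpow_succ_log_self (b := 2) one_lt_two x
  have hK' : (0 : F) < K := by exact_mod_cast hK
  have h3 : (0 : F) < (2 : F) ^ Int.log 2 x := by positivity
  set y := (x - (2 : F) ^ Int.log 2 x) / ((2 : F) ^ Int.log 2 x / K) with hy
  have h4 : 0 ≤ y := div_nonneg (sub_nonneg.2 h1) (by positivity)
  have h5 : y < K := by
    rw [hy, div_lt_iff₀ (by positivity)]
    rw [zpow_add_one₀ two_ne_zero] at h2
    have : (K : F) * ((2 : F) ^ Int.log 2 x / K) = 2 ^ Int.log 2 x := by field_simp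
    linarith
  obtain ⟨k, hk⟩ := Int.eq_ofNat_of_zero_le (Int.floor_nonneg.2 h4)
  refine ⟨k, ?_, hk⟩
  have : (k : ℤ) < K := by
    rw [← hk]
    exact Int.floor_lt.2 (by exact_mod_cast h5)
  exact_mod_cast this

/-- The rounded size of `x` is one of the numbers `2 ^ e + k ε 2 ^ e` with `0 ≤ k < 1 / ε`. -/
theorem exists_rounded_eq (hK : 0 < K) {x : F} (hx : 0 < x) :
    ∃ (e : ℤ) (k : ℕ), k < K ∧ rounded K x = sizeClass K e (k : F) := by
  obtain ⟨k, hk, h⟩ := exists_floor_eq hK hx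
  refine ⟨Int.log 2 x, k, hk, ?_⟩
  rw [rounded, h, Int.cast_natCast]

theorem rounded_le (hK : 0 < K) (x : F) : rounded K x ≤ x := by
  have hK' : (0 : F) < K := by exact_mod_cast hK
  have h3 : (0 : F) < (2 : F) ^ Int.log 2 x / K := by positivity
  have := Int.floor_le ((x - (2 : F) ^ Int.log 2 x) / ((2 : F) ^ Int.log 2 x / K))
  rw [le_div_iff₀ h3] at this
  unfold rounded sizeClass
  linarith

theorem pow_le_rounded {x : F} (hx : 0 < x) : (2 : F) ^ Int.log 2 x ≤ rounded K x := by
  have h1 : (2 : F) ^ Int.log 2 x ≤ x := by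
    simpa using Int.zpow_log_le_self (b := 2) one_lt_two hx
  have h4 : (0 : F) ≤ ⌊(x - (2 : F) ^ Int.log 2 x) / ((2 : F) ^ Int.log 2 x / K)⌋ := by
    exact_mod_cast Int.floor_nonneg.2 (div_nonneg (sub_nonneg.2 h1) (by positivity))
  exact le_add_of_nonneg_right (by positivity)

theorem rounded_pos {x : F} (hx : 0 < x) : 0 < rounded K x :=
  lt_of_lt_of_le (by positivity) (pow_le_rounded hx)

/-- Rounding changes a size at most by the factor `1 + ε`. -/
theorem le_rounded (hK : 0 < K) {x : F} (hx : 0 < x) : x ≤ (1 + 1 / K) * rounded K x := by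
  have hK' : (0 : F) < K := by exact_mod_cast hK
  have h3 : (0 : F) < (2 : F) ^ Int.log 2 x / K := by positivity
  have h := (Int.lt_floor_add_one
    ((x - (2 : F) ^ Int.log 2 x) / ((2 : F) ^ Int.log 2 x / K))).le
  rw [div_le_iff₀ h3] at h
  have h1 := pow_le_rounded (K := K) hx
  have h2 : (2 : F) ^ Int.log 2 x / K ≤ 1 / K * rounded K x := by
    rw [div_mul_eq_mul_div, one_mul]
    gcongr
  have h4 : x ≤ rounded K x + (2 : F) ^ Int.log 2 x / K := by
    unfold rounded sizeClass
    linarith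
  linarith

theorem lowThreshold_nonneg (UB : F) : 0 ≤ lowThreshold K UB := by
  unfold lowThreshold
  split_ifs <;> positivity

theorem lowThreshold_mono (hK : 0 < K) {x y : F} (h : x ≤ y) :
    lowThreshold K x ≤ lowThreshold K y := by
  have hK' : (0 : F) < K := by exact_mod_cast hK
  by_cases hx : 0 < x
  · unfold lowThreshold
    rw [if_pos hx, if_pos (hx.trans_le h)]
    refine zpow_le_zpow_right₀ one_le_two (Int.clog_mono_right (by positivity) ?_)
    gcongr
  · rw [lowThreshold, if_neg hx]
    exact lowThreshold_nonneg y

theorem le_mul_lowThreshold (hK : 0 < K) {UB : F} : UB ≤ K * lowThreshold K UB := by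
  have hK' : (0 : F) < K := by exact_mod_cast hK
  unfold lowThreshold
  split_ifs with h
  · have := Int.self_le_zpow_clog (b := 2) one_lt_two (UB / (K : F))
    rw [div_le_iff₀ hK'] at this
    rw [mul_comm]
    exact_mod_cast this
  · simpa using h

theorem zpow_clog_lt {x : F} (hx : 0 < x) : (2 : F) ^ Int.clog 2 x < 2 * x := by
  have h := Int.zpow_pred_clog_lt_self (b := 2) one_lt_two hx
  have e : Int.clog 2 x = Int.clog 2 x - 1 + 1 := by ring
  rw [e, zpow_add_one₀ two_ne_zero]
  push_cast at h
  linarith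

theorem mul_lowThreshold_le (hK : 0 < K) {UB : F} (hU : 0 ≤ UB) :
    K * lowThreshold K UB ≤ 2 * UB := by
  have hK' : (0 : F) < K := by exact_mod_cast hK
  unfold lowThreshold
  split_ifs with h
  · have := zpow_clog_lt (show 0 < UB / K by positivity)
    rw [← mul_div_assoc, lt_div_iff₀ hK'] at this
    linarith
  · simpa using hU

theorem highThreshold_le {UB : F} (hU : 0 ≤ UB) : highThreshold UB ≤ 2 * UB := by
  unfold highThreshold
  split_ifs with h
  · exact (zpow_clog_lt h).le
  · simpa using hU

theorem le_highThreshold (UB : F) : UB ≤ highThreshold UB := by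
  unfold highThreshold
  split_ifs with h
  · simpa using Int.self_le_zpow_clog (b := 2) one_lt_two UB
  · exact not_lt.1 h

theorem lowThreshold_le_highThreshold (hK : 1 ≤ K) (UB : F) :
    lowThreshold K UB ≤ highThreshold UB := by
  have hK' : (1 : F) ≤ K := by exact_mod_cast hK
  unfold lowThreshold highThreshold
  split_ifs with h
  · exact zpow_le_zpow_right₀ one_le_two (Int.clog_mono_right (by positivity)
      (div_le_self h.le hK'))
  · exact le_rfl

/-- Every rounded size from `lo` on is a multiple of `ε lo`. -/
theorem exists_multiple_of_le (hK : 0 < K) {UB : F} (e : ℤ) {k : ℕ} (hk : k < K)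
    (h : lowThreshold K UB ≤ sizeClass K e (k : F)) (hU : 0 < UB) :
    ∃ z : ℕ, sizeClass K e (k : F) = z * (lowThreshold K UB / K) := by
  rw [lowThreshold, if_pos hU] at h ⊢
  set l := Int.clog 2 (UB / K)
  have h1 : l < e + 1 := (zpow_lt_zpow_iff_right₀ (one_lt_two : (1 : F) < 2)).1
    (h.trans_lt (sizeClass_lt_pow hk))
  obtain ⟨t, ht⟩ : ∃ t : ℕ, e = l + t := ⟨(e - l).toNat, by omega⟩
  refine ⟨(K + k) * 2 ^ t, ?_⟩
  rw [sizeClass_nat hK, ht, zpow_add₀ two_ne_zero, zpow_natCast]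
  push_cast
  ring

theorem mem_bigSizes {UB : F} {x : F} : x ∈ bigSizes K UB ↔ 0 < UB ∧
    ∃ (i : ℤ) (k : ℕ), Int.clog 2 (UB / K) ≤ i ∧ i < Int.clog 2 UB ∧ k < K ∧
      sizeClass K i (k : F) = x := by
  unfold bigSizes
  split_ifs with h
  · simp only [List.mem_flatten, List.mem_map, mem_exponents, h, true_and]
    constructor
    · rintro ⟨l, ⟨i, hi, rfl⟩, hx⟩
      obtain ⟨k, hk, rfl⟩ := List.mem_map.1 hx
      exact ⟨i, k, hi.1, hi.2, by simpa using hk, rfl⟩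
    · rintro ⟨i, k, h1, h2, h3, rfl⟩
      exact ⟨_, ⟨i, ⟨h1, h2⟩, rfl⟩, List.mem_map.2 ⟨k, by simpa using h3, rfl⟩⟩
  · simp [h]

theorem lowThreshold_le_of_mem {UB x : F} (hx : x ∈ bigSizes K UB) : lowThreshold K UB ≤ x := by
  obtain ⟨h, i, k, h1, -, -, rfl⟩ := mem_bigSizes.1 hx
  rw [lowThreshold, if_pos h]
  exact (zpow_le_zpow_right₀ one_le_two h1).trans (pow_le_sizeClass i k)

theorem lt_highThreshold_of_mem {UB x : F} (hx : x ∈ bigSizes K UB) : x < highThreshold UB := by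
  obtain ⟨h, i, k, -, h2, hk, rfl⟩ := mem_bigSizes.1 hx
  rw [highThreshold, if_pos h]
  exact (sizeClass_lt_pow hk).trans_le (zpow_le_zpow_right₀ one_le_two (by omega))

theorem mem_bigSizes_of_le {UB : F} {e : ℤ} {k : ℕ} (hk : k < K)
    (h1 : lowThreshold K UB ≤ sizeClass K e (k : F))
    (h2 : sizeClass K e (k : F) < highThreshold UB) : sizeClass K e (k : F) ∈ bigSizes K UB := by
  have hU : 0 < UB := by
    by_contra hU
    rw [highThreshold, if_neg hU] at h2
    have : (0 : F) < (2 : F) ^ e := by positivity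
    linarith [pow_le_sizeClass (F := F) (K := K) e k]
  rw [lowThreshold, if_pos hU] at h1
  rw [highThreshold, if_pos hU] at h2
  have h3 := (zpow_lt_zpow_iff_right₀ (one_lt_two : (1 : F) < 2)).1
    (h1.trans_lt (sizeClass_lt_pow hk))
  have h4 := (zpow_lt_zpow_iff_right₀ (one_lt_two : (1 : F) < 2)).1
    ((pow_le_sizeClass e k).trans_lt h2)
  exact mem_bigSizes.2 ⟨hU, e, k, by omega, h4, hk, rfl⟩

theorem pairwise_bigSizes (UB : F) : (bigSizes K UB).Pairwise (· > ·) := by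
  unfold bigSizes
  split_ifs with h
  swap
  · exact List.Pairwise.nil
  rcases Nat.eq_zero_or_pos K with rfl | hK
  · simp
  rw [List.pairwise_flatten]
  constructor
  · intro l hl
    obtain ⟨i, -, rfl⟩ := List.mem_map.1 hl
    rw [List.pairwise_map, List.pairwise_reverse]
    exact List.pairwise_lt_range.imp fun h => sizeClass_lt_sizeClass hK h
  · rw [List.pairwise_map, exponents_eq, List.pairwise_map]
    refine List.pairwise_lt_range.imp fun {a b} hab x hx y hy => ?_
    obtain ⟨k, hk, rfl⟩ := List.mem_map.1 hx
    obtain ⟨k', hk', rfl⟩ := List.mem_map.1 hy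
    refine (sizeClass_lt_pow (by simpa using hk')).trans_le
      ((zpow_le_zpow_right₀ one_le_two ?_).trans (pow_le_sizeClass _ k))
    omega

theorem length_bigSizes_le (UB : F) :
    (bigSizes K UB).length ≤ (Int.clog 2 UB - Int.clog 2 (UB / K)).toNat * K := by
  unfold bigSizes
  split_ifs with h
  · rw [List.length_flatten, List.map_map, exponents_eq, List.map_map]
    have : ∀ f : ℕ → ℕ, (∀ t, f t = K) → ((List.range
        (Int.clog 2 UB - Int.clog 2 (UB / (K : F))).toNat).map f).sum
          = (Int.clog 2 UB - Int.clog 2 (UB / (K : F))).toNat * K := fun f hf => by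
      rw [funext hf, List.map_const', List.sum_replicate, List.length_range, smul_eq_mul]
    refine (this _ fun t => ?_).le
    simp
  · simp

/-- There are at most `1 + log K` exponents between the thresholds. -/
theorem count_exponents_le (hK : 1 ≤ K) {UB : F} (hU : 0 < UB) :
    (Int.clog 2 UB - Int.clog 2 (UB / K)).toNat ≤ 1 + Nat.clog 2 K := by
  have hK' : (0 : F) < K := by exact_mod_cast hK
  have h1 : (2 : F) ^ Int.clog 2 UB < 2 * UB := zpow_clog_lt hU
  have h2 : UB ≤ K * 2 ^ Int.clog 2 (UB / (K : F)) := by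
    have := le_mul_lowThreshold (F := F) hK (UB := UB)
    rwa [lowThreshold, if_pos hU] at this
  have h3 : (K : F) ≤ 2 ^ Nat.clog 2 K := by
    exact_mod_cast Nat.le_pow_clog one_lt_two K
  have h4 : (2 : F) ^ Int.clog 2 UB
      < 2 ^ ((1 : ℤ) + (Nat.clog 2 K : ℤ) + Int.clog 2 (UB / (K : F))) := by
    rw [zpow_add₀ two_ne_zero, zpow_add₀ two_ne_zero, zpow_natCast, zpow_one]
    have h5 : (0 : F) < 2 ^ Int.clog 2 (UB / (K : F)) := by positivity
    nlinarith
  have := (zpow_lt_zpow_iff_right₀ (one_lt_two : (1 : F) < 2)).1 h4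
  omega

end Thresholds

/-! ### The phase of one size of big jobs -/

section ClassPhase

variable {F : Type} [Field F] [LinearOrder F] [IsStrictOrderedRing F]
  {m : ℕ} {q : ℕ → F} {n : ℕ}

/-- The state `st` of the algorithm when all jobs of size at least `y` have been assigned, where `S`
is the old schedule: the new schedule of these jobs satisfies the LPT condition, and the list of
differing machines is correct. -/
structure PhaseInv (q : ℕ → F) (n : ℕ) (S : Sched m) (y : F) (st : Sched m × List (Fin m)) :
    Prop where
  isSome : ∀ j, (st.1 j).isSome ↔ j ≤ n ∧ y ≤ q j
  stable : Stable q (atLeast q (jobs n) y) st.1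
  sublist : st.2.Sublist (List.finRange m)
  mem_iff : ∀ i, i ∈ st.2 ↔ ¬ ∀ j ≤ n, y ≤ q j → (S j = some i ↔ st.1 j = some i)

theorem PhaseInv.iff {S : Sched m} {y : F} {st : Sched m × List (Fin m)}
    (h : PhaseInv q n S y st) {i : Fin m} (hi : i ∉ st.2) {j : ℕ} (hj : j ≤ n) (hy : y ≤ q j) :
    S j = some i ↔ st.1 j = some i := by
  by_contra hne
  exact hi ((h.mem_iff i).2 fun h' => hne (h' j hj hy))

theorem mem_jobs {j : ℕ} : j ∈ jobs n ↔ j ≤ n := by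
  rw [Finset.mem_range, Nat.lt_succ_iff]

theorem jobs_eq : jobs n = insert n (Finset.range n) := Finset.range_add_one

/-- The stability condition at the jobs of size `x`, in terms of the loads of the jobs of size at
least `x`. -/
theorem _root_.Stable.mload_le {m : ℕ} {q : ℕ → F} {J : Finset ℕ} {σ : Sched m} {x : F}
    (h : Stable q (atLeast q J x) σ) {j : ℕ} (hj : j ∈ J) (hx : q j = x) {i : Fin m}
    (hi : σ j = some i) (k : Fin m) :
    mload q (atLeast q J x) σ i ≤ x + mload q (atLeast q J x) σ k := by
  have := h j (mem_atLeast.2 ⟨hj, hx.ge⟩) i hi k (Finset.mem_univ k)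
  rwa [hx, atLeast_atLeast le_rfl] at this

/-- The step from threshold `y` to the next smaller size `x`. -/
theorem PhaseInv.next {S : Sched m} {y x lo g : F} {st r : Sched m × List (Fin m)}
    (h : PhaseInv q n S y st) (hS : ∀ j, (S j).isSome ↔ j < n)
    (hSs : Stable q (atLeast q (Finset.range n) lo) S) (hlo : lo ≤ x) (hx : 0 < x) (hxy : x < y)
    (hbetween : ∀ j ≤ n, q j < y → x ≤ q j → q j = x) (hq : ∀ j ≤ n, 0 < q j)
    (hg : 0 < g) (hgx : g ≤ x) (hgm : ∀ j ≤ n, lo ≤ q j → ∃ z : ℕ, q j = z * g)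
    (hr : PhaseResult q n S (fun j => q j = x) x st r) :
    PhaseInv q n S x r ∧ (∀ j ≤ n, y ≤ q j → r.1 j = st.1 j) ∧
      g * (r.2.toFinset.card : F) ≤ g * st.2.toFinset.card + (if x ≤ q n then 2 * q n else 0) := by
  classical
  obtain ⟨js, rest, σ₁, hjs, hrest, hkept, hlist⟩ := hr.result
  set σ₂ := r.1 with hσ₂
  set D := st.2.toFinset with hD
  have hmemD : ∀ i, i ∈ D ↔ i ∈ st.2 := fun i => List.mem_toFinset
  have hSn : S n = none := by
    rw [← Option.not_isSome_iff_eq_none, hS]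
    exact lt_irrefl n
  -- the assignments after the phase
  have hold : ∀ j, j ∉ js → σ₂ j = st.1 j := fun j hj => by
    rw [hlist.eq j fun h' => hj ((hrest j).1 h').1,
      hkept.other j fun i h' => absurd h' hj]
  have hbig : ∀ j ≤ n, y ≤ q j → σ₂ j = st.1 j := fun j _ hy => hold j fun h' => by
    have := ((hjs j).1 h').2
    linarith
  have hst1 : ∀ j ∈ js, st.1 j = none := fun j hj => by
    rw [← Option.not_isSome_iff_eq_none, h.isSome]
    have := ((hjs j).1 hj).2
    intro h'
    linarith [h'.2]
  have hkeep : ∀ j ∈ js, ∀ i, S j = some i → i ∉ D → j ∉ rest ∧ σ₂ j = some i := by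
    intro j hj i hi hiD
    have h1 := hkept.kept j hj i hi fun h' => hiD ((hmemD i).2 h')
    have h2 : j ∉ rest := fun h' => by
      have := ((hrest j).1 h').2
      rw [h1] at this
      simp at this
    exact ⟨h2, by rw [hlist.eq j h2, h1]⟩
  have hnotrest : ∀ j ∈ js, j ∉ rest → ∃ i, S j = some i ∧ i ∉ D ∧ σ₂ j = some i := by
    intro j hj hjr
    by_contra hne
    push Not at hne
    refine hjr ((hrest j).2 ⟨hj, ?_⟩)
    rw [hkept.other j fun i _ hi => ?_]
    · exact hst1 j hj
    · by_contra hi'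
      have hiD : i ∉ D := fun h' => hi' ((hmemD i).1 h')
      exact hne i hi hiD (hkeep j hj i hi hiD).2
  have hsome : ∀ j, (σ₂ j).isSome ↔ j ≤ n ∧ x ≤ q j := by
    intro j
    by_cases hj : j ∈ js
    · have h1 := (hjs j).1 hj
      refine iff_of_true ?_ ⟨h1.1, h1.2.ge⟩
      by_cases hjr : j ∈ rest
      · exact hlist.isSome j hjr
      · obtain ⟨i, -, -, hi⟩ := hnotrest j hj hjr
        rw [hi]
        rfl
    · rw [hold j hj, h.isSome]
      refine ⟨fun h' => ⟨h'.1, hxy.le.trans h'.2⟩, fun h' => ⟨h'.1, ?_⟩⟩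
      by_contra! hlt
      exact hj ((hjs j).2 ⟨h'.1, hbetween j h'.1 hlt h'.2⟩)
  -- the loads and the counts
  set cls := (jobs n).filter fun j => q j = x with hcls
  set cls₀ := (Finset.range n).filter fun j => q j = x with hcls₀
  have hmemcls : ∀ j, j ∈ cls ↔ j ∈ js := fun j => by
    rw [hcls, Finset.mem_filter, mem_jobs, hjs]
  set L := mload q (atLeast q (Finset.range n) y) S with hL
  set L' := mload q (atLeast q (jobs n) y) st.1 with hL'
  set c : Fin m → ℕ := fun i => (onMachine cls₀ S i).card with hc
  set d : Fin m → ℕ := fun i => (onMachine rest.toFinset σ₂ i).card with hd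
  have hfilter : ∀ J : Finset ℕ, J ⊆ jobs n →
      ((atLeast q J x).filter fun j => x < q j) = atLeast q J y := by
    intro J hJ
    ext j
    rw [Finset.mem_filter, mem_atLeast, mem_atLeast]
    refine ⟨fun h' => ⟨h'.1.1, ?_⟩, fun h' => ⟨⟨h'.1, hxy.le.trans h'.2⟩, hxy.trans_le h'.2⟩⟩
    by_contra! hlt
    exact h'.2.ne' (hbetween j (mem_jobs.1 (hJ h'.1.1)) hlt h'.1.2)
  have hfilter' : ∀ J : Finset ℕ, ((atLeast q J x).filter fun j => q j = x)
      = J.filter fun j => q j = x := by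
    intro J
    ext j
    rw [Finset.mem_filter, mem_atLeast, Finset.mem_filter]
    exact ⟨fun h' => ⟨h'.1.1, h'.2⟩, fun h' => ⟨⟨h'.1, h'.2.ge⟩, h'.2⟩⟩
  have hloadS : ∀ i, mload q (atLeast q (Finset.range n) x) S i = L i + c i * x := by
    intro i
    rw [mload_eq_add_card (x := x) fun j hj => (mem_atLeast.1 hj).2, hfilter, hfilter']
    exact Finset.range_subset_range.2 n.le_succ
  have hcount : ∀ i, (onMachine cls σ₂ i).card = (if i ∈ D then 0 else c i) + d i := by
    intro i
    have h1 : onMachine cls σ₂ i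
        = (if i ∈ D then ∅ else onMachine cls₀ S i) ∪ onMachine rest.toFinset σ₂ i := by
      ext j
      rw [Finset.mem_union, mem_onMachine, mem_onMachine, hmemcls,
        (List.mem_toFinset : j ∈ rest.toFinset ↔ _)]
      constructor
      · rintro ⟨hj, hji⟩
        by_cases hjr : j ∈ rest
        · exact Or.inr ⟨hjr, hji⟩
        · left
          obtain ⟨i', hi', hi'D, h2⟩ := hnotrest j hj hjr
          have : i' = i := by simpa [h2] using hji
          subst this
          rw [if_neg hi'D, mem_onMachine, hcls₀, Finset.mem_filter, Finset.mem_range, ← hS, hi']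
          exact ⟨⟨rfl, ((hjs j).1 hj).2⟩, rfl⟩
      · rintro (hj | ⟨hj, hji⟩)
        · split_ifs at hj with hiD
          · simp at hj
          · rw [mem_onMachine, hcls₀, Finset.mem_filter, Finset.mem_range] at hj
            have hj' : j ∈ js := (hjs j).2 ⟨hj.1.1.le, hj.1.2⟩
            exact ⟨hj', (hkeep j hj' i hj.2 hiD).2⟩
        · exact ⟨((hrest j).1 hj).1, hji⟩
    rw [h1, Finset.card_union_of_disjoint]
    · split_ifs
      · simp [hd]
      · simp [hd, hc]
    · rw [Finset.disjoint_left]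
      intro j hj hj'
      split_ifs at hj with hiD
      · simp at hj
      · rw [mem_onMachine, hcls₀, Finset.mem_filter, Finset.mem_range] at hj
        have hj1 : j ∈ js := (hjs j).2 ⟨hj.1.1.le, hj.1.2⟩
        exact (hkeep j hj1 i hj.2 hiD).1 (List.mem_toFinset.1 (mem_onMachine.1 hj').1)
  have hloadσ : ∀ i, mload q (atLeast q (jobs n) x) σ₂ i
      = L' i + ((if i ∈ D then 0 else c i) + d i : ℕ) * x := by
    intro i
    rw [mload_eq_add_card (x := x) fun j hj => (mem_atLeast.1 hj).2, hfilter _ subset_rfl,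
      hfilter', ← hcls, hcount]
    congr 1
    refine mload_congr fun j => and_congr_right fun hj => ?_
    rw [mem_atLeast, mem_jobs] at hj
    rw [hbig j hj.1 hj.2]
  have hloadn : ∀ i, mload q (jobs n) σ₂ i
      = L' i + ((if i ∈ D then 0 else c i) + d i : ℕ) * x := by
    intro i
    rw [← hloadσ]
    refine mload_congr fun j => ?_
    rw [mem_atLeast]
    refine ⟨fun h' => ⟨⟨h'.1, ?_⟩, h'.2⟩, fun h' => ⟨h'.1.1, h'.2⟩⟩
    exact ((hsome j).1 (by rw [h'.2]; rfl)).2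
  have hlast : ∀ i, d i ≠ 0 → ∃ j ∈ rest, σ₂ j = some i ∧
      (∀ i', mload q (jobs n) σ₂ i ≤ x + mload q (jobs n) σ₂ i') ∧
      (i ∉ st.2 → ∀ i' ∈ st.2, mload q (jobs n) σ₂ i < x + mload q (jobs n) σ₂ i') := by
    intro i hi
    obtain ⟨j, hj⟩ := Finset.card_ne_zero.1 hi
    rw [mem_onMachine, List.mem_toFinset] at hj
    obtain ⟨j', hj', h1, h2, h3⟩ := hlist.last j hj.1 i hj.2
    rw [((hjs j').1 ((hrest j').1 hj').1).2] at h2 h3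
    exact ⟨j', hj', h1, h2, h3⟩
  have heq : ∀ i, i ∉ D → L i = L' i := fun i hi => mload_congr fun j => by
    rw [mem_atLeast, mem_atLeast, mem_jobs, Finset.mem_range]
    have hi' : i ∉ st.2 := fun h' => hi ((hmemD i).2 h')
    constructor
    · rintro ⟨⟨h1, h2⟩, h3⟩
      exact ⟨⟨h1.le, h2⟩, (h.iff hi' h1.le h2).1 h3⟩
    · rintro ⟨⟨h1, h2⟩, h3⟩
      have h4 := (h.iff hi' h1 h2).2 h3
      refine ⟨⟨?_, h2⟩, h4⟩
      rw [← hS, h4]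
      rfl
  have hSx : Stable q (atLeast q (Finset.range n) x) S := by
    have := hSs.atLeast x
    rwa [atLeast_atLeast hlo] at this
  have hsub : atLeast q (Finset.range n) y ⊆ atLeast q (jobs n) y :=
    Finset.filter_subset_filter _ (Finset.range_subset_range.2 n.le_succ)
  have hsum : ∑ i, d i = ∑ i ∈ D, c i + (if q n = x then 1 else 0) := by
    have h1 : ∑ i, (onMachine cls σ₂ i).card = cls.card := sum_card_onMachine fun j hj => by
      obtain ⟨i, hi⟩ := Option.isSome_iff_exists.1 ((hsome j).2 (by
        have := (hjs j).1 ((hmemcls j).1 hj)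
        exact ⟨this.1, this.2.ge⟩))
      exact ⟨i, Finset.mem_univ i, hi⟩
    have h2 : ∑ i, c i = cls₀.card := sum_card_onMachine fun j hj => by
      obtain ⟨i, hi⟩ := Option.isSome_iff_exists.1 ((hS j).2
        (Finset.mem_range.1 (Finset.mem_filter.1 hj).1))
      exact ⟨i, Finset.mem_univ i, hi⟩
    have h3 : cls.card = cls₀.card + (if q n = x then 1 else 0) := by
      rw [hcls, jobs_eq, Finset.filter_insert]
      split_ifs
      · rw [Finset.card_insert_of_notMem (by simp)]
      · rfl
    have h4 : ∑ i, (if i ∈ D then 0 else c i) + ∑ i ∈ D, c i = ∑ i, c i := by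
      rw [← Finset.sum_add_sum_compl D c, ← Finset.sum_add_sum_compl D fun i => if i ∈ D then 0
        else c i, Finset.sum_eq_zero fun i hi => if_pos hi,
        Finset.sum_congr rfl fun i hi => if_neg (Finset.mem_compl.1 hi)]
      ring
    rw [Finset.sum_congr rfl fun i _ => hcount i, Finset.sum_add_distrib] at h1
    omega
  have hcounts : PhaseCounts D L L' c d x := by
    refine ⟨hx, ?_, heq, fun i hi k => ?_, fun i hi k => ?_, fun i hi hiD k hk => ?_, ?_⟩
    · refine (dominated_of_stable _ _ hsub (fun j hj => ?_) ?_ h.stable (fun j hj => ?_)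
        fun j hj => ?_).restrict heq
      · exact hq j (mem_jobs.1 (mem_atLeast.1 hj).1)
      · have := hSs.atLeast y
        rwa [atLeast_atLeast (hlo.trans hxy.le)] at this
      · exact (hS j).2 (Finset.mem_range.1 (mem_atLeast.1 hj).1)
      · rw [mem_atLeast, mem_jobs] at hj
        exact (h.isSome j).2 hj
    · obtain ⟨j, hj⟩ := Finset.card_ne_zero.1 hi
      rw [mem_onMachine, hcls₀, Finset.mem_filter] at hj
      rw [← hloadS, ← hloadS]
      exact Stable.mload_le hSx hj.1.1 hj.1.2 hj.2 k
    · obtain ⟨-, -, -, h1, -⟩ := hlast i hi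
      rw [← hloadn, ← hloadn]
      exact h1 k
    · obtain ⟨-, -, -, -, h1⟩ := hlast i hi
      rw [← hloadn, ← hloadn]
      exact h1 (fun h' => hiD ((hmemD i).2 h')) k ((hmemD k).1 hk)
    · rw [hsum]
      exact Nat.le_add_right _ _
  have hstable : Stable q (atLeast q (jobs n) x) σ₂ := by
    intro j hj i hi k _
    rw [mem_atLeast, mem_jobs] at hj
    by_cases hjy : y ≤ q j
    · rw [atLeast_atLeast hj.2]
      have h1 := h.stable j (mem_atLeast.2 ⟨mem_jobs.2 hj.1, hjy⟩) i
        (by rw [← hbig j hj.1 hjy, hi]) k (Finset.mem_univ k)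
      rw [atLeast_atLeast hjy] at h1
      have h2 : ∀ i, mload q (atLeast q (jobs n) (q j)) σ₂ i
          = mload q (atLeast q (jobs n) (q j)) st.1 i := fun i =>
        mload_congr fun k => and_congr_right fun hk => by
          rw [mem_atLeast, mem_jobs] at hk
          rw [hbig k hk.1 (hjy.trans hk.2)]
      rwa [h2, h2]
    · have hjx := hbetween j hj.1 (not_le.1 hjy) hj.2
      rw [hjx, atLeast_atLeast le_rfl, hloadσ, hloadσ]
      refine hcounts.greedy' i ?_ k
      rw [← hcount]
      exact Finset.card_ne_zero.2 ⟨j, mem_onMachine.2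
        ⟨(hmemcls j).2 ((hjs j).2 ⟨hj.1, hjx⟩), hi⟩⟩
  refine ⟨⟨hsome, hstable, hr.sublist, hr.mem_iff⟩, hbig, ?_⟩
  -- the new differing machines
  have hnew : r.2.toFinset ⊆ D ∪ Dᶜ.filter fun i => d i ≠ 0 := by
    intro i hi
    rw [Finset.mem_union, Finset.mem_filter, Finset.mem_compl]
    by_contra hne
    push Not at hne
    have hi' : i ∉ st.2 := fun h' => hne.1 ((hmemD i).2 h')
    have hdi := hne.2 hne.1
    refine (hr.mem_iff i).1 (List.mem_toFinset.1 hi) fun j hj hxj => ?_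
    by_cases hjy : y ≤ q j
    · rw [h.iff hi' hj hjy, ← hbig j hj hjy]
    · have hj' : j ∈ js := (hjs j).2 ⟨hj, hbetween j hj (not_le.1 hjy) hxj⟩
      refine ⟨fun h' => (hkeep j hj' i h' hne.1).2, fun h' => ?_⟩
      have hjr : j ∉ rest := fun hjr => by
        have : j ∈ onMachine rest.toFinset σ₂ i :=
          mem_onMachine.2 ⟨List.mem_toFinset.2 hjr, h'⟩
        rw [Finset.card_eq_zero.1 hdi] at this
        simp at this
      obtain ⟨i', h1, -, h2⟩ := hnotrest j hj' hjr
      have : i' = i := by simpa [← hσ₂, h2] using h'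
      rw [← this, h1]
  have hcard : r.2.toFinset.card ≤ D.card + ∑ i ∈ Dᶜ, d i := by
    refine (Finset.card_le_card hnew).trans ((Finset.card_union_le _ _).trans ?_)
    gcongr
    rw [Finset.card_eq_sum_ones]
    calc ∑ i ∈ Dᶜ.filter fun i => d i ≠ 0, 1 ≤ ∑ i ∈ Dᶜ.filter fun i => d i ≠ 0, d i :=
          Finset.sum_le_sum fun i hi => Nat.one_le_iff_ne_zero.2 (Finset.mem_filter.1 hi).2
      _ ≤ _ := Finset.sum_le_sum_of_subset (Finset.filter_subset _ _)
  have hmul : ∀ i ∈ D, ∀ k ∈ D, L i < L' k → L i + g ≤ L' k := by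
    have hz : ∀ (J : Finset ℕ) (σ : Sched m) (i : Fin m), J ⊆ jobs n → ∃ z : ℕ,
        mload q (atLeast q J y) σ i = z * g := by
      intro J σ i hJ
      have : ∀ j ∈ onMachine (atLeast q J y) σ i, ∃ z : ℕ, q j = z * g := fun j hj => by
        have := mem_atLeast.1 (mem_onMachine.1 hj).1
        exact hgm j (mem_jobs.1 (hJ this.1)) ((hlo.trans hxy.le).trans this.2)
      choose! f hf using this
      refine ⟨∑ j ∈ onMachine (atLeast q J y) σ i, f j, ?_⟩
      rw [mload_eq, Finset.sum_congr rfl hf, Nat.cast_sum, Finset.sum_mul]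
    intro i _ k _ hik
    obtain ⟨z, hz1⟩ := hz (Finset.range n) S i (Finset.range_subset_range.2 n.le_succ)
    obtain ⟨z', hz2⟩ := hz (jobs n) st.1 k subset_rfl
    rw [hL, hL', hz1, hz2] at hik ⊢
    have : z < z' := by exact_mod_cast lt_of_mul_lt_mul_right hik hg.le
    have h1 : (z : F) + 1 ≤ z' := by exact_mod_cast this
    nlinarith
  have hdiff : ∑ i ∈ D, L' i - ∑ i ∈ D, L i = if y ≤ q n then q n else 0 := by
    have h1 : ∑ i, L' i - ∑ i, L i = ∑ i ∈ D, L' i - ∑ i ∈ D, L i := by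
      rw [← Finset.sum_add_sum_compl D, ← Finset.sum_add_sum_compl D L,
        Finset.sum_congr rfl fun i hi => heq i (Finset.mem_compl.1 hi)]
      ring
    have h2 : ∑ i, L' i = ∑ j ∈ atLeast q (jobs n) y, q j := sum_mload_eq q fun j hj => by
      rw [mem_atLeast, mem_jobs] at hj
      obtain ⟨i, hi⟩ := Option.isSome_iff_exists.1 ((h.isSome j).2 hj)
      exact ⟨i, Finset.mem_univ i, hi⟩
    have h3 : ∑ i, L i = ∑ j ∈ atLeast q (Finset.range n) y, q j := sum_mload_eq q fun j hj => by
      obtain ⟨i, hi⟩ := Option.isSome_iff_exists.1 ((hS j).2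
        (Finset.mem_range.1 (mem_atLeast.1 hj).1))
      exact ⟨i, Finset.mem_univ i, hi⟩
    rw [← h1, h2, h3, atLeast, atLeast, jobs_eq, Finset.filter_insert]
    split_ifs
    · rw [Finset.sum_insert (by simp)]
      ring
    · ring
  have hextra := hcounts.sum_extra_le hg hgx hmul hsum
  rw [hdiff] at hextra
  have h1 : (r.2.toFinset.card : F) ≤ D.card + (∑ i ∈ Dᶜ, d i : ℕ) := by exact_mod_cast hcard
  have h2 : g * (r.2.toFinset.card : F) ≤ g * D.card + g * (∑ i ∈ Dᶜ, d i : ℕ) := by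
    rw [← mul_add]
    gcongr
  have hqn := hq n le_rfl
  by_cases hyn : y ≤ q n
  · rw [if_pos hyn, if_neg (hxy.trans_le hyn).ne'] at hextra
    rw [if_pos (hxy.le.trans hyn)]
    push_cast at hextra h2 ⊢
    linarith
  · rw [if_neg hyn] at hextra
    by_cases hxn : q n = x
    · rw [if_pos hxn] at hextra
      rw [if_pos hxn.ge]
      push_cast at hextra h2 ⊢
      linarith
    · have : ¬ x ≤ q n := fun h' => hxn (hbetween n le_rfl (not_le.1 hyn) h')
      rw [if_neg hxn] at hextra
      rw [if_neg this]
      push_cast at hextra h2 ⊢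
      linarith

end ClassPhase

/-! ### The phase of the huge jobs and the sequence of phases -/

section HugeJobs

variable {F : Type} [Field F] [LinearOrder F] [IsStrictOrderedRing F]
  {m : ℕ} {q : ℕ → F} {n : ℕ}

/-- If an LPT schedule leaves a machine empty, then all jobs are on different machines. -/
theorem _root_.Stable.injOn {J : Finset ℕ} {σ : Sched m} (h : Stable q J σ) (hq : ∀ j ∈ J, 0 < q j)
    {i₀ : Fin m} (h0 : ∀ j ∈ J, σ j ≠ some i₀) {j j' : ℕ} (hj : j ∈ J) (hj' : j' ∈ J) {i : Fin m}
    (hi : σ j = some i) (hi' : σ j' = some i) : j = j' := by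
  wlog hle : q j ≤ q j' generalizing j j'
  · exact (this hj' hj hi' hi (le_of_not_ge hle)).symm
  by_contra hne
  have h1 := h j hj i hi i₀ (Finset.mem_univ _)
  have h2 : mload q (atLeast q J (q j)) σ i₀ = 0 := Finset.sum_eq_zero fun k hk => by
    rw [Finset.mem_filter] at hk
    exact absurd hk.2 (h0 k (mem_atLeast.1 hk.1).1)
  have h3 : ∑ k ∈ {j, j'}, q k ≤ mload q (atLeast q J (q j)) σ i := by
    refine Finset.sum_le_sum_of_subset_of_nonneg (fun k hk => ?_) fun k hk _ => ?_
    · rw [Finset.mem_filter, mem_atLeast]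
      rcases Finset.mem_insert.1 hk with rfl | hk
      · exact ⟨⟨hj, le_rfl⟩, hi⟩
      · rw [Finset.mem_singleton] at hk
        subst hk
        exact ⟨⟨hj', hle⟩, hi'⟩
    · exact (hq k (mem_atLeast.1 (Finset.mem_filter.1 hk).1).1).le
  rw [Finset.sum_pair hne] at h3
  linarith [hq j' hj']

theorem _root_.Stable.card_lt {J : Finset ℕ} {σ : Sched m} (h : Stable q J σ) (hq : ∀ j ∈ J, 0 < q j)
    {i₀ : Fin m} (h0 : ∀ j ∈ J, σ j ≠ some i₀) (hs : ∀ j ∈ J, (σ j).isSome) : J.card < m := by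
  classical
  have h1 : J.card ≤ ((Finset.univ.erase i₀).image some : Finset (Option (Fin m))).card := by
    refine Finset.card_le_card_of_injOn σ (fun j hj => ?_) fun j hj j' hj' hjj' => ?_
    · obtain ⟨i, hi⟩ := Option.isSome_iff_exists.1 (hs j hj)
      refine Finset.mem_coe.2 (Finset.mem_image.2 ⟨i, Finset.mem_erase.2 ⟨?_, Finset.mem_univ i⟩,
        hi.symm⟩)
      rintro rfl
      exact h0 j hj hi
    · obtain ⟨i, hi⟩ := Option.isSome_iff_exists.1 (hs j hj)
      exact h.injOn hq h0 hj hj' hi (hjj' ▸ hi)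
  have h2 := Finset.card_image_le (s := Finset.univ.erase i₀) (f := some)
  rw [Finset.card_erase_of_mem (Finset.mem_univ _), Finset.card_univ, Fintype.card_fin] at h2
  have := i₀.pos
  omega

theorem exists_free_machine {J : Finset ℕ} (hJ : J.card < m) (σ : Sched m) :
    ∃ i₀, ∀ j ∈ J, σ j ≠ some i₀ := by
  by_contra! h
  choose f hf hσ using h
  have : (Finset.univ : Finset (Fin m)).card ≤ J.card :=
    Finset.card_le_card_of_injOn f (fun i _ => hf i) fun i _ i' _ hii' => by
      have := hσ i
      rw [hii', hσ i'] at this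
      simpa using this.symm
  rw [Finset.card_univ, Fintype.card_fin] at this
  omega

/-- The phase of the huge jobs: if there are fewer than `m` huge jobs, each has a machine of its
own, and only the new job can make machines differ. -/
theorem huge_phase {S : Sched m} {hi : F} {r : Sched m × List (Fin m)}
    (hS : ∀ j, (S j).isSome ↔ j < n) (hSs : Stable q (atLeast q (Finset.range n) hi) S)
    (hq : ∀ j ≤ n, 0 < q j) (hcard : (atLeast q (jobs n) hi).card < m)
    (hr : PhaseResult q n S (fun j => hi ≤ q j) hi (emptySched m, []) r) :
    PhaseInv q n S hi r ∧ (∀ j < n, hi ≤ q j → r.1 j = S j) ∧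
      r.2.toFinset.card ≤ if hi ≤ q n then 1 else 0 := by
  classical
  obtain ⟨js, rest, σ₁, hjs, hrest, hkept, hlist⟩ := hr.result
  set σ₂ := r.1 with hσ₂
  have hSn : S n = none := by
    rw [← Option.not_isSome_iff_eq_none, hS]
    exact lt_irrefl n
  have hsub : atLeast q (Finset.range n) hi ⊆ atLeast q (jobs n) hi :=
    Finset.filter_subset_filter _ (Finset.range_subset_range.2 n.le_succ)
  have hkeep : ∀ j < n, hi ≤ q j → j ∉ rest ∧ σ₂ j = S j := by
    intro j hj hij
    obtain ⟨i, hi⟩ := Option.isSome_iff_exists.1 ((hS j).2 hj)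
    have h1 := hkept.kept j ((hjs j).2 ⟨hj.le, hij⟩) i hi (by simp)
    have h2 : j ∉ rest := fun h' => by
      have := ((hrest j).1 h').2
      rw [h1] at this
      simp at this
    exact ⟨h2, by rw [hlist.eq j h2, h1, hi]⟩
  have hrestn : ∀ j ∈ rest, j = n := fun j hj => by
    have h1 := (hjs j).1 ((hrest j).1 hj).1
    by_contra hne
    exact (hkeep j (lt_of_le_of_ne h1.1 hne) h1.2).1 hj
  have hsome : ∀ j, (σ₂ j).isSome ↔ j ≤ n ∧ hi ≤ q j := by
    intro j
    by_cases hj : j ∈ js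
    · refine iff_of_true ?_ ((hjs j).1 hj)
      by_cases hjr : j ∈ rest
      · exact hlist.isSome j hjr
      · rw [hlist.eq j hjr]
        by_contra hne
        rw [Option.not_isSome_iff_eq_none] at hne
        exact hjr ((hrest j).2 ⟨hj, hne⟩)
    · refine iff_of_false ?_ fun h => hj ((hjs j).2 h)
      rw [hlist.eq j fun h => hj ((hrest j).1 h).1, hkept.other j fun i h => absurd h hj]
      simp [emptySched]
  obtain ⟨i₁, hi₁⟩ := exists_free_machine (lt_of_le_of_lt (Finset.card_le_card hsub) hcard) S
  obtain ⟨i₂, hi₂⟩ := exists_free_machine hcard σ₂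
  have hpos : ∀ j ∈ atLeast q (Finset.range n) hi, 0 < q j := fun j hj =>
    hq j (Finset.mem_range.1 (mem_atLeast.1 hj).1).le
  have hload0 : mload q (jobs n) σ₂ i₂ = 0 := Finset.sum_eq_zero fun j hj => by
    rw [Finset.mem_filter] at hj
    refine absurd hj.2 (hi₂ j (mem_atLeast.2 ⟨hj.1, ((hsome j).1 ?_).2⟩))
    rw [hj.2]
    rfl
  -- The new job, if it is huge, has a machine of its own.
  have hnew : ∀ j < n, hi ≤ q j → hi ≤ q n → ∀ i, σ₂ j = some i → σ₂ n ≠ some i := by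
    intro j hj hij hin i hji hni
    have hnr : n ∈ rest := by
      rw [hrest, hjs]
      refine ⟨⟨le_rfl, hin⟩, ?_⟩
      rw [hkept.other n fun i _ h => by simp [hSn] at h]
      rfl
    obtain ⟨j', hj', -, h1, -⟩ := hlist.last n hnr i hni
    have h2 := h1 i₂
    rw [hrestn j' hj', hload0] at h2
    have h3 : ∑ k ∈ {j, n}, q k ≤ mload q (jobs n) σ₂ i := by
      refine Finset.sum_le_sum_of_subset_of_nonneg (fun k hk => ?_) fun k hk _ => ?_
      · rw [Finset.mem_filter, mem_jobs]
        rcases Finset.mem_insert.1 hk with rfl | hk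
        · exact ⟨hj.le, hji⟩
        · rw [Finset.mem_singleton] at hk
          subst hk
          exact ⟨le_rfl, hni⟩
      · exact (hq k (mem_jobs.1 (Finset.mem_filter.1 hk).1)).le
    rw [Finset.sum_pair hj.ne] at h3
    linarith [hq j hj.le]
  have hinj : ∀ j j', j ≤ n → hi ≤ q j → j' ≤ n → hi ≤ q j' → ∀ i, σ₂ j = some i →
      σ₂ j' = some i → j = j' := by
    intro j j' hj hij hj' hij' i h1 h2
    rcases hj.eq_or_lt with rfl | hjn <;> rcases hj'.eq_or_lt with rfl | hjn'
    · rfl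
    · exact absurd h1 (hnew j' hjn' hij' hij i h2)
    · exact absurd h2 (hnew j hjn hij hij' i h1)
    · rw [(hkeep j hjn hij).2] at h1
      rw [(hkeep j' hjn' hij').2] at h2
      exact hSs.injOn hpos hi₁ (mem_atLeast.2 ⟨Finset.mem_range.2 hjn, hij⟩)
        (mem_atLeast.2 ⟨Finset.mem_range.2 hjn', hij'⟩) h1 h2
  refine ⟨⟨hsome, fun j hj i hji k _ => ?_, hr.sublist, hr.mem_iff⟩,
    fun j hj hij => (hkeep j hj hij).2, ?_⟩
  · rw [mem_atLeast, mem_jobs] at hj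
    rw [atLeast_atLeast hj.2]
    have h1 : mload q (atLeast q (jobs n) (q j)) σ₂ i ≤ ∑ k ∈ {j}, q k := by
      refine Finset.sum_le_sum_of_subset_of_nonneg (fun k hk => ?_) fun k hk _ => ?_
      · rw [Finset.mem_filter, mem_atLeast, mem_jobs] at hk
        rw [Finset.mem_singleton]
        exact (hinj j k hj.1 hj.2 hk.1.1 (hj.2.trans hk.1.2) i hji hk.2).symm
      · rw [Finset.mem_singleton] at hk
        subst hk
        exact (hq k hj.1).le
    rw [Finset.sum_singleton] at h1
    have h2 := mload_nonneg (J := atLeast q (jobs n) (q j)) (fun k hk =>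
      (hq k (mem_jobs.1 (mem_atLeast.1 hk).1)).le) σ₂ k
    linarith
  · have h1 : ∀ i ∈ r.2, hi ≤ q n ∧ σ₂ n = some i := by
      intro i hir
      by_contra hne
      refine (hr.mem_iff i).1 hir fun j hj hij => ?_
      rcases hj.eq_or_lt with rfl | hjn
      · rw [hSn]
        exact iff_of_false (by simp) fun h => hne ⟨hij, h⟩
      · rw [← (hkeep j hjn hij).2]
    split_ifs with hin
    · refine Finset.card_le_one.2 fun a ha b hb => ?_
      have h2 := (h1 a (List.mem_toFinset.1 ha)).2
      have h3 := (h1 b (List.mem_toFinset.1 hb)).2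
      rw [h2] at h3
      simpa using h3
    · rw [Nat.le_zero, Finset.card_eq_zero, Finset.eq_empty_iff_forall_notMem]
      exact fun a ha => hin (h1 a (List.mem_toFinset.1 ha)).1

theorem PhaseInv.congr {S : Sched m} {x y : F} {st : Sched m × List (Fin m)}
    (h : PhaseInv q n S y st) (hxy : ∀ j ≤ n, x ≤ q j ↔ y ≤ q j) : PhaseInv q n S x st := by
  have h1 : atLeast q (jobs n) x = atLeast q (jobs n) y :=
    Finset.filter_congr fun j hj => hxy j (mem_jobs.1 hj)
  refine ⟨fun j => ?_, h1 ▸ h.stable, h.sublist, fun i => ?_⟩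
  · rw [h.isSome]
    exact and_congr_right fun hj => (hxy j hj).symm
  · rw [h.mem_iff]
    exact not_congr (forall₂_congr fun j hj => by rw [hxy j hj])

end HugeJobs

section PhaseSequence

variable {F : Type} [Field F] [LinearOrder F] [IsStrictOrderedRing F] [FloorRing F]
  {m : ℕ} {size : F → ℕ} {q : ℕ → F} {n V K : ℕ}

/-- The phases for the big jobs. The number of differing machines grows by `O(q n / (ε lo))` in each
phase, where `n` is the new job. -/
theorem phases_spec (h : SumBound m size q n V) (hm : 0 < m) (hK : 1 ≤ K) {UB : F}
    (hsize : ∀ x ∈ bigSizes K UB, size x ≤ V) (hlen : (bigSizes K UB).length ≤ V)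
    (hq : ∀ j ≤ n, 0 < q j)
    (hround : ∀ j ≤ n, ∃ (e : ℤ) (k : ℕ), k < K ∧ q j = sizeClass K e (k : F))
    {S : Sched m} (hS : ∀ j, (S j).isSome ↔ j < n)
    (hSs : Stable q (atLeast q (Finset.range n) (lowThreshold K UB)) S)
    {st₀ : Sched m × List (Fin m)} (h0 : PhaseInv q n S (highThreshold UB) st₀)
    (hhuge : ∀ j < n, highThreshold UB ≤ q j → st₀.1 j = S j)
    (hcard : st₀.2.toFinset.card ≤ if highThreshold UB ≤ q n then 1 else 0) :
    Prog.Spec V 28 (Prog.fold (fun st x => phase size q n S (fun j => Prog.eq size (q j) x) x st)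
      st₀ (bigSizes K UB)) (fun st => PhaseInv q n S (lowThreshold K UB) st ∧
        (∀ j < n, highThreshold UB ≤ q j → st.1 j = S j) ∧
        lowThreshold K UB / K * (st.2.toFinset.card : F)
          ≤ ((bigSizes K UB).length + 1) * if lowThreshold K UB ≤ q n then 2 * q n else 0) := by
  set lo := lowThreshold K UB with hlo
  set hi := highThreshold UB with hhi
  set P := bigSizes K UB with hP
  have hK' : (1 : F) ≤ K := by exact_mod_cast hK
  have hlo0 : 0 ≤ lo := lowThreshold_nonneg UB
  have hglo : lo / K ≤ lo := div_le_self hlo0 hK'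
  have hlohi : lo ≤ hi := lowThreshold_le_highThreshold hK UB
  refine (Prog.Spec.fold (k := 26) (I := fun rem st => ∃ (y : F) (t : ℕ), lo ≤ y ∧ y ≤ hi ∧
    rem <:+ P ∧ t + rem.length = P.length ∧ (∀ x ∈ rem, x < y) ∧
    (∀ j ≤ n, lo ≤ q j → q j < y → q j ∈ rem) ∧ PhaseInv q n S y st ∧
    (∀ j < n, hi ≤ q j → st.1 j = S j) ∧
    lo / K * (st.2.toFinset.card : F) ≤ (t + 1) * if y ≤ q n then 2 * q n else 0)
    h.le_V hlen ?_ ?_).mono ?_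
  · refine ⟨hi, 0, hlohi, le_rfl, List.suffix_rfl, by simp, fun x hx => lt_highThreshold_of_mem hx,
      fun j hj h1 h2 => ?_, h0, hhuge, ?_⟩
    · obtain ⟨e, k, hk, he⟩ := hround j hj
      rw [he] at h1 h2 ⊢
      exact mem_bigSizes_of_le hk h1 h2
    · split_ifs at hcard ⊢ with hin
      · have h1 : (st₀.2.toFinset.card : F) ≤ 1 := by exact_mod_cast hcard
        have h2 : lo / K * (st₀.2.toFinset.card : F) ≤ lo / K * 1 := by
          gcongr
        have := hq n le_rfl
        push_cast
        linarith
      · rw [Nat.le_zero.1 hcard]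
        simp
  · rintro x rem st ⟨y, t, h1, h2, h3, h4, h5, h6, h7, h8, h9⟩
    have hxP : x ∈ P := h3.subset List.mem_cons_self
    have hxlo : lo ≤ x := lowThreshold_le_of_mem hxP
    have hxy := h5 x List.mem_cons_self
    have hpair : ∀ z ∈ rem, z < x :=
      (List.pairwise_cons.1 ((pairwise_bigSizes UB).sublist h3.sublist)).1
    have hU : 0 < UB := (mem_bigSizes.1 hxP).1
    have hlopos : 0 < lo := by
      rw [hlo, lowThreshold, if_pos hU]
      positivity
    have hx0 : 0 < x := hlopos.trans_le hxlo
    refine (phase_spec h hm (fun j hj => (hq j (mem_jobs.1 hj)).le) (fun j hj =>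
      Prog.Spec.eq h.le_V (h.size_le hj) (hsize x hxP)) (hsize x hxP) S h7.sublist).mono
      fun r hr => ?_
    have hbetween : ∀ j ≤ n, q j < y → x ≤ q j → q j = x := fun j hj hjy hxj => by
      rcases List.mem_cons.1 (h6 j hj (hxlo.trans hxj) hjy) with h' | h'
      · exact h'
      · exact absurd (hpair _ h') (not_lt.2 hxj)
    obtain ⟨e1, e2, e3⟩ := h7.next hS hSs hxlo hx0 hxy hbetween hq
      (show 0 < lo / K by positivity) (hglo.trans hxlo)
      (fun j hj hj' => by
        obtain ⟨e, k, hk, he⟩ := hround j hj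
        rw [he] at hj' ⊢
        exact exists_multiple_of_le hK e hk hj' hU) hr
    refine ⟨x, t + 1, hxlo, hxy.le.trans h2, (List.suffix_cons x rem).trans h3, ?_, hpair, ?_, e1,
      fun j hj hij => ?_, ?_⟩
    · rw [List.length_cons] at h4
      omega
    · intro j hj hj1 hj2
      rcases List.mem_cons.1 (h6 j hj hj1 (hj2.trans hxy)) with h' | h'
      · exact absurd h' hj2.ne
      · exact h'
    · rw [e2 j hj.le (h2.trans hij), h8 j hj hij]
    · refine e3.trans ?_
      have hqn := hq n le_rfl
      push_cast
      by_cases hyn : y ≤ q n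
      · rw [if_pos hyn] at h9
        rw [if_pos (hxy.le.trans hyn)]
        linarith
      · rw [if_neg hyn, mul_zero] at h9
        split_ifs
        · have : (0 : F) ≤ t * (2 * q n) := by positivity
          linarith
        · linarith
  · rintro st ⟨y, t, h1, h2, h3, h4, h5, h6, h7, h8, h9⟩
    have hiff : ∀ j ≤ n, lo ≤ q j ↔ y ≤ q j := fun j hj => by
      refine ⟨fun h' => ?_, h1.trans⟩
      by_contra! hlt
      simpa using h6 j hj h' hlt
    refine ⟨h7.congr hiff, h8, ?_⟩
    rw [List.length_nil, add_zero] at h4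
    rw [← h4]
    simpa only [hiff n le_rfl] using h9

end PhaseSequence

/-! ### Small jobs, the final loop and the migrated size -/

section NearLPT

variable {F : Type} [Field F] [LinearOrder F] [IsStrictOrderedRing F]
  {m : ℕ} {q : ℕ → F} {n : ℕ}

/-- The properties of the schedules of the algorithm that matter for its analysis: the jobs of size
at least `lo` satisfy the LPT condition, and a machine with a smaller job is at most `lo` higher
than any other machine. -/
structure NearLPT (q : ℕ → F) (J : Finset ℕ) (lo : F) (σ : Sched m) : Prop where
  stable : Stable q (atLeast q J lo) σ
  small : ∀ i, (∃ j ∈ J, σ j = some i ∧ q j < lo) → ∀ i', mload q J σ i ≤ mload q J σ i' + lo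

theorem NearLPT.le_of_big {J : Finset ℕ} {lo : F} {σ : Sched m} (h : NearLPT q J lo σ)
    (hq : ∀ j ∈ J, 0 < q j) {i : Fin m} (hi : ∀ j ∈ J, σ j = some i → lo ≤ q j) {e : ℕ}
    (he : e ∈ J) (hei : σ e = some i) (hmin : ∀ j ∈ J, σ j = some i → q e ≤ q j) (k : Fin m) :
    mload q J σ i ≤ q e + mload q J σ k := by
  have h1 : mload q J σ i = mload q (atLeast q J lo) σ i := mload_congr fun j => by
    rw [mem_atLeast]
    exact ⟨fun h => ⟨⟨h.1, hi j h.1 h.2⟩, h.2⟩, fun h => ⟨h.1.1, h.2⟩⟩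
  have h2 : mload q (atLeast q J lo) σ k ≤ mload q J σ k :=
    mload_mono (Finset.filter_subset _ _) (fun j hj => (hq j hj).le) σ k
  have h3 := mload_le_of_lptAt (J := atLeast q J lo)
    (fun j hj => hq j (mem_atLeast.1 hj).1) (Finset.mem_univ k)
    hei (fun j hj => hmin j (mem_atLeast.1 hj).1) (h.stable e (mem_atLeast.2 ⟨he, hi e he hei⟩))
  linarith

theorem NearLPT.mono {J : Finset ℕ} {lo lo' : F} {σ : Sched m} (h : NearLPT q J lo σ)
    (hq : ∀ j ∈ J, 0 < q j) (hlo : lo ≤ lo') : NearLPT q J lo' σ := by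
  refine ⟨?_, ?_⟩
  · have := h.stable.atLeast lo'
    rwa [atLeast_atLeast hlo] at this
  · rintro i ⟨j, hj, hji, hjlo⟩ i'
    by_cases hi : ∃ j ∈ J, σ j = some i ∧ q j < lo
    · linarith [h.small i hi i']
    · push Not at hi
      obtain ⟨e, he, hei, hmin⟩ := exists_smallest_on q (J := J) (σ := σ) (i := i)
        ⟨j, mem_onMachine.2 ⟨hj, hji⟩⟩
      linarith [h.le_of_big hq hi he hei hmin i', hmin j hj hji]

theorem mload_congr_fun {J : Finset ℕ} {q' : ℕ → F} {σ σ' : Sched m} (hq : ∀ j ∈ J, q j = q' j)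
    (hσ : ∀ j ∈ J, σ j = σ' j) (i : Fin m) : mload q J σ i = mload q' J σ' i := by
  unfold mload
  rw [Finset.filter_congr fun j hj => by rw [hσ j hj]]
  exact Finset.sum_congr rfl fun j hj => hq j (Finset.mem_filter.1 hj).1

theorem atLeast_congr {J : Finset ℕ} {q' : ℕ → F} (hq : ∀ j ∈ J, q j = q' j) (x : F) :
    atLeast q J x = atLeast q' J x :=
  Finset.filter_congr fun j hj => by rw [hq j hj]

theorem _root_.Stable.congr {J : Finset ℕ} {q' : ℕ → F} {σ σ' : Sched m} (h : Stable q J σ)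
    (hq : ∀ j ∈ J, q j = q' j) (hσ : ∀ j ∈ J, σ j = σ' j) : Stable q' J σ' := by
  intro j hj i hi k hk
  have hsub : atLeast q J (q j) ⊆ J := Finset.filter_subset _ _
  have := h j hj i (by rw [hσ j hj, hi]) k hk
  rw [mload_congr_fun (fun j hj => hq j (hsub hj)) fun j hj => hσ j (hsub hj),
    mload_congr_fun (σ := σ) (fun j hj => hq j (hsub hj)) fun j hj => hσ j (hsub hj),
    atLeast_congr hq, hq j hj] at this
  exact this

theorem NearLPT.congr {J : Finset ℕ} {lo : F} {σ : Sched m} {q' : ℕ → F} (h : NearLPT q J lo σ)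
    (hqq : ∀ j ∈ J, q j = q' j) : NearLPT q' J lo σ := by
  have hsub : atLeast q J lo ⊆ J := Finset.filter_subset _ _
  refine ⟨?_, ?_⟩
  · rw [← atLeast_congr hqq]
    exact h.stable.congr (fun j hj => hqq j (hsub hj)) fun _ _ => rfl
  · rintro i ⟨j, hj, hji, hjlo⟩ i'
    rw [← mload_congr_fun hqq fun _ _ => rfl, ← mload_congr_fun hqq fun _ _ => rfl]
    exact h.small i ⟨j, hj, hji, by rwa [hqq j hj]⟩ i'

end NearLPT

section SmallJobs

variable {F : Type} [Field F] [LinearOrder F] [IsStrictOrderedRing F]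
  {m : ℕ} {q : ℕ → F} {n : ℕ}

/-- The schedule `ρ` at the beginning of the final loop, compared with the old schedule `S`. Here `D`
is the set of the machines with different big jobs, and `lam` is the minimum load of `S`. -/
structure LoopStart (q : ℕ → F) (n : ℕ) (lo lam : F) (D : Finset (Fin m)) (S ρ : Sched m) :
    Prop where
  isSome : ∀ j, (ρ j).isSome ↔ j ≤ n
  keep : ∀ j < n, ∀ i, S j = some i → i ∉ D → ρ j = some i
  le_load : ∀ i, i ∉ D → lam ≤ mload q (jobs n) ρ i
  small : ∀ i, i ∉ D → HasSmall q n lo ρ i → mload q (jobs n) ρ i ≤ lam + lo ∨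
    ∀ i', mload q (jobs n) ρ i ≤ mload q (jobs n) ρ i' + lo

theorem loopStart_of_phases {S : Sched m} {lo lam : F} {st : Sched m × List (Fin m)}
    (h : PhaseInv q n S lo st) (hS : ∀ j, (S j).isSome ↔ j < n)
    (hSn : NearLPT q (Finset.range n) lo S) (hq : ∀ j ≤ n, 0 < q j)
    {i₀ : Fin m} (hlam : lam = mload q (Finset.range n) S i₀)
    (hmin : ∀ i, lam ≤ mload q (Finset.range n) S i)
    {small rest : List ℕ} {σ₁ ρ : Sched m} (hsmall : ∀ j, j ∈ small ↔ j ≤ n ∧ q j < lo)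
    (hkept : Kept S st.2 small st.1 σ₁) (hrest : ∀ j, j ∈ rest ↔ j ≤ n ∧ σ₁ j = none)
    (hlist : ListScheduled q n [] rest σ₁ ρ) :
    LoopStart q n lo lam st.2.toFinset S ρ ∧ ∀ j ≤ n, lo ≤ q j → ρ j = st.1 j := by
  have hbig : ∀ j ≤ n, lo ≤ q j → ρ j = st.1 j := by
    intro j hj hlo
    have h1 : σ₁ j = st.1 j := hkept.other j fun i h' => by
      have := ((hsmall j).1 h').2
      linarith
    rw [hlist.eq j fun h' => ?_, h1]
    have h2 := ((hrest j).1 h').2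
    rw [h1] at h2
    have h3 := (h.isSome j).2 ⟨hj, hlo⟩
    rw [h2] at h3
    simp at h3
  have hsome : ∀ j, (ρ j).isSome ↔ j ≤ n := by
    intro j
    by_cases hj : j ∈ rest
    · exact iff_of_true (hlist.isSome j hj) ((hrest j).1 hj).1
    · rw [hlist.eq j hj]
      constructor
      · intro h1
        by_contra hjn
        rw [hkept.other j fun i h' => absurd ((hsmall j).1 h').1 hjn] at h1
        exact hjn ((h.isSome j).1 h1).1
      · intro hjn
        by_contra hne
        rw [Option.not_isSome_iff_eq_none] at hne
        exact hj ((hrest j).2 ⟨hjn, hne⟩)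
  have hkeep : ∀ j < n, ∀ i, S j = some i → i ∉ st.2 → j ∉ rest ∧ ρ j = some i := by
    intro j hj i hi hiD
    have h1 : σ₁ j = some i := by
      by_cases hlo : lo ≤ q j
      · rw [hkept.other j fun i h' => ?_]
        · exact (h.iff hiD hj.le hlo).1 hi
        · have := ((hsmall j).1 h').2
          linarith
      · exact hkept.kept j ((hsmall j).2 ⟨hj.le, not_le.1 hlo⟩) i hi hiD
    have h2 : j ∉ rest := fun h' => by
      have := ((hrest j).1 h').2
      rw [h1] at this
      simp at this
    exact ⟨h2, by rw [hlist.eq j h2, h1]⟩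
  refine ⟨⟨hsome, fun j hj i hi hiD => (hkeep j hj i hi (by simpa using hiD)).2, ?_, ?_⟩, hbig⟩
  · intro i hiD
    refine (hmin i).trans (Finset.sum_le_sum_of_subset_of_nonneg (fun j hj => ?_) fun j hj _ => ?_)
    · rw [Finset.mem_filter, Finset.mem_range] at hj
      rw [Finset.mem_filter, mem_jobs]
      exact ⟨hj.1.le, (hkeep j hj.1 i hj.2 (by simpa using hiD)).2⟩
    · exact (hq j (mem_jobs.1 (Finset.mem_filter.1 hj).1)).le
  · rintro i hiD ⟨j, hj, hji, hjlo⟩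
    have hiD' : i ∉ st.2 := by simpa using hiD
    by_cases hex : ∃ j ∈ rest, ρ j = some i
    · obtain ⟨j, hj, hji⟩ := hex
      obtain ⟨j', hj', hji', h1, -⟩ := hlist.last j hj i hji
      refine Or.inr fun i' => (h1 i').trans ?_
      have hj'n := (hrest j').1 hj'
      have : q j' < lo := by
        by_contra! hlo
        have h2 := hkept.other j' fun i h' => absurd ((hsmall j').1 h').2 (not_lt.2 hlo)
        have h3 := (h.isSome j').2 ⟨hj'n.1, hlo⟩
        rw [← h2, hj'n.2] at h3
        simp at h3
      linarith
    · push Not at hex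
      left
      have hold : ∀ j, j ≤ n → ρ j = some i → j < n ∧ S j = some i := by
        intro j hj hji
        have hjr : j ∉ rest := fun h' => hex j h' hji
        have h1 : σ₁ j = some i := by rw [← hlist.eq j hjr, hji]
        have h2 : S j = some i := by
          by_cases hlo : lo ≤ q j
          · exact (h.iff hiD' hj hlo).2 (by rw [← hbig j hj hlo, hji])
          · by_contra hne
            have h3 : j ∈ small := (hsmall j).2 ⟨hj, not_le.1 hlo⟩
            rw [hkept.other j fun i' _ hi' => ?_] at h1
            · have := (h.isSome j).1 (by rw [h1]; rfl)
              exact hlo this.2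
            · by_contra hi'D
              have := hkept.kept j h3 i' hi' hi'D
              rw [h1] at this
              rw [this] at hne
              exact hne hi'
        exact ⟨(hS j).1 (by rw [h2]; rfl), h2⟩
      have h1 : mload q (jobs n) ρ i = mload q (Finset.range n) S i := mload_congr fun j => by
        rw [mem_jobs, Finset.mem_range]
        constructor
        · exact fun h' => hold j h'.1 h'.2
        · exact fun h' => ⟨h'.1.le, (hkeep j h'.1 i h'.2 hiD').2⟩
      rw [h1, hlam]
      obtain ⟨h2, h3⟩ := hold j hj hji
      exact hSn.small i ⟨j, Finset.mem_range.2 h2, h3, hjlo⟩ i₀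

/-- The loads after job `j` is moved from machine `i` to machine `k`. -/
theorem mload_move {J : Finset ℕ} {σ : Sched m} {j : ℕ} (hj : j ∈ J) {i : Fin m}
    (hi : σ j = some i) (k l : Fin m) : mload q J (Function.update σ j (some k)) l
      = mload q J σ l + (if k = l then q j else 0) - (if i = l then q j else 0) := by
  simp only [mload, Finset.sum_filter]
  rw [← Finset.add_sum_erase J _ hj, ← Finset.add_sum_erase J
    (fun j' => if σ j' = some l then q j' else 0) hj, Function.update_self, hi,
    Finset.sum_congr rfl fun j' hj' => by rw [Function.update_of_ne (Finset.ne_of_mem_erase hj')]]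
  simp only [Option.some.injEq]
  ring

/-- The invariant of the final loop, which started from `ρ`. Jobs that have been moved are on low
machines and do not move again. Jobs that left a machine outside of `D` went to machines in `D`, and
no machine got much of them. -/
structure LoopInv (q : ℕ → F) (n : ℕ) (lo lam : F) (D : Finset (Fin m)) (ρ σ : Sched m) :
    Prop where
  isSome : ∀ j, (σ j).isSome ↔ j ≤ n
  big : ∀ j ≤ n, lo ≤ q j → σ j = ρ j
  moved : ∀ j ≤ n, σ j ≠ ρ j → ∀ i, σ j = some i → ∀ i',
    mload q (jobs n) σ i ≤ mload q (jobs n) σ i' + lo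
  small : ∀ i, i ∉ D → HasSmall q n lo σ i → mload q (jobs n) σ i ≤ lam + lo ∨
    ∀ i', mload q (jobs n) σ i ≤ mload q (jobs n) σ i' + lo
  high : ∀ i, i ∉ D → lam ≤ mload q (jobs n) σ i ∨
    ∀ i', HasSmall q n lo σ i' → mload q (jobs n) σ i' < mload q (jobs n) σ i + lo
  target : ∀ j ≤ n, ∀ i, ρ j = some i → i ∉ D → σ j ≠ ρ j → ∃ k ∈ D, σ j = some k
  sum_le : ∀ k, ∑ j ∈ (jobs n).filter (fun j => σ j = some k ∧ σ j ≠ ρ j ∧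
    ∃ i, i ∉ D ∧ ρ j = some i), q j ≤ lam + lo

theorem LoopStart.inv {lo lam : F} {D : Finset (Fin m)} {S ρ : Sched m}
    (h : LoopStart q n lo lam D S ρ) (hlam : 0 ≤ lam) (hlo : 0 ≤ lo) :
    LoopInv q n lo lam D ρ ρ :=
  ⟨h.isSome, fun _ _ _ => rfl, fun _ _ h => absurd rfl h, h.small,
    fun i hi => Or.inl (h.le_load i hi), fun _ _ _ _ _ h => absurd rfl h, fun k => by
      rw [Finset.sum_eq_zero fun j hj => absurd rfl (Finset.mem_filter.1 hj).2.2.1]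
      exact add_nonneg hlam hlo⟩

theorem LoopInv.move {lo lam : F} {D : Finset (Fin m)} {ρ σ : Sched m}
    (h : LoopInv q n lo lam D ρ σ) (hq : ∀ j ≤ n, 0 < q j) {j : ℕ} {i k : Fin m}
    (hmv : SmallMove q n lo σ j i k) :
    LoopInv q n lo lam D ρ (Function.update σ j (some k)) ∧
      ((jobs n).filter fun j' => Function.update σ j (some k) j' = ρ j').card
        < ((jobs n).filter fun j' => σ j' = ρ j').card := by
  set σ' := Function.update σ j (some k) with hσ'
  have hjn : j ∈ jobs n := mem_jobs.2 hmv.le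
  have hqj := hq j hmv.le
  have hlt := hmv.lt_lo
  have hbad := hmv.bad
  have hleast := hmv.least
  have hik : i ≠ k := by
    rintro rfl
    linarith
  have hj' : σ' j = some k := Function.update_self _ _ _
  have hne : ∀ l, l ≠ j → σ' l = σ l := fun l hl => Function.update_of_ne hl _ _
  have hload : ∀ l, mload q (jobs n) σ' l = _ := fun l => mload_move hjn hmv.on k l
  have hk : mload q (jobs n) σ' k = mload q (jobs n) σ k + q j := by
    rw [hload, if_pos rfl, if_neg hik, sub_zero]
  have hi : mload q (jobs n) σ' i = mload q (jobs n) σ i - q j := by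
    rw [hload, if_neg hik.symm, if_pos rfl, add_zero]
  have hother : ∀ l, l ≠ i → l ≠ k → mload q (jobs n) σ' l = mload q (jobs n) σ l :=
    fun l hli hlk => by
      rw [hload, if_neg hlk.symm, if_neg hli.symm, add_zero, sub_zero]
  -- The minimum load does not decrease.
  have hmin : ∀ l, mload q (jobs n) σ k ≤ mload q (jobs n) σ' l := by
    intro l
    by_cases hli : l = i
    · rw [hli, hi]
      linarith
    by_cases hlk : l = k
    · rw [hlk, hk]
      linarith
    rw [hother l hli hlk]
    exact hleast l
  have hincr : ∀ l, l ≠ i → mload q (jobs n) σ l ≤ mload q (jobs n) σ' l := by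
    intro l hli
    by_cases hlk : l = k
    · rw [hlk, hk]
      linarith
    exact (hother l hli hlk).ge
  -- A machine other than `i` that was low stays low.
  have hlow : ∀ l, l ≠ i → (l ≠ k → mload q (jobs n) σ l ≤ mload q (jobs n) σ k + lo) → ∀ l',
      mload q (jobs n) σ' l ≤ mload q (jobs n) σ' l' + lo := by
    intro l hli hl l'
    have := hmin l'
    by_cases hlk : l = k
    · rw [hlk, hk]
      linarith
    · rw [hother l hli hlk]
      linarith [hl hlk]
  have hunmoved : σ j = ρ j := by
    by_contra hne
    linarith [h.moved j hmv.le hne i hmv.on k]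
  have hsm : ∀ l, l ≠ k → HasSmall q n lo σ' l → HasSmall q n lo σ l := by
    rintro l hl ⟨j', h1, h2, h3⟩
    refine ⟨j', h1, ?_, h3⟩
    rwa [hne] at h2
    rintro rfl
    rw [hj'] at h2
    exact hl (by simpa using h2.symm)
  have hismall : HasSmall q n lo σ i := ⟨j, hmv.le, hmv.on, hlt⟩
  -- A job leaves a machine outside of `D` only for a machine of load less than `lam`.
  have hout : i ∉ D → mload q (jobs n) σ k < lam ∧ k ∈ D := by
    intro hiD
    have h1 : mload q (jobs n) σ k < lam := by
      rcases h.small i hiD hismall with h1 | h1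
      · linarith
      · linarith [h1 k]
    refine ⟨h1, ?_⟩
    by_contra hkD
    rcases h.high k hkD with h2 | h2
    · linarith
    · linarith [h2 i hismall]
  refine ⟨⟨fun j' => ?_, fun j' hj'n hlo => ?_, fun j' hj'n hmoved l hl => ?_, fun l hlD hls => ?_,
    fun l hlD => ?_, fun j' hj'n l hl hlD hmoved => ?_, fun l => ?_⟩, ?_⟩
  · by_cases hjj : j' = j
    · rw [hjj, hj']
      exact iff_of_true rfl hmv.le
    · rw [hne j' hjj, h.isSome]
  · rw [hne j' fun hjj => by rw [hjj] at hlo; linarith, h.big j' hj'n hlo]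
  · by_cases hjj : j' = j
    · rw [hjj, hj'] at hl
      obtain rfl : k = l := by simpa using hl
      exact hlow k hik.symm fun h' => absurd rfl h'
    · rw [hne j' hjj] at hmoved hl
      have h1 := h.moved j' hj'n hmoved l hl k
      exact hlow l (by rintro rfl; linarith) fun _ => h1
  · by_cases hli : l = i
    · subst hli
      left
      rcases h.small l hlD hismall with h1 | h1
      · rw [hi]
        linarith
      · linarith [h1 k]
    · by_cases hlk : l = k
      · exact Or.inr (hlow l hli fun h' => absurd hlk h')
      · rcases h.small l hlD (hsm l hlk hls) with h1 | h1
        · exact Or.inl (by rwa [hother l hli hlk])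
        · exact Or.inr (hlow l hli fun _ => h1 k)
  · by_cases hli : l = i
    · subst hli
      refine Or.inr fun i' hi' => ?_
      rw [hi]
      by_cases hik' : i' = k
      · rw [hik', hk]
        linarith
      · have h1 := hmv.most i' (hsm i' hik' hi')
        by_cases hil : i' = l
        · rw [hil, hi]
          linarith
        · rw [hother i' hil hik']
          linarith
    · rcases h.high l hlD with h1 | h1
      · exact Or.inl (h1.trans (hincr l hli))
      · refine Or.inr fun i' hi' => ?_
        by_cases hik' : i' = k
        · by_cases hlk : l = k
          · rw [hik', hlk]
            linarith
          · rw [hik', hk, hother l hli hlk]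
            linarith [hleast l]
        · have h2 := h1 i' (hsm i' hik' hi')
          have h3 : mload q (jobs n) σ' i' ≤ mload q (jobs n) σ i' := by
            by_cases hii : i' = i
            · rw [hii, hi]
              linarith
            · exact (hother i' hii hik').le
          linarith [hincr l hli]
  · by_cases hjj : j' = j
    · rw [hjj, ← hunmoved, hmv.on] at hl
      obtain rfl : i = l := by simpa using hl
      exact ⟨k, (hout hlD).2, by rw [hjj, hj']⟩
    · rw [hne j' hjj] at hmoved ⊢
      exact h.target j' hj'n l hl hlD hmoved
  · set A := (jobs n).filter (fun j' => σ j' = some l ∧ σ j' ≠ ρ j' ∧ ∃ i, i ∉ D ∧ ρ j' = some i)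
      with hA
    set A' := (jobs n).filter (fun j' => σ' j' = some l ∧ σ' j' ≠ ρ j' ∧
      ∃ i, i ∉ D ∧ ρ j' = some i) with hA'
    have hpos : ∀ j' ∈ jobs n, 0 ≤ q j' := fun j' h' => (hq j' (mem_jobs.1 h')).le
    have hsub : ∀ j', j' ≠ j → j' ∈ A' → j' ∈ A := by
      intro j' hjj h'
      rw [hA', Finset.mem_filter, hne j' hjj] at h'
      exact Finset.mem_filter.2 h'
    by_cases hjA : j ∈ A'
    · have h1 := hjA
      rw [hA', Finset.mem_filter, hj', ← hunmoved, hmv.on] at h1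
      obtain ⟨-, hkl, -, i', hi'D, hi'⟩ := h1
      obtain rfl : k = l := by simpa using hkl
      obtain rfl : i = i' := by simpa using hi'
      rw [← Finset.add_sum_erase A' q hjA]
      have h2 : ∑ j' ∈ A'.erase j, q j' ≤ mload q (jobs n) σ k := by
        refine Finset.sum_le_sum_of_subset_of_nonneg (fun j' h' => ?_) fun j' h' _ =>
          hpos j' (Finset.mem_filter.1 h').1
        rw [Finset.mem_erase] at h'
        have h3 := Finset.mem_filter.1 (hsub j' h'.1 h'.2)
        exact Finset.mem_filter.2 ⟨h3.1, h3.2.1⟩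
      linarith [(hout hi'D).1]
    · refine le_trans (Finset.sum_le_sum_of_subset_of_nonneg (fun j' h' => ?_)
        fun j' h' _ => hpos j' (Finset.mem_filter.1 h').1) (h.sum_le l)
      exact hsub j' (fun hjj => hjA (hjj ▸ h')) h'
  · refine Finset.card_lt_card (Finset.ssubset_iff_of_subset (fun j' h' => ?_) |>.2 ⟨j, ?_, ?_⟩)
    · rw [Finset.mem_filter] at h' ⊢
      rwa [hne] at h'
      rintro rfl
      rw [hj', ← hunmoved, hmv.on] at h'
      exact hik (by simpa using h'.2.symm)
    · exact Finset.mem_filter.2 ⟨hjn, hunmoved⟩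
    · intro h'
      rw [Finset.mem_filter, hj', ← hunmoved, hmv.on] at h'
      exact hik (by simpa using h'.2.symm)

end SmallJobs

section Migration

variable {F : Type} [Field F] [LinearOrder F] [IsStrictOrderedRing F]
  {m : ℕ} {q : ℕ → F} {n : ℕ}

theorem sum_union_le_add (s t : Finset ℕ) (h : ∀ j ∈ s ∪ t, 0 ≤ q j) :
    ∑ j ∈ s ∪ t, q j ≤ ∑ j ∈ s, q j + ∑ j ∈ t, q j := by
  rw [← Finset.sum_union_inter]
  exact le_add_of_nonneg_right (Finset.sum_nonneg fun j hj =>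
    h j (Finset.mem_union_left _ (Finset.mem_inter.1 hj).1))

theorem sum_biUnion_le_sum (s : Finset (Fin m)) (t : Fin m → Finset ℕ)
    (h : ∀ j ∈ s.biUnion t, 0 ≤ q j) : ∑ j ∈ s.biUnion t, q j ≤ ∑ i ∈ s, ∑ j ∈ t i, q j := by
  classical
  induction s using Finset.induction_on with
  | empty => simp
  | insert a s ha ih =>
    rw [Finset.biUnion_insert] at h ⊢
    rw [Finset.sum_insert ha]
    exact (sum_union_le_add _ _ h).trans (add_le_add_right
      (ih fun j hj => h j (Finset.mem_union_right _ hj)) _)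

/-- The total rounded size of the migrated jobs is bounded in terms of the number of machines with
different big jobs. -/
theorem sum_migrated_le {S ρ σ : Sched m} {lo hi lam U : F} {D : Finset (Fin m)}
    (hq : ∀ j ≤ n, 0 < q j) (hS : ∀ j, (S j).isSome ↔ j < n)
    (hSn : NearLPT q (Finset.range n) lo S) {i₀ : Fin m}
    (hlam : lam = mload q (Finset.range n) S i₀) (hlohi : lo ≤ hi)
    (hstart : LoopStart q n lo lam D S ρ) (h : LoopInv q n lo lam D ρ σ)
    (hhuge : ∀ j < n, hi ≤ q j → σ j = S j) (hloU : lo ≤ U) (hhiU : hi ≤ 2 * U) (hlamU : lam ≤ U)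
    (hU : 0 ≤ U) :
    ∑ j ∈ (Finset.range n).filter (fun j => S j ≠ σ j), q j ≤ 5 * U * D.card := by
  classical
  set B := (Finset.range n).filter (fun j => S j ≠ σ j) with hB
  have hBn : ∀ j ∈ B, j < n ∧ S j ≠ σ j ∧ q j < hi := fun j hj => by
    rw [hB, Finset.mem_filter, Finset.mem_range] at hj
    exact ⟨hj.1, hj.2, by
      by_contra! hij
      exact hj.2 (hhuge j hj.1 hij).symm⟩
  -- The jobs that left a machine in `D`, and the jobs that went to a machine in `D`.
  have hcover : B ⊆ D.biUnion fun k => (B.filter fun j => S j = some k) ∪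
      (jobs n).filter (fun j => σ j = some k ∧ σ j ≠ ρ j ∧ ∃ i, i ∉ D ∧ ρ j = some i) := by
    intro j hj
    obtain ⟨hjn, hne, -⟩ := hBn j hj
    obtain ⟨i, hi⟩ := Option.isSome_iff_exists.1 ((hS j).2 hjn)
    rw [Finset.mem_biUnion]
    by_cases hiD : i ∈ D
    · exact ⟨i, hiD, Finset.mem_union_left _ (Finset.mem_filter.2 ⟨hj, hi⟩)⟩
    · have h1 := hstart.keep j hjn i hi hiD
      have h2 : σ j ≠ ρ j := by
        rw [h1, ← hi]
        exact hne.symm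
      obtain ⟨k, hk, hk'⟩ := h.target j hjn.le i h1 hiD h2
      exact ⟨k, hk, Finset.mem_union_right _ (Finset.mem_filter.2
        ⟨mem_jobs.2 hjn.le, hk', h2, i, hiD, h1⟩)⟩
  have hone : ∀ k, ∑ j ∈ B.filter (fun j => S j = some k), q j ≤ 3 * U := by
    intro k
    rcases (B.filter fun j => S j = some k).eq_empty_or_nonempty with he | ⟨j, hj⟩
    · rw [he, Finset.sum_empty]
      linarith
    rw [Finset.mem_filter] at hj
    obtain ⟨hjn, -, hjhi⟩ := hBn j hj.1
    have h1 : ∑ j ∈ B.filter (fun j => S j = some k), q j ≤ mload q (Finset.range n) S k := by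
      refine Finset.sum_le_sum_of_subset_of_nonneg (fun j' h' => ?_) fun j' h' _ =>
        (hq j' (Finset.mem_range.1 (Finset.mem_filter.1 h').1).le).le
      rw [Finset.mem_filter] at h' ⊢
      exact ⟨Finset.mem_range.2 (hBn j' h'.1).1, h'.2⟩
    by_cases hk : ∃ j ∈ Finset.range n, S j = some k ∧ q j < lo
    · linarith [hSn.small k hk i₀]
    · push Not at hk
      obtain ⟨e, he, hek, hmin⟩ := exists_smallest_on q (J := Finset.range n) (σ := S) (i := k)
        ⟨j, mem_onMachine.2 ⟨Finset.mem_range.2 hjn, hj.2⟩⟩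
      have h2 := hSn.le_of_big (fun j hj => hq j (Finset.mem_range.1 hj).le) hk he hek hmin i₀
      linarith [hmin j (Finset.mem_range.2 hjn) hj.2]
  have hpos : ∀ j ∈ D.biUnion fun k => (B.filter fun j => S j = some k) ∪
      (jobs n).filter (fun j => σ j = some k ∧ σ j ≠ ρ j ∧ ∃ i, i ∉ D ∧ ρ j = some i),
      0 ≤ q j := by
    intro j hj
    obtain ⟨k, -, hj⟩ := Finset.mem_biUnion.1 hj
    rcases Finset.mem_union.1 hj with hj | hj
    · exact (hq j (hBn j (Finset.mem_filter.1 hj).1).1.le).le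
    · exact (hq j (mem_jobs.1 (Finset.mem_filter.1 hj).1)).le
  refine (Finset.sum_le_sum_of_subset_of_nonneg hcover fun j hj _ => hpos j hj).trans ?_
  refine (sum_biUnion_le_sum _ _ hpos).trans ?_
  have hterm : ∀ k ∈ D, ∑ j ∈ (B.filter fun j => S j = some k) ∪
      (jobs n).filter (fun j => σ j = some k ∧ σ j ≠ ρ j ∧ ∃ i, i ∉ D ∧ ρ j = some i), q j
      ≤ 5 * U := by
    intro k hk
    have h1 := sum_union_le_add (q := q) (B.filter fun j => S j = some k)
      ((jobs n).filter (fun j => σ j = some k ∧ σ j ≠ ρ j ∧ ∃ i, i ∉ D ∧ ρ j = some i))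
      fun j hj => hpos j (Finset.mem_biUnion.2 ⟨k, hk, hj⟩)
    linarith [hone k, h.sum_le k]
  refine (Finset.sum_le_sum hterm).trans_eq ?_
  rw [Finset.sum_const, nsmul_eq_mul]
  ring

end Migration

/-! ### One call of the algorithm -/

section Call

variable {F : Type} [Field F] [LinearOrder F] [IsStrictOrderedRing F] [FloorRing F]
  {m : ℕ} {size : F → ℕ} {q : ℕ → F} {n V K : ℕ}

/-- The invariant of the algorithm: `σ` is a schedule of the first `n` jobs, and it is close to an
LPT schedule with respect to the threshold for small jobs that belongs to some LPT schedule of the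
first `n` jobs. -/
structure CallInv (K : ℕ) (q : ℕ → F) (n : ℕ) (σ : Sched m) : Prop where
  isSome : ∀ j, (σ j).isSome ↔ j < n
  near : ∃ (σL : Sched m) (i₀ : Fin m), (∀ j < n, (σL j).isSome) ∧ Stable q (Finset.range n) σL ∧
    (∀ i, mload q (Finset.range n) σL i₀ ≤ mload q (Finset.range n) σL i) ∧
    NearLPT q (Finset.range n) (lowThreshold K
      (mload q (Finset.range n) σL i₀ + mload q (Finset.range n) σL i₀)) σ

theorem CallInv.congr {q' : ℕ → F} {σ : Sched m} (h : CallInv K q n σ)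
    (hq : ∀ j < n, q j = q' j) : CallInv K q' n σ := by
  have hq' : ∀ j ∈ Finset.range n, q j = q' j := fun j hj => hq j (Finset.mem_range.1 hj)
  obtain ⟨σL, i₀, h1, h2, h3, h4⟩ := h.near
  have hl : ∀ i, mload q (Finset.range n) σL i = mload q' (Finset.range n) σL i :=
    mload_congr_fun hq' fun _ _ => rfl
  refine ⟨h.isSome, σL, i₀, h1, h2.congr hq' fun _ _ => rfl, fun i => ?_, ?_⟩
  · rw [← hl, ← hl]
    exact h3 i
  · rw [← hl]
    exact h4.congr hq'

theorem callInv_zero (hm : 0 < m) : CallInv K q 0 (emptySched m) := by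
  refine ⟨fun j => by simp [emptySched], emptySched m, ⟨0, hm⟩, by simp, ?_, fun i => ?_, ?_, ?_⟩
  · exact fun j hj => by simp at hj
  · simp [mload]
  · exact fun j hj => absurd (mem_atLeast.1 hj).1 (by simp)
  · rintro i ⟨j, hj, -⟩
    simp at hj

/-- Bounds on all numbers that occur in a call of the algorithm. -/
structure CallBound (m : ℕ) (size : F → ℕ) (K : ℕ) (p : ℕ → F) (n V : ℕ) : Prop where
  sum : SumBound m size (fun j => rounded K (p j)) n V
  n_le : n + 2 ≤ V
  round : ∀ j ≤ n, RoundBound size K (p j) V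
  threshold : ∀ s ⊆ jobs n,
    ThresholdBound size K (∑ j ∈ s, rounded K (p j) + ∑ j ∈ s, rounded K (p j)) V
  add_low : ∀ s ⊆ jobs n, ∀ t ⊆ jobs n, size (∑ j ∈ s, rounded K (p j) + lowThreshold K
    (∑ j ∈ t, rounded K (p j) + ∑ j ∈ t, rounded K (p j))) ≤ V

/-- An LPT schedule has fewer than `m` huge jobs. -/
theorem card_huge_lt {σL : Sched m} {i₀ : Fin m} (hq : ∀ j ≤ n, 0 < q j)
    (hs : ∀ j, (σL j).isSome ↔ j ≤ n) (hL : Stable q (jobs n) σL) :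
    (atLeast q (jobs n) (highThreshold
      (mload q (jobs n) σL i₀ + mload q (jobs n) σL i₀))).card < m := by
  set τ := mload q (jobs n) σL i₀
  have hmem : ∀ j ∈ atLeast q (jobs n) (highThreshold (τ + τ)), j ≤ n ∧ τ + τ ≤ q j :=
    fun j hj => by
      rw [mem_atLeast, mem_jobs] at hj
      exact ⟨hj.1, (le_highThreshold _).trans hj.2⟩
  refine Stable.card_lt (hL.atLeast _) (i₀ := i₀) (fun j hj => hq j (hmem j hj).1) (fun j hj hi => ?_)
    fun j hj => (hs j).2 (hmem j hj).1
  obtain ⟨h1, h2⟩ := hmem j hj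
  have h3 : q j ≤ τ := Finset.single_le_sum (f := q)
    (fun j hj => (hq j (mem_jobs.1 (Finset.mem_filter.1 hj).1)).le)
    (Finset.mem_filter.2 ⟨mem_jobs.2 h1, hi⟩)
  linarith [hq j h1]

/-- The minimum load of any assignment is at most twice that of an LPT schedule. -/
theorem le_two_mul_of_stable {σL τ : Sched m} {i₀ : Fin m} {T : F} (hq : ∀ j ≤ n, 0 < q j)
    (hs : ∀ j, (σL j).isSome ↔ j ≤ n) (hL : Stable q (jobs n) σL)
    (hτ : ∀ i, T ≤ mload q (jobs n) τ i) :
    T ≤ mload q (jobs n) σL i₀ + mload q (jobs n) σL i₀ := by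
  have h := cover_bound (σ := σL) (W := mload q (jobs n) σL i₀) (T := T) (i₀ := i₀) (jobs n)
    Finset.univ Finset.univ τ rfl (fun j hj => hq j (mem_jobs.1 hj)) (fun j hj => by
      obtain ⟨i, hi⟩ := Option.isSome_iff_exists.1 ((hs j).2 (mem_jobs.1 hj))
      exact ⟨i, Finset.mem_univ i, hi⟩) (Finset.mem_univ _) le_rfl
    (fun i _ => Or.inr fun j hj _ => hL j hj) fun i _ => hτ i
  rw [Finset.card_univ, Fintype.card_fin] at h
  have hm : (1 : F) ≤ m := by exact_mod_cast i₀.pos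
  have h0 : 0 ≤ mload q (jobs n) σL i₀ :=
    mload_nonneg (fun j hj => (hq j (mem_jobs.1 hj)).le) _ _
  by_contra! hlt
  nlinarith

/-- The final loop. -/
theorem rebalance_spec (h : SumBound m size q n V) (hm : 0 < m) (hn : n + 2 ≤ V) {lo : F}
    (hlo : size lo ≤ V) (hadd : ∀ s ⊆ jobs n, size (∑ j ∈ s, q j + lo) ≤ V)
    (hq : ∀ j ≤ n, 0 < q j) {lam : F} {D : Finset (Fin m)} {ρ : Sched m}
    (hρ : LoopInv q n lo lam D ρ ρ) :
    Prog.Spec V 27 (Prog.loop (rebalanceStep size q n lo) ρ) (fun σ => LoopInv q n lo lam D ρ σ ∧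
      ∀ i, HasSmall q n lo σ i → ∀ i', mload q (jobs n) σ i ≤ mload q (jobs n) σ i' + lo) := by
  refine Prog.Spec.loop (k := 25) (I := LoopInv q n lo lam D ρ)
    (μ := fun σ => ((jobs n).filter fun j => σ j = ρ j).card) h.le_V (fun σ hσ =>
      (rebalanceStep_spec h hm hlo hadd σ).mono ?_) hρ ?_
  · rintro ⟨σ', b⟩ (⟨h1, h2, h3⟩ | ⟨h1, j, i, k, h2, h3⟩)
    · simp only at h2
      subst h2
      exact Or.inl ⟨h1, hσ, h3⟩
    · simp only at h3
      subst h3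
      exact Or.inr ⟨h1, hσ.move hq h2⟩
  · have := Finset.card_filter_le (jobs n) fun j => ρ j = ρ j
    rw [Finset.card_range] at this
    omega

/-- A call of the algorithm terminates in polynomial time, preserves the invariant, and migrates
jobs of total rounded size `O((log K) K ^ 3)` times the size of the new job. -/
theorem onlineLPT_spec {p : ℕ → F} (hp : ∀ j, 0 < p j) (hm : 0 < m) (hK : 2 ≤ K)
    (h : CallBound m size K p n V) {S : Sched m}
    (hS : CallInv K (fun j => rounded K (p j)) n S) :
    Prog.Spec V 38 (onlineLPT size K p n S) (fun σ =>
      CallInv K (fun j => rounded K (p j)) (n + 1) σ ∧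
      ∑ j ∈ (Finset.range n).filter (fun j => S j ≠ σ j), rounded K (p j)
        ≤ 10 * (K : F) ^ 2 * (((1 + Nat.clog 2 K) * K : ℕ) + 1) * rounded K (p n)) := by
  have hV := h.sum.le_V
  have hK1 : 1 ≤ K := by omega
  have hKF : (2 : F) ≤ K := by exact_mod_cast hK
  refine (roundAll_spec hV h.sum.n_le h.round).bind hV (by norm_num : 15 ≤ 37) fun q hqp => ?_
  have hqs : ∀ s ⊆ jobs n, ∑ j ∈ s, q j = ∑ j ∈ s, rounded K (p j) := fun s hs =>
    Finset.sum_congr rfl fun j hj => hqp j (mem_jobs.1 (hs hj))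
  have hq : ∀ j ≤ n, 0 < q j := fun j hj => by
    rw [hqp j hj]
    exact rounded_pos (hp j)
  have hq0 : ∀ j ∈ jobs n, 0 ≤ q j := fun j hj => (hq j (mem_jobs.1 hj)).le
  have hqr : ∀ j ∈ Finset.range n, 0 < q j := fun j hj => hq j (Finset.mem_range.1 hj).le
  have hsb : SumBound m size q n V := ⟨hV, h.sum.m_le, h.sum.n_le, fun s hs => by
    rw [hqs s hs]
    exact h.sum.sum_le s hs⟩
  have hS' : CallInv K q n S := hS.congr fun j hj => (hqp j hj.le).symm
  refine (lpt_spec hsb hm hq0).bind hV (by norm_num : 23 ≤ 36) ?_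
  rintro σL ⟨hLs, hL⟩
  refine (pickLeast_spec hsb hm (by simp) σL).bind hV (by norm_num : 17 ≤ 35) ?_
  rintro i₀ ⟨hi₀, -⟩
  refine (load_spec hsb σL i₀).bind hV (by norm_num : 7 ≤ 34) ?_
  rintro _ rfl
  set τ := mload q (jobs n) σL i₀ with hτ
  have hτ0 : 0 ≤ τ := mload_nonneg hq0 _ _
  refine (Prog.Spec.add hV (hsb.mload_le σL i₀) (hsb.mload_le σL i₀)).bind hV
    (by norm_num : 5 ≤ 33) ?_
  rintro _ rfl
  have hτsum : τ = ∑ j ∈ (jobs n).filter (fun j => σL j = some i₀), rounded K (p j) :=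
    hqs _ (Finset.filter_subset _ _)
  have hth : ThresholdBound size K (τ + τ) V := by
    rw [hτsum]
    exact h.threshold _ (Finset.filter_subset _ _)
  set lo := lowThreshold K (τ + τ) with hlo
  set hi := highThreshold (τ + τ) with hhi
  have hadd : ∀ s ⊆ jobs n, size (∑ j ∈ s, q j + lo) ≤ V := fun s hs => by
    rw [hqs s hs, hlo, hτsum]
    exact h.add_low s hs _ (Finset.filter_subset _ _)
  have hlo0 : 0 ≤ lo := lowThreshold_nonneg _
  have hlohi : lo ≤ hi := lowThreshold_le_highThreshold hK1 _
  -- The threshold for small jobs never decreases.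
  have hnear : NearLPT q (Finset.range n) lo S := by
    obtain ⟨σL', i', h1, h2, h3, h4⟩ := hS'.near
    refine h4.mono hqr (lowThreshold_mono hK1 ?_)
    obtain ⟨i, hi⟩ := (dominated_of_stable (Finset.range n) (jobs n)
      (Finset.range_subset_range.2 n.le_succ) (fun j hj => hq j (mem_jobs.1 hj)) h2 hL
      (fun j hj => h1 j (Finset.mem_range.1 hj))
      fun j hj => (hLs j).2 (mem_jobs.1 hj)).exists_le i₀
    have := h3 i
    exact add_le_add (this.trans hi) (this.trans hi)
  have hlams := Finset.exists_min_image (Finset.univ : Finset (Fin m))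
    (mload q (Finset.range n) S) ⟨i₀, Finset.mem_univ _⟩
  obtain ⟨i₁, -, hi₁⟩ := hlams
  set lam := mload q (Finset.range n) S i₁ with hlam
  have hlam0 : 0 ≤ lam := mload_nonneg (fun j hj => (hqr j hj).le) _ _
  have hlamU : lam ≤ τ + τ := le_two_mul_of_stable hq hLs hL (τ := S) fun i =>
    (hi₁ i (Finset.mem_univ i)).trans
      (mload_mono (Finset.range_subset_range.2 n.le_succ) hq0 S i)
  have hstab : ∀ x, lo ≤ x → Stable q (atLeast q (Finset.range n) x) S := fun x hx => by
    have := hnear.stable.atLeast x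
    rwa [atLeast_atLeast hx] at this
  refine (thresholds_spec hV hth).bind hV (by norm_num : 19 ≤ 32) ?_
  rintro _ rfl
  refine (phase_spec hsb hm hq0 (p := fun j => hi ≤ q j) (fun j hj =>
    Prog.Spec.le hV hth.size_high (hsb.size_le hj)) hth.size_high S
    (st := (emptySched m, [])) (List.nil_sublist _)).bind hV (by norm_num : 26 ≤ 31) fun st₀ hst₀ => ?_
  obtain ⟨e1, e2, e3⟩ := huge_phase hS'.isSome (hstab hi hlohi) hq (card_huge_lt hq hLs hL) hst₀
  refine (phases_spec hsb hm hK1 hth.size_big hth.length hq (fun j hj => by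
    rw [hqp j hj]
    exact exists_rounded_eq hK1 (hp j)) hS'.isSome (hstab lo le_rfl) e1 e2 e3).bind hV
    (by norm_num : 28 ≤ 30) ?_
  rintro st ⟨f1, f2, f3⟩
  refine (Prog.Spec.filter (p := fun j => q j < lo) hV hsb.range_le fun j hj =>
    Prog.Spec.lt hV (hsb.size_le (Nat.lt_succ_iff.1 (List.mem_range.1 hj))) hth.size_low).bind hV
    (by norm_num : 7 ≤ 29) fun small hsmall => ?_
  refine (keep_spec hV (hsb.sublist_le f1.sublist) (hsb.sublist_range_le hsmall.1) S st.1).bind hV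
    (by norm_num : 6 ≤ 28) fun σ₁ hσ₁ => ?_
  refine (scheduleRest_spec hsb hm hq0 (pref := []) (by simp) (List.Sublist.refl _) σ₁).bind hV
    (by norm_num : 23 ≤ 27) ?_
  rintro ρ ⟨rest, hrest, hρ⟩
  obtain ⟨g1, g2⟩ := loopStart_of_phases f1 hS'.isSome hnear hq hlam
    (fun i => hi₁ i (Finset.mem_univ i)) (fun j => by
      rw [hsmall.2, List.mem_range, Nat.lt_succ_iff]) hσ₁ (fun j => by
      rw [hrest, List.mem_range, Nat.lt_succ_iff]) hρ
  refine (rebalance_spec hsb hm h.n_le hth.size_low hadd hq (g1.inv hlam0 hlo0)).mono ?_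
  rintro σ ⟨hσ, hend⟩
  have hbig : ∀ j ≤ n, lo ≤ q j → σ j = st.1 j := fun j hj hj' => by
    rw [hσ.big j hj hj', g2 j hj hj']
  refine ⟨CallInv.congr (q := q) ⟨fun j => ?_, σL, i₀, fun j hj => ?_, hL, hi₀, ?_, ?_⟩
    fun j hj => hqp j (Nat.lt_succ_iff.1 hj), ?_⟩
  · rw [hσ.isSome, Nat.lt_succ_iff]
  · exact (hLs j).2 (Nat.lt_succ_iff.1 hj)
  · refine f1.stable.congr (fun _ _ => rfl) fun j hj => ?_
    rw [mem_atLeast, mem_jobs] at hj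
    exact (hbig j hj.1 hj.2).symm
  · rintro i ⟨j, hj, hji, hjlo⟩ i'
    exact hend i ⟨j, mem_jobs.1 hj, hji, hjlo⟩ i'
  · have hU0 : 0 ≤ τ + τ := by linarith
    have hloU : lo ≤ τ + τ := by
      have := mul_lowThreshold_le (F := F) hK1 hU0
      nlinarith
    have key := sum_migrated_le hq hS'.isSome hnear hlam hlohi g1 hσ (fun j hj hj' => by
      rw [hbig j hj.le (hlohi.trans hj'), f2 j hj hj']) hloU (highThreshold_le hU0) hlamU hU0
    rw [← hqp n le_rfl, ← Finset.sum_congr rfl fun j hj =>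
      hqp j (Finset.mem_range.1 (Finset.mem_filter.1 hj).1).le]
    refine key.trans ?_
    have hqn := hq n le_rfl
    have h1 : lo / K * (st.2.toFinset.card : F) ≤ ((bigSizes K (τ + τ)).length + 1) * (2 * q n) := by
      refine f3.trans (mul_le_mul_of_nonneg_left ?_ (by positivity))
      split_ifs
      · exact le_rfl
      · positivity
    have h2 : ((bigSizes K (τ + τ)).length : F) ≤ ((1 + Nat.clog 2 K) * K : ℕ) := by
      have h3 : (bigSizes K (τ + τ)).length ≤ (1 + Nat.clog 2 K) * K := by
        by_cases hU : 0 < τ + τ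
        · exact (length_bigSizes_le _).trans (Nat.mul_le_mul_right _ (count_exponents_le hK1 hU))
        · rw [bigSizes, if_neg hU]
          exact Nat.zero_le _
      exact_mod_cast h3
    have h3 : τ + τ ≤ (K : F) ^ 2 * (lo / K) := by
      have := le_mul_lowThreshold (F := F) hK1 (UB := τ + τ)
      have e : (K : F) ^ 2 * (lo / K) = K * lo := by
        field_simp
      rwa [e]
    calc 5 * (τ + τ) * (st.2.toFinset.card : F)
        ≤ 5 * ((K : F) ^ 2 * (lo / K)) * st.2.toFinset.card := by gcongr
      _ = 5 * (K : F) ^ 2 * (lo / K * st.2.toFinset.card) := by ring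
      _ ≤ 5 * (K : F) ^ 2 * (((bigSizes K (τ + τ)).length + 1) * (2 * q n)) := by gcongr
      _ ≤ 5 * (K : F) ^ 2 * ((((1 + Nat.clog 2 K) * K : ℕ) + 1) * (2 * q n)) := by gcongr
      _ = _ := by ring

end Call

end OnlineLPT

/-! ### Lengths of rational numbers -/

section BitSize

theorem bitSize_le_of_eq_div {x : ℚ} {a : ℤ} {b s t : ℕ} (hb : 0 < b) (hx : x = a / b)
    (ha : a.natAbs < 2 ^ s) (hbt : b < 2 ^ t) : bitSize x ≤ s + t := by
  have hb' : (b : ℤ) ≠ 0 := by exact_mod_cast hb.ne'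
  have hx' : x = (a : ℚ) / ((b : ℤ) : ℚ) := by rw [hx]; push_cast; rfl
  have h1 : x.num.natAbs ≤ a.natAbs := by
    rcases eq_or_ne a 0 with rfl | ha0
    · rw [hx]
      simp
    · refine Nat.le_of_dvd (Int.natAbs_pos.2 ha0) (Int.natAbs_dvd_natAbs.2 ?_)
      rw [hx', ← Rat.divInt_eq_div]
      exact Rat.num_dvd a hb'
  have h2 : x.den ≤ b := by
    refine Nat.le_of_dvd hb ?_
    have := Rat.den_dvd a b
    rw [Rat.divInt_eq_div, ← hx'] at this
    exact_mod_cast this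
  exact add_le_add (Nat.size_le.2 (h1.trans_lt ha)) (Nat.size_le.2 (h2.trans_lt hbt))

theorem one_le_bitSize (x : ℚ) : 1 ≤ bitSize x := by
  have := Nat.size_pos.2 x.den_pos
  unfold bitSize
  omega

theorem bitSize_natCast_le (k : ℕ) : bitSize (k : ℚ) ≤ k + 1 := by
  have h1 := bitSize_le_of_eq_div (x := (k : ℚ)) (a := k) (b := 1) (s := k) (t := 1) one_pos
    (by simp) (by simpa using Nat.lt_two_pow_self) (by norm_num)
  exact h1

theorem bitSize_mul_le (x y : ℚ) : bitSize (x * y) ≤ bitSize x + bitSize y := by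
  have h := bitSize_le_of_eq_div (x := x * y) (a := x.num * y.num) (b := x.den * y.den)
    (s := x.num.natAbs.size + y.num.natAbs.size) (t := x.den.size + y.den.size)
    (mul_pos x.den_pos y.den_pos) ?_ ?_ ?_
  · unfold bitSize at h ⊢
    omega
  · push_cast
    rw [mul_div_mul_comm, Rat.num_div_den, Rat.num_div_den]
  · rw [Int.natAbs_mul, pow_add]
    exact mul_lt_mul'' (Nat.lt_size_self _) (Nat.lt_size_self _) (Nat.zero_le _) (Nat.zero_le _)
  · rw [pow_add]
    exact mul_lt_mul'' (Nat.lt_size_self _) (Nat.lt_size_self _) (Nat.zero_le _) (Nat.zero_le _)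

theorem bitSize_inv_le (x : ℚ) : bitSize x⁻¹ ≤ bitSize x := by
  rcases eq_or_ne x 0 with rfl | hx
  · simp
  have hnum : x.num ≠ 0 := Rat.num_ne_zero.2 hx
  have h := bitSize_le_of_eq_div (x := x⁻¹) (a := x.num.sign * x.den) (b := x.num.natAbs)
    (s := x.den.size) (t := x.num.natAbs.size) (Int.natAbs_pos.2 hnum) ?_ ?_
    (Nat.lt_size_self _)
  · unfold bitSize at h ⊢
    omega
  · have h1 : ((x.num.natAbs : ℕ) : ℚ) = x.num.sign * x.num := by
      rw [← Int.cast_mul, Int.sign_mul_self_eq_abs, Int.abs_eq_natAbs, Int.cast_natCast]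
    have h2 : (x.num.sign : ℚ) ≠ 0 := by
      exact_mod_cast (Int.sign_eq_zero_iff_zero.not).2 hnum
    rw [h1]
    push_cast
    rw [mul_div_mul_left _ _ h2]
    nth_rewrite 1 [← Rat.num_div_den x]
    rw [inv_div]
  · rw [Int.natAbs_mul, Int.natAbs_sign_of_ne_zero hnum, one_mul, Int.natAbs_natCast]
    exact Nat.lt_size_self _

theorem bitSize_div_le (x y : ℚ) : bitSize (x / y) ≤ bitSize x + bitSize y := by
  rw [div_eq_mul_inv]
  exact (bitSize_mul_le x y⁻¹).trans (Nat.add_le_add_left (bitSize_inv_le y) _)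

theorem bitSize_neg (x : ℚ) : bitSize (-x) = bitSize x := by
  unfold bitSize
  rw [Rat.num_neg_eq_neg_num, Rat.den_neg_eq_den, Int.natAbs_neg]

theorem bitSize_add_le (x y : ℚ) : bitSize (x + y) ≤ 2 * (bitSize x + bitSize y) + 1 := by
  have hx := x.den_pos
  have hy := y.den_pos
  have h := bitSize_le_of_eq_div (x := x + y) (a := x.num * y.den + x.den * y.num)
    (b := x.den * y.den) (s := bitSize x + bitSize y + 1) (t := x.den.size + y.den.size)
    (mul_pos hx hy) ?_ ?_ ?_
  · unfold bitSize at h ⊢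
    omega
  · have h1 : (x.den : ℚ) ≠ 0 := by exact_mod_cast hx.ne'
    have h2 : (y.den : ℚ) ≠ 0 := by exact_mod_cast hy.ne'
    push_cast
    rw [← div_add_div _ _ h1 h2, Rat.num_div_den, Rat.num_div_den]
  · have h1 : x.num.natAbs * y.den < 2 ^ (bitSize x + bitSize y) :=
      calc x.num.natAbs * y.den < 2 ^ x.num.natAbs.size * 2 ^ y.den.size :=
            mul_lt_mul'' (Nat.lt_size_self _) (Nat.lt_size_self _) (Nat.zero_le _) (Nat.zero_le _)
        _ ≤ _ := by
            rw [← pow_add]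
            exact Nat.pow_le_pow_right two_pos (by unfold bitSize; omega)
    have h2 : x.den * y.num.natAbs < 2 ^ (bitSize x + bitSize y) :=
      calc x.den * y.num.natAbs < 2 ^ x.den.size * 2 ^ y.num.natAbs.size :=
            mul_lt_mul'' (Nat.lt_size_self _) (Nat.lt_size_self _) (Nat.zero_le _) (Nat.zero_le _)
        _ ≤ _ := by
            rw [← pow_add]
            exact Nat.pow_le_pow_right two_pos (by unfold bitSize; omega)
    refine (Int.natAbs_add_le _ _).trans_lt ?_
    rw [Int.natAbs_mul, Int.natAbs_mul, Int.natAbs_natCast, Int.natAbs_natCast, pow_succ]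
    omega
  · rw [pow_add]
    exact mul_lt_mul'' (Nat.lt_size_self _) (Nat.lt_size_self _) (Nat.zero_le _) (Nat.zero_le _)

theorem bitSize_sub_le (x y : ℚ) : bitSize (x - y) ≤ 2 * (bitSize x + bitSize y) + 1 := by
  have := bitSize_add_le x (-y)
  rwa [bitSize_neg, ← sub_eq_add_neg] at this

theorem bitSize_two_zpow_le (e : ℤ) : bitSize ((2 : ℚ) ^ e) ≤ e.natAbs + 2 := by
  have key : ∀ k : ℕ, bitSize ((2 : ℚ) ^ k) ≤ k + 2 := fun k => by
    refine (bitSize_le_of_eq_div (a := 2 ^ k) (b := 1) (s := k + 1) (t := 1) one_pos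
      (by simp) ?_ (by norm_num)).trans (by omega)
    rw [Int.natAbs_pow]
    exact Nat.pow_lt_pow_right one_lt_two (Nat.lt_succ_self k)
  rcases Int.natAbs_eq e with h | h
  · rw [h, zpow_natCast, Int.natAbs_natCast]
    exact key _
  · rw [h, zpow_neg, zpow_natCast, Int.natAbs_neg, Int.natAbs_natCast]
    exact (bitSize_inv_le _).trans (key _)

theorem lt_two_pow_bitSize {x : ℚ} (hx : 0 < x) : x < 2 ^ bitSize x := by
  have h1 : (x.num.natAbs : ℚ) < 2 ^ bitSize x := by
    have h2 : x.num.natAbs < 2 ^ bitSize x := (Nat.lt_size_self _).trans_le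
      (Nat.pow_le_pow_right two_pos (by unfold bitSize; omega))
    exact_mod_cast h2
  refine lt_of_le_of_lt ?_ h1
  have h3 : (1 : ℚ) ≤ x.den := by exact_mod_cast x.den_pos
  have h4 : ((x.num.natAbs : ℕ) : ℚ) = x.num := by
    rw [← Int.cast_natCast, Int.natAbs_of_nonneg (Rat.num_nonneg.2 hx.le)]
  rw [h4]
  nth_rewrite 1 [← Rat.num_div_den x]
  refine div_le_self ?_ h3
  exact_mod_cast (Rat.num_nonneg.2 hx.le)

theorem two_zpow_neg_bitSize_lt {x : ℚ} (hx : 0 < x) : (2 : ℚ) ^ (-(bitSize x : ℤ)) < x := by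
  have h1 := lt_two_pow_bitSize (inv_pos.2 hx)
  have h2 : (2 : ℚ) ^ bitSize x⁻¹ ≤ 2 ^ bitSize x :=
    pow_le_pow_right₀ one_le_two (bitSize_inv_le x)
  rw [zpow_neg, zpow_natCast]
  exact inv_lt_of_inv_lt₀ hx (h1.trans_le h2)

theorem natAbs_log_le_bitSize {x : ℚ} (hx : 0 < x) : (Int.log 2 x).natAbs ≤ bitSize x := by
  have h1 : (2 : ℚ) ^ Int.log 2 x ≤ x := by
    simpa using Int.zpow_log_le_self (b := 2) one_lt_two hx
  have h2 : x < (2 : ℚ) ^ (Int.log 2 x + 1) := by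
    simpa using Int.lt_zpow_succ_log_self (b := 2) one_lt_two x
  have h3 := (zpow_lt_zpow_iff_right₀ (one_lt_two : (1 : ℚ) < 2)).1
    ((two_zpow_neg_bitSize_lt hx).trans h2)
  have h4 : (2 : ℚ) ^ Int.log 2 x < 2 ^ (bitSize x : ℤ) := by
    rw [zpow_natCast]
    exact h1.trans_lt (lt_two_pow_bitSize hx)
  have h5 := (zpow_lt_zpow_iff_right₀ (one_lt_two : (1 : ℚ) < 2)).1 h4
  omega

theorem natAbs_clog_le_bitSize {x : ℚ} (hx : 0 < x) : (Int.clog 2 x).natAbs ≤ bitSize x := by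
  have h1 : (2 : ℚ) ^ (Int.clog 2 x - 1) < x := by
    simpa using Int.zpow_pred_clog_lt_self (b := 2) one_lt_two hx
  have h2 : x ≤ (2 : ℚ) ^ Int.clog 2 x := by
    simpa using Int.self_le_zpow_clog (b := 2) one_lt_two x
  have h3 := (zpow_lt_zpow_iff_right₀ (one_lt_two : (1 : ℚ) < 2)).1
    ((two_zpow_neg_bitSize_lt hx).trans_le h2)
  have h4 : (2 : ℚ) ^ (Int.clog 2 x - 1) < 2 ^ (bitSize x : ℤ) := by
    rw [zpow_natCast]
    exact h1.trans (lt_two_pow_bitSize hx)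
  have h5 := (zpow_lt_zpow_iff_right₀ (one_lt_two : (1 : ℚ) < 2)).1 h4
  omega

end BitSize

namespace OnlineLPT

section RationalBounds

variable {K N V : ℕ}

theorem roundBound_rat {x : ℚ} (hx : 0 < x) (hxN : bitSize x ≤ N) (hK : 1 ≤ K) (hKN : K ≤ N)
    (hV : 1000 * (N + 1) ≤ V) : RoundBound bitSize K x V := by
  have h1 := natAbs_log_le_bitSize hx
  have h2 := bitSize_two_zpow_le (Int.log 2 x)
  have h3 := bitSize_natCast_le K
  have h4 := bitSize_div_le ((2 : ℚ) ^ Int.log 2 x) K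
  have h5 := bitSize_sub_le x ((2 : ℚ) ^ Int.log 2 x)
  have h6 := bitSize_div_le (x - (2 : ℚ) ^ Int.log 2 x) ((2 : ℚ) ^ Int.log 2 x / K)
  obtain ⟨k, hk, hkx⟩ : ∃ k : ℕ, k < K ∧
      ⌊(x - (2 : ℚ) ^ Int.log 2 x) / ((2 : ℚ) ^ Int.log 2 x / K)⌋ = (k : ℤ) :=
    exists_floor_eq hK hx
  have h7 := bitSize_natCast_le k
  have h8 := bitSize_mul_le (k : ℚ) ((2 : ℚ) ^ Int.log 2 x / K)
  refine ⟨?_, ?_, ?_, ?_, ?_, ?_, ?_, ?_, ?_⟩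
  any_goals omega
  · rw [hkx, Int.cast_natCast]
    omega
  · rw [hkx, Int.cast_natCast]
    omega

theorem bitSize_lowThreshold_le {UB : ℚ} (hU : bitSize UB ≤ 24 * N + 1) (hK : 1 ≤ K)
    (hKN : K ≤ N) : bitSize (lowThreshold K UB) ≤ 25 * N + 4 := by
  unfold lowThreshold
  split_ifs with hpos
  · have hKQ : (0 : ℚ) < K := by exact_mod_cast hK
    have h1 := natAbs_clog_le_bitSize (div_pos hpos hKQ)
    have h2 := bitSize_natCast_le K
    have h3 := bitSize_div_le UB K
    have h4 := bitSize_two_zpow_le (Int.clog 2 (UB / (K : ℚ)))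
    omega
  · have := bitSize_natCast_le 0
    rw [Nat.cast_zero] at this
    omega

theorem thresholdBound_rat {UB : ℚ} (hU : bitSize UB ≤ 24 * N + 1) (hK : 1 ≤ K) (hKN : K ≤ N)
    (hV : 1000 * (N + 1) ^ 2 ≤ V) : ThresholdBound bitSize K UB V := by
  have hV' : 1000 * (N + 1) ≤ V := le_trans (by nlinarith) hV
  have h0 : bitSize (0 : ℚ) ≤ 1 := by simpa using bitSize_natCast_le 0
  have hKb := bitSize_natCast_le K
  have hdiv := bitSize_div_le UB K
  by_cases hpos : 0 < UB
  swap
  · have hUK : UB / K ≤ 0 := div_nonpos_of_nonpos_of_nonneg (not_lt.1 hpos) (Nat.cast_nonneg K)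
    have hc := Int.clog_of_right_le_zero 2 (not_lt.1 hpos)
    have hl := Int.clog_of_right_le_zero 2 hUK
    refine ⟨by omega, by omega, by omega, by omega, by omega, by omega, by omega, by omega,
      fun i h1 h2 => by omega, ?_, ?_, fun x hx => ?_, ?_⟩
    · rw [lowThreshold, if_neg hpos]
      omega
    · rw [highThreshold, if_neg hpos]
      omega
    · exact absurd (mem_bigSizes.1 hx).1 hpos
    · rw [bigSizes, if_neg hpos]
      exact Nat.zero_le _
  have hKQ : (0 : ℚ) < K := by exact_mod_cast hK
  have hl := natAbs_clog_le_bitSize (div_pos hpos hKQ)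
  have hc := natAbs_clog_le_bitSize hpos
  have hcount := count_exponents_le hK hpos
  have hclog : Nat.clog 2 K ≤ K := Nat.clog_le_of_le_pow Nat.lt_two_pow_self.le
  have hi : ∀ i : ℤ, Int.clog 2 (UB / (K : ℚ)) ≤ i → i < Int.clog 2 UB → i.natAbs ≤ 25 * N + 2 := fun i h1 h2 => by omega
  have hhigh := bitSize_two_zpow_le (Int.clog 2 UB)
  have hpow : ∀ i : ℤ, Int.clog 2 (UB / (K : ℚ)) ≤ i → i < Int.clog 2 UB → bitSize ((2 : ℚ) ^ i) ≤ 25 * N + 4 ∧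
      bitSize ((2 : ℚ) ^ i / K) ≤ 26 * N + 5 ∧
      ∀ k : ℕ, k < K → bitSize (k : ℚ) ≤ N + 1 ∧
        bitSize ((k : ℚ) * ((2 : ℚ) ^ i / K)) ≤ 27 * N + 6 := by
    intro i h1 h2
    have h3 := hi i h1 h2
    have h4 := bitSize_two_zpow_le i
    have h5 := bitSize_div_le ((2 : ℚ) ^ i) K
    refine ⟨by omega, by omega, fun k hk => ?_⟩
    have h6 := bitSize_natCast_le k
    have h7 := bitSize_mul_le (k : ℚ) ((2 : ℚ) ^ i / K)
    exact ⟨by omega, by omega⟩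
  refine ⟨by omega, by omega, by omega, by omega, by omega, by omega, by omega, by omega,
    fun i h1 h2 => ?_, ?_, ?_, fun x hx => ?_, ?_⟩
  · have h3 := hi i h1 h2
    obtain ⟨h4, h5, h6⟩ := hpow i h1 h2
    refine ⟨by omega, by omega, by omega, fun k hk => ?_⟩
    have := h6 k hk
    exact ⟨by omega, by omega⟩
  · have := bitSize_lowThreshold_le hU hK hKN
    omega
  · rw [highThreshold, if_pos hpos]
    omega
  · obtain ⟨-, i, k, h1, h2, h3, rfl⟩ := mem_bigSizes.1 hx
    obtain ⟨h4, h5, h6⟩ := hpow i h1 h2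
    have h7 := h6 k h3
    have h8 := bitSize_add_le ((2 : ℚ) ^ i) ((k : ℚ) * ((2 : ℚ) ^ i / K))
    unfold sizeClass
    omega
  · refine (length_bigSizes_le UB).trans (le_trans ?_ hV)
    calc _ ≤ (N + 1) * (N + 1) := Nat.mul_le_mul (by omega) (by omega)
      _ ≤ 1000 * (N + 1) ^ 2 := by
        rw [← pow_two]
        exact Nat.le_mul_of_pos_left _ (by norm_num)

/-- A sum of rounded sizes has a representation of linear length, since `K 2 ^ N` is a common
denominator. -/
theorem bitSize_sum_rounded_le {p : ℕ → ℚ} (hp : ∀ j, 0 < p j) {n : ℕ} (hn : n + 1 ≤ N)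
    (hpN : ∀ j ≤ n, bitSize (p j) ≤ N) (hK : 1 ≤ K) (hKN : K ≤ N) {s : Finset ℕ}
    (hs : s ⊆ jobs n) : bitSize (∑ j ∈ s, rounded K (p j)) ≤ 6 * N := by
  have hKQ : (0 : ℚ) < K := by exact_mod_cast hK
  have hz : ∀ j ∈ s, ∃ z : ℕ, rounded K (p j) = z / ((K * 2 ^ N : ℕ) : ℚ) := by
    intro j hj
    obtain ⟨k, -, hk⟩ := exists_floor_eq (x := p j) hK (hp j)
    have h1 := natAbs_log_le_bitSize (hp j)
    have h2 := hpN j (mem_jobs.1 (hs hj))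
    rw [rounded, hk, Int.cast_natCast, sizeClass_nat hK]
    set e := Int.log 2 (p j)
    obtain ⟨t, ht⟩ : ∃ t : ℕ, e = (t : ℤ) - N := ⟨(e + N).toNat, by omega⟩
    refine ⟨(K + k) * 2 ^ t, ?_⟩
    rw [ht, zpow_sub₀ two_ne_zero, zpow_natCast, zpow_natCast]
    push_cast
    field_simp
  choose! f hf using hz
  have hsum : ∑ j ∈ s, rounded K (p j) = ((∑ j ∈ s, f j : ℕ) : ℤ) / ((K * 2 ^ N : ℕ) : ℚ) := by
    rw [Finset.sum_congr rfl hf, ← Finset.sum_div]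
    push_cast
    rfl
  have hd : 0 < K * 2 ^ N := by positivity
  have hN2 : N < 2 ^ N := Nat.lt_two_pow_self
  have hd2 : K * 2 ^ N < 2 ^ (2 * N) := by
    rw [two_mul, pow_add]
    exact Nat.mul_lt_mul_of_pos_right (hKN.trans_lt hN2) (by positivity)
  refine (bitSize_le_of_eq_div (s := 4 * N) (t := 2 * N) hd hsum ?_ hd2).trans (by omega)
  have h1 : ∑ j ∈ s, rounded K (p j) ≤ (N : ℚ) * 2 ^ N := by
    have h2 : ∀ j ∈ s, rounded K (p j) ≤ 2 ^ N := fun j hj =>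
      (rounded_le hK _).trans ((lt_two_pow_bitSize (hp j)).le.trans
        (pow_le_pow_right₀ one_le_two (hpN j (mem_jobs.1 (hs hj)))))
    refine (Finset.sum_le_card_nsmul _ _ _ h2).trans ?_
    rw [nsmul_eq_mul]
    have h3 : s.card ≤ N := by
      have := Finset.card_le_card hs
      rw [Finset.card_range] at this
      omega
    have h4 : (s.card : ℚ) ≤ N := by exact_mod_cast h3
    gcongr
  have hd' : (0 : ℚ) < ((K * 2 ^ N : ℕ) : ℚ) := by exact_mod_cast hd
  rw [hsum, div_le_iff₀ hd'] at h1
  have h2 : ∑ j ∈ s, f j ≤ N * 2 ^ N * (K * 2 ^ N) := by exact_mod_cast h1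
  rw [Int.natAbs_natCast]
  calc ∑ j ∈ s, f j ≤ N * 2 ^ N * (K * 2 ^ N) := h2
    _ < (2 ^ N * 2 ^ N) * 2 ^ (2 * N) := by
        refine Nat.mul_lt_mul_of_le_of_lt (Nat.mul_le_mul_right _ hN2.le) hd2 (by positivity)
    _ = 2 ^ (4 * N) := by rw [← pow_add, ← pow_add]; congr 1; omega

theorem callBound_rat {p : ℕ → ℚ} (hp : ∀ j, 0 < p j) {m n : ℕ} (hK : 1 ≤ K) (hKN : K ≤ N)
    (hm : m ≤ N) (hn : n + 1 ≤ N) (hpN : ∀ j ≤ n, bitSize (p j) ≤ N)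
    (hV : 1000 * (N + 1) ^ 2 ≤ V) : CallBound m bitSize K p n V := by
  have hV' : 1000 * (N + 1) ≤ V := le_trans (by nlinarith) hV
  have hsum : ∀ s ⊆ jobs n, bitSize (∑ j ∈ s, rounded K (p j)) ≤ 6 * N := fun s hs =>
    bitSize_sum_rounded_le hp hn hpN hK hKN hs
  have hth : ∀ s ⊆ jobs n, ∀ W, 1000 * (N + 1) ^ 2 ≤ W → ThresholdBound bitSize K
      (∑ j ∈ s, rounded K (p j) + ∑ j ∈ s, rounded K (p j)) W := fun s hs W hW => by
    have h1 := hsum s hs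
    have h2 := bitSize_add_le (∑ j ∈ s, rounded K (p j)) (∑ j ∈ s, rounded K (p j))
    exact thresholdBound_rat (N := N) (by omega) hK hKN hW
  refine ⟨⟨by omega, by omega, by omega, fun s hs => ?_⟩, by omega,
    fun j hj => roundBound_rat (hp j) (hpN j hj) hK hKN hV', fun s hs => hth s hs V hV,
    fun s hs t ht => ?_⟩
  · have := hsum s hs
    omega
  · have h1 := hsum s hs
    have h2 := bitSize_add_le (∑ j ∈ s, rounded K (p j))
      (lowThreshold K (∑ j ∈ t, rounded K (p j) + ∑ j ∈ t, rounded K (p j)))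
    have h3 := hsum t ht
    have h4 := bitSize_add_le (∑ j ∈ t, rounded K (p j)) (∑ j ∈ t, rounded K (p j))
    have h5 := bitSize_lowThreshold_le (N := N) (UB := ∑ j ∈ t, rounded K (p j)
      + ∑ j ∈ t, rounded K (p j)) (by omega) hK hKN
    omega

end RationalBounds

/-! ### Runs of the algorithm -/

section Runs

variable {F : Type} [Field F] [LinearOrder F] [IsStrictOrderedRing F] [FloorRing F]
  {m : ℕ} {size : F → ℕ} {K : ℕ}

/-- The algorithm can be run forever. -/
theorem exists_produces {p : ℕ → F} (hp : ∀ j, 0 < p j) (hm : 0 < m) (hK : 2 ≤ K) {V : ℕ → ℕ}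
    (h : ∀ n, CallBound m size K p n (V n)) (ω : ℕ → ℕ → ℕ) :
    ∃ (S : ℕ → Sched m) (T : ℕ → ℕ), Produces size K p ω S T ∧ ∀ n,
      T n ≤ V n ^ 38 ∧ CallInv K (fun j => rounded K (p j)) n (S n) ∧
      ∑ j ∈ (Finset.range n).filter (fun j => S n j ≠ S (n + 1) j), rounded K (p j)
        ≤ 10 * (K : F) ^ 2 * (((1 + Nat.clog 2 K) * K : ℕ) + 1) * rounded K (p n) := by
  have step : ∀ (n : ℕ) (σ : Sched m), CallInv K (fun j => rounded K (p j)) n σ →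
      ∃ (σ' : Sched m) (t : ℕ) (coins : ℕ → ℕ),
        (onlineLPT size K p n σ).run ⟨0, ω n⟩ = some (σ', ⟨t, coins⟩) ∧ t ≤ V n ^ 38 ∧
        CallInv K (fun j => rounded K (p j)) (n + 1) σ' ∧
        ∑ j ∈ (Finset.range n).filter (fun j => σ j ≠ σ' j), rounded K (p j)
          ≤ 10 * (K : F) ^ 2 * (((1 + Nat.clog 2 K) * K : ℕ) + 1) * rounded K (p n) := by
    intro n σ hσ
    obtain ⟨σ', ⟨t, coins⟩, h1, h2, h3, h4⟩ := onlineLPT_spec hp hm hK (h n) hσ ⟨0, ω n⟩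
    exact ⟨σ', t, coins, h1, by simpa using h2, h3, h4⟩
  choose! f g c hf using step
  let S : ℕ → Sched m := fun n => Nat.rec (emptySched m) (fun n σ => f n σ) n
  have hS : ∀ n, CallInv K (fun j => rounded K (p j)) n (S n) := fun n => by
    induction n with
    | zero => exact callInv_zero hm
    | succ n ih => exact (hf n (S n) ih).2.2.1
  exact ⟨S, fun n => g n (S n), ⟨rfl, fun n => ⟨c n (S n), (hf n (S n) (hS n)).1⟩⟩,
    fun n => ⟨(hf n (S n) (hS n)).2.1, hS n, (hf n (S n) (hS n)).2.2.2⟩⟩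

/-- If numbers are not charged by the length of their representation, some bound exists. -/
theorem exists_callBound (m K : ℕ) (p : ℕ → F) (n : ℕ) :
    ∃ V, CallBound m (fun _ => 0) K p n V := by
  suffices h : ∀ᶠ V in Filter.atTop, CallBound m (fun _ => 0) K p n V from h.exists
  have h1 : ∀ᶠ V in Filter.atTop, ∀ j ∈ jobs n, (Int.log 2 (p j)).natAbs ≤ V :=
    (Filter.eventually_all_finset _).2 fun j _ => Filter.eventually_ge_atTop _
  have h2 : ∀ᶠ V in Filter.atTop, ∀ s ∈ (jobs n).powerset, ThresholdBound (fun _ => 0) K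
      (∑ j ∈ s, rounded K (p j) + ∑ j ∈ s, rounded K (p j)) V := by
    refine (Filter.eventually_all_finset _).2 fun s _ => ?_
    generalize ∑ j ∈ s, rounded K (p j) + ∑ j ∈ s, rounded K (p j) = UB
    filter_upwards [Filter.eventually_ge_atTop K,
      Filter.eventually_ge_atTop (Int.clog 2 UB - Int.clog 2 (UB / K)).toNat,
      Filter.eventually_ge_atTop (Int.clog 2 (UB / K)).natAbs,
      Filter.eventually_ge_atTop (Int.clog 2 UB).natAbs,
      Filter.eventually_ge_atTop (bigSizes K UB).length] with V h1 h2 h3 h4 h5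
    exact ⟨h1, Nat.zero_le _, Nat.zero_le _, Nat.zero_le _, Nat.zero_le _, h2, h3, h4,
      fun i h6 h7 => ⟨by omega, Nat.zero_le _, Nat.zero_le _, fun _ _ =>
        ⟨Nat.zero_le _, Nat.zero_le _⟩⟩, Nat.zero_le _, Nat.zero_le _, fun _ _ => Nat.zero_le _, h5⟩
  filter_upwards [h1, h2, Filter.eventually_ge_atTop 16, Filter.eventually_ge_atTop m,
    Filter.eventually_ge_atTop (n + 2)] with V h1 h2 h3 h4 h5
  exact ⟨⟨h3, h4, by omega, fun _ _ => Nat.zero_le _⟩, h5, fun j hj =>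
    ⟨Nat.zero_le _, Nat.zero_le _, h1 j (mem_jobs.2 hj), Nat.zero_le _, Nat.zero_le _,
      Nat.zero_le _, Nat.zero_le _, Nat.zero_le _, Nat.zero_le _⟩,
    fun s hs => h2 s (Finset.mem_powerset.2 hs), fun _ _ _ _ => Nat.zero_le _⟩

end Runs

/-! ### The three guarantees -/

section Competitive

variable {m K : ℕ} {p : ℕ → ℝ} {n : ℕ}

theorem minLoad_eq (p : ℕ → ℝ) (n : ℕ) (σ : Sched m) :
    minLoad p n σ = ⨅ i, mload p (Finset.range n) σ i := by
  unfold minLoad mload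
  simp only [Finset.sum_filter]

theorem minLoad_nonneg (hp : ∀ j, 0 < p j) (σ : Sched m) : 0 ≤ minLoad p n σ := by
  rw [minLoad_eq]
  exact Real.iInf_nonneg fun i => mload_nonneg (fun j _ => (hp j).le) _ _

/-- The optimum is the minimum load of some assignment. -/
theorem exists_optLoad_eq (hm : 0 < m) (p : ℕ → ℝ) (n : ℕ) :
    ∃ τ : Sched m, ∀ i, optLoad m p n ≤ mload p (Finset.range n) τ i := by
  have : Nonempty (Fin m) := ⟨⟨0, hm⟩⟩
  obtain ⟨f, hf⟩ := exists_eq_ciSup_of_finite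
    (f := fun f : Fin n → Fin m => ⨅ i : Fin m, ∑ j : Fin n, if f j = i then p j else 0)
  refine ⟨fun j => if h : j < n then some (f ⟨j, h⟩) else none, fun i => ?_⟩
  have h1 : optLoad m p n = ⨅ i : Fin m, ∑ j : Fin n, if f j = i then p j else 0 := hf.symm
  rw [h1]
  refine (ciInf_le (Set.finite_range _).bddBelow i).trans_eq ?_
  rw [mload, Finset.sum_filter, Finset.sum_range]
  refine Finset.sum_congr rfl fun j _ => ?_
  simp

/-- The optimum is at least the minimum load of any schedule. -/
theorem le_optLoad (hm : 0 < m) {σ : Sched m} (hσ : ∀ j < n, (σ j).isSome) {t : ℝ}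
    (ht : ∀ i, t ≤ mload p (Finset.range n) σ i) : t ≤ optLoad m p n := by
  have : Nonempty (Fin m) := ⟨⟨0, hm⟩⟩
  refine le_trans ?_ (le_ciSup (f := fun f : Fin n → Fin m =>
    ⨅ i : Fin m, ∑ j : Fin n, if f j = i then p j else 0) (Set.finite_range _).bddAbove
    fun j => (σ j).get (hσ j j.2))
  refine le_ciInf fun i => (ht i).trans_eq ?_
  rw [mload, Finset.sum_filter, Finset.sum_range]
  refine Finset.sum_congr rfl fun j _ => if_congr ?_ rfl rfl
  rw [Option.eq_some_iff_get_eq]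
  exact ⟨fun ⟨_, h⟩ => h, fun h => ⟨hσ j j.2, h⟩⟩

/-- A schedule that satisfies the invariant has almost the quality of an LPT schedule. -/
theorem CallInv.optLoad_le (hp : ∀ j, 0 < p j) (hm : 0 < m) (hK : 16 ≤ K) {σ : Sched m}
    (h : CallInv K (fun j => rounded K (p j)) n σ) :
    optLoad m p n
      ≤ ((4 * (m : ℝ) - 2) / (3 * (m : ℝ) - 1) + 16 * (1 / (K : ℝ))) * minLoad p n σ := by
  have hK1 : 1 ≤ K := by omega
  have hKR : (16 : ℝ) ≤ K := by exact_mod_cast hK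
  have hmR : (1 : ℝ) ≤ m := by exact_mod_cast hm
  have : Nonempty (Fin m) := ⟨⟨0, hm⟩⟩
  set q : ℕ → ℝ := fun j => rounded K (p j) with hqdef
  have hq : ∀ j, 0 < q j := fun j => rounded_pos (hp j)
  have hqp : ∀ j, q j ≤ p j := fun j => rounded_le hK1 _
  have hpq : ∀ j, p j ≤ (1 + 1 / K) * q j := fun j => le_rounded hK1 (hp j)
  have hle : ∀ (σ : Sched m) i, mload q (Finset.range n) σ i ≤ mload p (Finset.range n) σ i :=
    fun σ i => Finset.sum_le_sum fun j _ => hqp j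
  obtain ⟨σL, i', h1, h2, h3, h4⟩ := h.near
  set τL := mload q (Finset.range n) σL i' with hτL
  set lo := lowThreshold K (τL + τL) with hlo
  have hτ0 : 0 ≤ τL := mload_nonneg (fun j _ => (hq j).le) _ _
  set OPT := optLoad m p n with hOPT
  have hτOPT : τL ≤ OPT := le_optLoad hm h1 fun i => (h3 i).trans (hle σL i)
  have hKlo : K * lo ≤ 4 * OPT := by
    have := mul_lowThreshold_le (F := ℝ) hK1 (UB := τL + τL) (by linarith)
    linarith
  obtain ⟨i₀, -, hi₀⟩ := Finset.exists_min_image (Finset.univ : Finset (Fin m))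
    (mload q (Finset.range n) σ) ⟨i', Finset.mem_univ _⟩
  set ℓ := mload q (Finset.range n) σ i₀ with hℓ
  have hℓ0 : 0 ≤ ℓ := mload_nonneg (fun j _ => (hq j).le) _ _
  have hlo0 : 0 ≤ lo := lowThreshold_nonneg _
  have hℓmin : ℓ ≤ minLoad p n σ := by
    rw [minLoad_eq]
    exact le_ciInf fun i => (hi₀ i (Finset.mem_univ i)).trans (hle σ i)
  obtain ⟨τ, hτ⟩ := exists_optLoad_eq hm p n
  set x : ℝ := 1 / K with hx
  have hx0 : 0 < x := by positivity
  have hx16 : x ≤ 1 / 16 := one_div_le_one_div_of_le (by norm_num) hKR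
  have hxK : x * K = 1 := by
    rw [hx]
    field_simp
  have hT : ∀ i, OPT / (1 + x) ≤ mload q (Finset.range n) τ i := fun i => by
    rw [div_le_iff₀ (by positivity)]
    refine (hτ i).trans ?_
    rw [mul_comm, mload, mload, Finset.mul_sum]
    exact Finset.sum_le_sum fun j _ => hpq j
  have key := cover_bound (σ := σ) (W := ℓ + lo) (T := OPT / (1 + x)) (i₀ := i₀) (Finset.range n)
    Finset.univ Finset.univ τ rfl (fun j _ => hq j) (fun j hj => by
      obtain ⟨i, hi⟩ := Option.isSome_iff_exists.1 ((h.isSome j).2 (Finset.mem_range.1 hj))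
      exact ⟨i, Finset.mem_univ i, hi⟩) (Finset.mem_univ _) (by linarith) (fun i _ => by
      by_cases hi : ∃ j ∈ Finset.range n, σ j = some i ∧ q j < lo
      · exact Or.inl (h4.small i hi i₀)
      · push Not at hi
        refine Or.inr fun j hj hji => ?_
        have hjlo := hi j hj hji
        have := h4.stable j (mem_atLeast.2 ⟨hj, hjlo⟩)
        intro l hl k hk
        have h5 := this l hl k hk
        rwa [atLeast_atLeast hjlo] at h5) fun i _ => hT i
  rw [Finset.card_univ, Fintype.card_fin] at key
  set R : ℝ := (4 * (m : ℝ) - 2) / (3 * (m : ℝ) - 1) with hR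
  have hden : 0 < 3 * (m : ℝ) - 1 := by linarith
  have hR0 : 0 ≤ R := div_nonneg (by linarith) hden.le
  have hR43 : R ≤ 4 / 3 := by
    rw [hR, div_le_iff₀ hden]
    linarith
  have h5 : OPT / (1 + x) ≤ R * (ℓ + lo) := by
    rw [hR, div_mul_eq_mul_div, le_div_iff₀ hden, mul_comm]
    exact key
  rw [div_le_iff₀ (by positivity)] at h5
  have hOPT0 : 0 ≤ OPT := hτ0.trans hτOPT
  have h6 : lo ≤ 4 * OPT * x := by
    calc lo = K * lo * x := by linear_combination (-lo) * hxK
      _ ≤ 4 * OPT * x := by gcongr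
  have h7 : R * lo * (1 + x) ≤ 6 * x * OPT := by
    calc R * lo * (1 + x) ≤ 4 / 3 * (4 * OPT * x) * (1 + 1 / 16) := by gcongr
      _ ≤ 6 * x * OPT := by nlinarith [mul_nonneg hx0.le hOPT0]
  have hRℓ : 0 ≤ R * ℓ := mul_nonneg hR0 hℓ0
  have h8 : (1 - 6 * x) * OPT ≤ (1 - 6 * x) * ((1 + 12 * x) * (R * ℓ)) := by
    have h9 : (1 + x) * (R * ℓ) ≤ (1 - 6 * x) * (1 + 12 * x) * (R * ℓ) := by
      refine mul_le_mul_of_nonneg_right ?_ hRℓ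
      nlinarith
    linarith
  have h9 : OPT ≤ (1 + 12 * x) * (R * ℓ) := le_of_mul_le_mul_left h8 (by linarith)
  calc OPT ≤ (1 + 12 * x) * (R * ℓ) := h9
    _ = (R + 12 * x * R) * ℓ := by ring
    _ ≤ (R + 16 * x) * ℓ := mul_le_mul_of_nonneg_right (by nlinarith) hℓ0
    _ ≤ (R + 16 * x) * minLoad p n σ := by gcongr

theorem isCompetitive (hm : 1 ≤ m) (hK : 16 ≤ K) :
    IsCompetitive m K ((4 * (m : ℝ) - 2) / (3 * (m : ℝ) - 1) + 16 * (1 / (K : ℝ))) := by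
  intro p hp ω
  choose V hV using fun n => exists_callBound m K p n
  obtain ⟨S, T, h1, h2⟩ := exists_produces hp hm (by omega) hV ω
  exact ⟨S, T, h1, fun n => ⟨(h2 n).2.1.isSome, (h2 n).2.1.optLoad_le hp hm hK⟩⟩

theorem one_add_clog_mul_le (hK : 2 ≤ K) :
    (((1 + Nat.clog 2 K) * K : ℕ) : ℝ) + 1 ≤ 8 * (K * Real.log K) := by
  have hKR : (2 : ℝ) ≤ K := by exact_mod_cast hK
  have hlog2 : (0.6 : ℝ) < Real.log 2 := lt_trans (by norm_num) Real.log_two_gt_d9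
  have hlog : Real.log 2 ≤ Real.log K := Real.log_le_log two_pos hKR
  have h1 : 2 ^ (Nat.clog 2 K - 1) < K := Nat.pow_pred_clog_lt_self one_lt_two (by omega)
  have hc : 1 ≤ Nat.clog 2 K := Nat.clog_pos one_lt_two hK
  have h2 : ((Nat.clog 2 K : ℝ) - 1) * Real.log 2 ≤ Real.log K := by
    have h3 : ((2 : ℝ) ^ (Nat.clog 2 K - 1)) ≤ K := by exact_mod_cast h1.le
    have h4 := Real.log_le_log (by positivity) h3
    rwa [Real.log_pow, Nat.cast_sub hc, Nat.cast_one] at h4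
  have hc' : (1 : ℝ) ≤ Nat.clog 2 K := by exact_mod_cast hc
  push_cast
  have h5 : (Nat.clog 2 K : ℝ) ≤ 1 + Real.log K / 0.6 := by
    rw [← sub_le_iff_le_add', le_div_iff₀ (by norm_num)]
    nlinarith
  have h6 : (1 : ℝ) ≤ Real.log K / 0.6 := by
    rw [le_div_iff₀ (by norm_num)]
    linarith
  have h7 : (1 + (Nat.clog 2 K : ℝ)) * K ≤ (2 + Real.log K / 0.6) * K :=
    mul_le_mul_of_nonneg_right (by linarith) (by linarith)
  have h8 : Real.log K / 0.6 ≤ 5 / 3 * Real.log K := by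
    rw [div_le_iff₀ (by norm_num)]
    linarith
  nlinarith

theorem hasMigrationFactor (hm : 1 ≤ m) (hK : 2 ≤ K) :
    HasMigrationFactor m K (160 * ((K : ℝ) ^ 3 * Real.log K)) := by
  intro p hp ω
  choose V hV using fun n => exists_callBound m K p n
  obtain ⟨S, T, h1, h2⟩ := exists_produces hp hm hK hV ω
  refine ⟨S, T, h1, fun n => ⟨(h2 n).2.1.isSome, ?_⟩⟩
  have hK1 : 1 ≤ K := by omega
  have hKR : (2 : ℝ) ≤ K := by exact_mod_cast hK
  have h3 := (h2 n).2.2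
  have h4 : ∀ j, p j ≤ 2 * rounded K (p j) := fun j => by
    have h5 := le_rounded hK1 (hp j)
    have h6 := rounded_pos (K := K) (hp j)
    have h7 : (1 : ℝ) / K ≤ 1 := by
      rw [div_le_one (by linarith)]
      linarith
    nlinarith
  have h5 := one_add_clog_mul_le hK
  have hlog : 0 ≤ Real.log K := Real.log_nonneg (by linarith)
  have h6 := rounded_pos (K := K) (hp n)
  calc migrated p n (S n) (S (n + 1))
      = ∑ j ∈ (Finset.range n).filter (fun j => S n j ≠ S (n + 1) j), p j := by
        rw [migrated, Finset.sum_filter]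
    _ ≤ ∑ j ∈ (Finset.range n).filter (fun j => S n j ≠ S (n + 1) j), 2 * rounded K (p j) :=
        Finset.sum_le_sum fun j _ => h4 j
    _ = 2 * ∑ j ∈ (Finset.range n).filter (fun j => S n j ≠ S (n + 1) j), rounded K (p j) := by
        rw [Finset.mul_sum]
    _ ≤ 2 * (10 * (K : ℝ) ^ 2 * (((1 + Nat.clog 2 K) * K : ℕ) + 1) * rounded K (p n)) := by
        gcongr
    _ ≤ 2 * (10 * (K : ℝ) ^ 2 * (8 * (K * Real.log K)) * p n) := by
        gcongr
        exact rounded_le hK1 _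
    _ = _ := by ring

theorem runsInTime (hm : 1 ≤ m) (hK : 2 ≤ K) :
    RunsInTime m K fun N => (1000 * (N + 1) ^ 2) ^ 38 := by
  intro p hp ω
  obtain ⟨S, T, h1, h2⟩ := exists_produces hp hm hK (V := fun n =>
    1000 * (m + K + ∑ j ∈ Finset.range (n + 1), bitSize (p j) + 1) ^ 2) (size := bitSize)
    (fun n => by
      have h3 : n + 1 ≤ ∑ j ∈ Finset.range (n + 1), bitSize (p j) := by
        have := Finset.card_nsmul_le_sum (Finset.range (n + 1)) (fun j => bitSize (p j)) 1
          fun j _ => one_le_bitSize _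
        simpa using this
      have h4 : ∀ j ≤ n, bitSize (p j) ≤ ∑ j ∈ Finset.range (n + 1), bitSize (p j) := fun j hj =>
        Finset.single_le_sum (f := fun j => bitSize (p j)) (fun _ _ => Nat.zero_le _)
          (Finset.mem_range.2 (Nat.lt_succ_of_le hj))
      refine callBound_rat hp (N := m + K + ∑ j ∈ Finset.range (n + 1), bitSize (p j))
        (by omega) (by omega) (by omega) (by omega) (fun j hj => ?_) le_rfl
      have := h4 j hj
      omega) ω
  exact ⟨S, T, h1, fun n => (h2 n).1⟩

end Competitive

end OnlineLPT

theorem IsCompetitive.mono {m K : ℕ} {ρ ρ' : ℝ} (h : IsCompetitive m K ρ) (hρ : ρ ≤ ρ') :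
    IsCompetitive m K ρ' := by
  intro p hp ω
  obtain ⟨S, T, h1, h2⟩ := h p hp ω
  exact ⟨S, T, h1, fun n => ⟨(h2 n).1, (h2 n).2.trans
    (mul_le_mul_of_nonneg_right hρ (OnlineLPT.minLoad_nonneg hp _))⟩⟩

theorem HasMigrationFactor.mono {m K : ℕ} {β β' : ℝ} (h : HasMigrationFactor m K β)
    (hβ : β ≤ β') : HasMigrationFactor m K β' := by
  intro p hp ω
  obtain ⟨S, T, h1, h2⟩ := h p hp ω
  exact ⟨S, T, h1, fun n => ⟨(h2 n).1, (h2 n).2.trans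
    (mul_le_mul_of_nonneg_right hβ (hp n).le)⟩⟩

theorem theorem4 :
    (∃ f : Polynomial ℕ, ∀ m K : ℕ, 1 ≤ m → 2 ≤ K → RunsInTime m K (fun N => f.eval N)) ∧
    (∃ C ε₀ : ℝ, 0 < ε₀ ∧ ∀ m K : ℕ, 1 ≤ m → 2 ≤ K → 1 / (K : ℝ) ≤ ε₀ →
      IsCompetitive m K ((4 * (m : ℝ) - 2) / (3 * (m : ℝ) - 1) + C * (1 / (K : ℝ)))) ∧
    (∃ C : ℝ, ∀ m K : ℕ, 1 ≤ m → 2 ≤ K →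
      HasMigrationFactor m K (C * ((K : ℝ) ^ 3 * Real.log (K : ℝ)))) ∧
    (∃ C : ℝ, ∀ δ : ℝ, 0 < δ → δ ≤ 1 / 2 → ∃ K : ℕ, 2 ≤ K ∧ (K : ℝ) ≤ C / δ ∧
      ∀ m : ℕ, 1 ≤ m → IsCompetitive m K (4 / 3 + δ) ∧
        HasMigrationFactor m K (C * ((1 / δ) ^ 3 * Real.log (1 / δ)))) := by
  refine ⟨⟨(1000 * (Polynomial.X + 1) ^ 2) ^ 38, fun m K hm hK => ?_⟩,
    ⟨16, 1 / 16, by norm_num, fun m K hm hK hε => OnlineLPT.isCompetitive hm ?_⟩,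
    ⟨160, fun m K hm hK => OnlineLPT.hasMigrationFactor hm hK⟩,
    ⟨160 * (17 ^ 3 * 6), fun δ hδ hδ2 => ⟨⌈16 / δ⌉₊, ?_⟩⟩⟩
  · have : (fun N => Polynomial.eval N ((1000 * (Polynomial.X + 1) ^ 2) ^ 38 : Polynomial ℕ))
        = fun N : ℕ => (1000 * (N + 1) ^ 2) ^ 38 := by
      funext N
      simp
    rw [this]
    exact OnlineLPT.runsInTime hm hK
  · have hK0 : (0 : ℝ) < K := by exact_mod_cast (by omega : 0 < K)
    have : (16 : ℝ) ≤ K := by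
      rw [div_le_div_iff₀ hK0 (by norm_num)] at hε
      linarith
    exact_mod_cast this
  · set K := ⌈16 / δ⌉₊ with hK
    have h1 : 16 / δ ≤ K := Nat.le_ceil _
    have h2 : (K : ℝ) < 16 / δ + 1 := Nat.ceil_lt_add_one (by positivity)
    have h3 : 2 ≤ 1 / δ := by
      rw [le_div_iff₀ hδ]
      linarith
    have h4 : 16 / δ = 16 * (1 / δ) := by ring
    have hK32 : (32 : ℝ) ≤ K := by linarith
    have hK16 : 16 ≤ K := by exact_mod_cast (by linarith : (16 : ℝ) ≤ K)
    have hK17 : (K : ℝ) ≤ 17 * (1 / δ) := by linarith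
    have hlog0 : 0 ≤ Real.log K := Real.log_nonneg (by linarith)
    have hlogδ : Real.log 2 ≤ Real.log (1 / δ) := Real.log_le_log two_pos h3
    have hlog : Real.log K ≤ 6 * Real.log (1 / δ) := by
      calc Real.log K ≤ Real.log (2 ^ 5 * (1 / δ)) :=
            Real.log_le_log (by linarith) (by linarith)
        _ = 5 * Real.log 2 + Real.log (1 / δ) := by
            rw [Real.log_mul (by norm_num) (by positivity), Real.log_pow]
            norm_num
        _ ≤ 6 * Real.log (1 / δ) := by linarith
    refine ⟨by omega, ?_, fun m hm => ⟨?_, ?_⟩⟩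
    · refine hK17.trans ?_
      rw [mul_one_div]
      gcongr
      norm_num
    · refine (OnlineLPT.isCompetitive hm hK16).mono (add_le_add ?_ ?_)
      · have hmR : (1 : ℝ) ≤ m := by exact_mod_cast hm
        rw [div_le_iff₀ (by linarith)]
        linarith
      · rw [div_le_iff₀ hδ] at h1
        rw [mul_one_div, div_le_iff₀ (by linarith)]
        linarith
    · refine (OnlineLPT.hasMigrationFactor hm (by omega)).mono ?_
      calc 160 * ((K : ℝ) ^ 3 * Real.log K)
          ≤ 160 * ((17 * (1 / δ)) ^ 3 * (6 * Real.log (1 / δ))) := by gcongr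
        _ = _ := by ring
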